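/- Let $\mathcal M$ be an oriented matroid on a finite ground set $E$ whose underlying matroid $M$ is loopless of rank $r\ge 1$, with a fixed chirotope $\chi$, and let $(\widetilde{\mathcal M},\star)$ be a general extension of $\mathcal M$: an oriented matroid on $E\sqcup\{\star\}$ with $\widetilde{\mathcal M}\setminus\star=\mathcal M$ and $\mathrm{rk}(S\cup\star)=\min(\mathrm{rk}(S)+1,r)$ for all $S\subseteq E$. Let $\mathcal T$ be the set of topes of $\mathcal M$, and let $\mathcal T^\star\subseteq\mathcal T$ be the set of topes $P$ such that $(+,P)$ is a tope of $\widetilde{\mathcal M}$ that is bounded with respect to $\star$, i.e. every nonzero covector $Y$ that is a face of $(+,P)$ has $Y(\star)=+$. For a basis $B$ of $M$ let $C_B$ be the signed circuit of $\widetilde{\mathcal M}$ with support $B\cup\star$ and $C_B(\star)=-$; put $\mathcal T^B=\{P\in\mathcal T : P|_B=C_B|_B\}$ and $\mathcal B(P,Q)=\{B \text{ a basis of } M : P,Q\in\mathcal T^B\}$. Let $A^\bullet(M)=\Lambda^\bullet(E)/(\partial e_S : S\subseteq E\text{ dependent})$ be the Orlik–Solomon algebra over $\mathbb Z$, where $\partial(e_1\wedge\cdots\wedge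 e_k)=\sum_i(-1)^{k-i}e_1\wedge\cdots\widehat{e_i}\cdots\wedge e_k$, and let $A(M)=A^r(M)$. For a rank-one flat $c$, let $\mathrm{Res}_c:A^\bullet(M)\to A^{\bullet-1}(M/c)$ be the linear map with $\mathrm{Res}_c(\omega\wedge e)=\omega$ and $\mathrm{Res}_c(\omega)=0$ for $e\in c$ and $\omega$ a monomial in generators outside $c$. For a complete flag of flats $F_\bullet=(F_0\subset F_1\subset\cdots\subset F_r=E)$ with $\mathrm{rk}\,F_i=i$, let $\mathrm{Res}_{F_\bullet}=\mathrm{Res}_{F_r/F_{r-1}}\circ\cdots\circ\mathrm{Res}_{F_1}:A(M)\to A^0(M/F_r)\cong\mathbb Z$. Let $a_e$ ($e\in E$) be indeterminates, $a_S=\sum_{e\in S}a_e$ and $a^S=\prod_{e\in S}a_e$. Define bilinear forms on $A(M)$ with values in $\mathbb Q(a_e:e\in E)$ by $$\langle x,y\rangle^{dR}=\sum_{F_\bullet}\mathrm{Res}_{F_\bullet}(x)\Big(\prod_{i=1}^{r-1}\frac1{a_{F_i}}\Big)\mathrm{Res}_{F_\bullet}(y),\qquad \langle x,y\rangle'^{dR}=\sum_{F_\bullet}\mathrm{Res}_{F_\bullet}(x)\Big(\prod_{i=1}^{r}\frac1{a_{F_i}}\Big)\mathrm{Res}_{F_\bullet}(y),$$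 and for $P,Q\in\mathcal T^\star$ let $\langle P,Q\rangle_{dR}=\sum_{B\in\mathcal B(P,Q)}a^B$. For each $P\in\mathcal T$ there is a unique canonical form $\Omega_P\in A(M)$, characterized by the following recursion on the rank. In rank $0$, $\Omega_P=\chi(\emptyset)\in A^0\cong\mathbb Z$. In rank $r\ge1$, for every rank-one flat $c$ and every $e\in c$: $\mathrm{Res}_c\Omega_P=P(e)\,\Omega_{P|_{E\setminus c}}$, computed in $\mathcal M/c$ with chirotope $(e_1,\dots,e_{r-1})\mapsto\chi(e_1,\dots,e_{r-1},e)$, if $c$ is the zero set of a covector that is a face of $P$; and $\mathrm{Res}_c\Omega_P=0$ otherwise. Theorem. The canonical forms $\{\Omega_P : P\in\mathcal T^\star\}$ are a $\mathbb Z$-basis of $A(M)$. In this basis, the matrix $\frac1{a_E}\big(\langle P,Q\rangle_{dR}\big)_{P,Q\in\mathcal T^\star}$ is the (two-sided) inverse of the matrix $\big(\langle\Omega_P,\Omega_Q\rangle^{dR}\big)_{P,Q\in\mathcal T^\star}$, and the matrix $\big(\langle P,Q\rangle_{dR}\big)_{P,Q\in\mathcal T^\star}$ is the inverse of the matrix $\big(\langle\Omega_P,\Omega_Q\rangle'^{dR}\big)_{P,Q\in\mathcal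 T^\star}$. -/

import Mathlib

open scoped BigOperators

noncomputable section

namespace OMForms

/-! ## Sign vectors and oriented matroids -/

section SignVectors

variable {α : Type*}

/-- The composition `X ∘ Y` of sign vectors: `X e` where `X e ≠ 0`, and `Y e` elsewhere. -/
def signComp (X Y : α → SignType) : α → SignType :=
  fun e => if X e = 0 then Y e else X e

/-- `Y` is a face of `X`: it is obtained from `X` by setting some entries to `0`. -/
def IsSignFace (Y X : α → SignType) : Prop :=
  ∀ e, Y e ≠ 0 → Y e = X e

/-- Orthogonality of sign vectors: the products `X e * Y e` all vanish, or both signs occur. -/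
def SignOrthogonal (X Y : α → SignType) : Prop :=
  (∀ e, X e * Y e = 0) ∨ ((∃ e, X e * Y e = 1) ∧ ∃ e, X e * Y e = -1)

end SignVectors

/-- An oriented matroid on a finite ground set `E ⊆ α`, given by its signed covectors and the
covector axioms. A sign vector on `E` is represented by its extension by `0` to `α`. -/
structure OrientedMatroid (α : Type*) where
  /-- the ground set -/
  E : Set α
  finite_E : E.Finite
  /-- the signed covectors -/
  covectors : Set (α → SignType)
  mem_E : ∀ X ∈ covectors, ∀ e, X e ≠ 0 → e ∈ E
  zero_mem : (0 : α → SignType) ∈ covectors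
  neg_mem : ∀ X ∈ covectors, -X ∈ covectors
  comp_mem : ∀ X ∈ covectors, ∀ Y ∈ covectors, signComp X Y ∈ covectors
  elim : ∀ X ∈ covectors, ∀ Y ∈ covectors, ∀ e, X e ≠ 0 → Y e = -X e →
    ∃ Z ∈ covectors, Z e = 0 ∧ ∀ f, ¬(X f ≠ 0 ∧ Y f = -X f) → Z f = signComp X Y f

namespace OrientedMatroid

variable {α : Type*} (𝓜 : OrientedMatroid α)

/-- The closure of `S`: all ground set elements at which every covector vanishing on `S` vanishes
(the smallest zero set of a covector that contains `S`). -/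
def cl (S : Set α) : Set α :=
  {e | e ∈ 𝓜.E ∧ ∀ X ∈ 𝓜.covectors, (∀ f ∈ S, X f = 0) → X e = 0}

/-- Independence in the underlying matroid: no element of `I` lies in the closure of the others. -/
def IsIndep (I : Set α) : Prop :=
  I ⊆ 𝓜.E ∧ ∀ e ∈ I, e ∉ 𝓜.cl (I \ {e})

variable {𝓜}

theorem notMem_cl_iff {S : Set α} {e : α} (he : e ∈ 𝓜.E) :
    e ∉ 𝓜.cl S ↔ ∃ X ∈ 𝓜.covectors, (∀ f ∈ S, X f = 0) ∧ X e ≠ 0 := by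
  simp [cl, he]

theorem cl_mono {S T : Set α} (h : S ⊆ T) : 𝓜.cl S ⊆ 𝓜.cl T :=
  fun _ he => ⟨he.1, fun X hX h0 => he.2 X hX fun f hf => h0 f (h hf)⟩

theorem cl_subset_of_subset_cl {S T : Set α} (h : S ⊆ 𝓜.cl T) : 𝓜.cl S ⊆ 𝓜.cl T :=
  fun _ he => ⟨he.1, fun X hX h0 => he.2 X hX fun _ hf => (h hf).2 X hX h0⟩

theorem subset_cl {S : Set α} (h : S ⊆ 𝓜.E) : S ⊆ 𝓜.cl S :=
  fun e he => ⟨h he, fun _ _ h0 => h0 e he⟩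

theorem exists_covector_sep {S : Set α} {e f : α} (he : e ∈ 𝓜.E) (hf : f ∈ 𝓜.E)
    (heS : e ∉ 𝓜.cl S) (hfS : f ∉ 𝓜.cl (insert e S)) : e ∉ 𝓜.cl (insert f S) := by
  obtain ⟨X, hX, hX0, hXf⟩ := (notMem_cl_iff hf).1 hfS
  obtain ⟨Y, hY, hY0, hYe⟩ := (notMem_cl_iff he).1 heS
  have hXe : X e = 0 := hX0 e (Set.mem_insert _ _)
  rw [notMem_cl_iff he]
  by_cases hYf : Y f = 0
  · exact ⟨Y, hY, by rintro g (rfl | hg); exacts [hYf, hY0 g hg], hYe⟩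
  obtain ⟨Y', hY', hY0', hYe', hYf'⟩ : ∃ Y' ∈ 𝓜.covectors, (∀ g ∈ S, Y' g = 0) ∧ Y' e ≠ 0 ∧
      Y' f = -X f := by
    by_cases hs : Y f = -X f
    · exact ⟨Y, hY, hY0, hYe, hs⟩
    · refine ⟨-Y, 𝓜.neg_mem Y hY, fun g hg => by simp [hY0 g hg], by simpa using hYe, ?_⟩
      simp only [Pi.neg_apply]
      generalize Y f = a at *
      generalize X f = b at *
      revert a b; decide
  obtain ⟨Z, hZ, hZf, hZ'⟩ := 𝓜.elim X hX Y' hY' f hXf hYf'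
  refine ⟨Z, hZ, ?_, ?_⟩
  · rintro g (rfl | hg)
    · exact hZf
    · have := hX0 g (Set.mem_insert_of_mem _ hg)
      rw [hZ' g (by simp [this])]
      simp [signComp, this, hY0' g hg]
  · rw [hZ' e (by simp [hXe])]
    simpa [signComp, hXe] using hYe'

theorem IsIndep.subset {I J : Set α} (hJ : 𝓜.IsIndep J) (h : I ⊆ J) : 𝓜.IsIndep I :=
  ⟨h.trans hJ.1, fun e he hcl =>
    hJ.2 e (h he) (cl_mono (Set.sdiff_subset_sdiff_left h) hcl)⟩

theorem isIndep_insert {I : Set α} {e : α} (hI : 𝓜.IsIndep I) (he : e ∈ 𝓜.E)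
    (hcl : e ∉ 𝓜.cl I) : 𝓜.IsIndep (insert e I) := by
  have heI : e ∉ I := fun h => hcl (subset_cl hI.1 h)
  refine ⟨Set.insert_subset he hI.1, ?_⟩
  rintro f (rfl | hf)
  · rwa [Set.insert_sdiff_self_of_notMem heI]
  · have hne : f ≠ e := fun h => heI (h ▸ hf)
    have h1 : insert e I \ {f} = insert e (I \ {f}) := by
      ext x; simp only [Set.mem_sdiff, Set.mem_insert_iff, Set.mem_singleton_iff]
      constructor
      · rintro ⟨rfl | h, h'⟩ <;> tauto
      · rintro (rfl | h)
        · exact ⟨Or.inl rfl, fun h => hne h.symm⟩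
        · tauto
    rw [h1]
    refine exists_covector_sep (hI.1 hf) he (hI.2 f hf) ?_
    rwa [Set.insert_sdiff_singleton, Set.insert_eq_of_mem hf]

theorem IsIndep.ncard_le {I : Set α} (hI : I ⊆ 𝓜.E) :
    ∀ (n : ℕ) (J : Set α), (J \ I).ncard = n → 𝓜.IsIndep J → J ⊆ 𝓜.cl I → J.ncard ≤ I.ncard := by
  have hIf : I.Finite := 𝓜.finite_E.subset hI
  intro n
  induction n with
  | zero =>
    intro J hn hJ _
    have hJf : J.Finite := 𝓜.finite_E.subset hJ.1
    have : J \ I = ∅ := (Set.ncard_eq_zero hJf.sdiff).1 hn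
    exact Set.ncard_le_ncard (Set.sdiff_eq_empty.1 this) hIf
  | succ n ih =>
    intro J hn hJ hJI
    have hJf : J.Finite := 𝓜.finite_E.subset hJ.1
    obtain ⟨j, hjJ, hjI⟩ : (J \ I).Nonempty := by
      rw [Set.nonempty_iff_ne_empty]; intro h; simp [h] at hn
    obtain ⟨i, hiI, hi⟩ : ∃ i ∈ I, i ∉ 𝓜.cl (J \ {j}) := by
      by_contra hcon
      push Not at hcon
      exact hJ.2 j hjJ (cl_subset_of_subset_cl hcon (hJI hjJ))
    have hiJ' : i ∉ J \ {j} := fun h => hi (subset_cl ((Set.sdiff_subset).trans hJ.1) h)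
    have hind : 𝓜.IsIndep (insert i (J \ {j})) :=
      isIndep_insert (hJ.subset Set.sdiff_subset) (hI hiI) hi
    have hcard : (insert i (J \ {j})).ncard = J.ncard := by
      rw [Set.ncard_insert_of_notMem hiJ' hJf.sdiff, Set.ncard_sdiff_singleton_add_one hjJ hJf]
    rw [← hcard]
    refine ih _ ?_ hind ?_
    · have h1 : insert i (J \ {j}) \ I = (J \ I) \ {j} := by
        ext x; simp only [Set.mem_sdiff, Set.mem_insert_iff, Set.mem_singleton_iff]
        constructor
        · rintro ⟨rfl | h, h'⟩
          · exact absurd hiI h'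
          · tauto
        · tauto
      have h2 := Set.ncard_sdiff_singleton_add_one (s := J \ I) ⟨hjJ, hjI⟩ hJf.sdiff
      rw [h1]; omega
    · exact Set.insert_subset (subset_cl hI hiI) (Set.sdiff_subset.trans hJI)

variable (𝓜)

/-- The underlying matroid. Its closure operator is `cl`, so its flats are the zero sets of the
covectors. -/
def matroid : Matroid α :=
  (IndepMatroid.ofFinite 𝓜.finite_E 𝓜.IsIndep
    ⟨Set.empty_subset _, fun _ he => he.elim⟩
    (fun _ _ hJ h => hJ.subset h)
    (fun I J hI hJ hlt => by
      by_contra hcon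
      push Not at hcon
      refine absurd (IsIndep.ncard_le hI.1 _ J rfl hJ fun e he => ?_) (not_le.2 hlt)
      by_contra hcl
      exact hcon e he (fun h => hcl (subset_cl hI.1 h)) (isIndep_insert hI (hJ.1 he) hcl))
    (fun _ hI => hI.1)).matroid

/-- A tope is a covector that is not a proper face of another covector. -/
def IsTope (P : α → SignType) : Prop :=
  P ∈ 𝓜.covectors ∧ ∀ Y ∈ 𝓜.covectors, IsSignFace P Y → Y = P

/-- `χ` is a chirotope of `𝓜`, of rank `r`: an alternating sign function, nonzero exactly on the
ordered bases, such that every covector vanishing on all but one of the entries of `x` is, up to a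
global sign, the function obtained from `χ x` by varying that entry. -/
structure IsChirotope {r : ℕ} (χ : (Fin r → α) → SignType) : Prop where
  ne_zero_iff : ∀ x, χ x ≠ 0 ↔ Function.Injective x ∧ 𝓜.matroid.IsBase (Set.range x)
  alternating : ∀ x (σ : Equiv.Perm (Fin r)),
    χ (x ∘ σ) = SignType.sign (Equiv.Perm.sign σ : ℤ) * χ x
  compatible : ∀ (x : Fin r → α) (i : Fin r) (e : α), ∀ X ∈ 𝓜.covectors,
    (∀ j, j ≠ i → X (x j) = 0) → X e * χ x = X (x i) * χ (Function.update x i e)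

/-- `C` is a signed circuit: its support is a circuit of the underlying matroid and it is orthogonal
to every covector. -/
def IsSignedCircuit (C : α → SignType) : Prop :=
  𝓜.matroid.IsCircuit {e | C e ≠ 0} ∧ ∀ X ∈ 𝓜.covectors, SignOrthogonal C X

variable {𝓜}

/-- `𝓝` is a general extension of `𝓜` by the element `star`: the deletion of `star` from `𝓝` is
`𝓜`, and `star` is in general position in `𝓝`, where `rk (S ∪ star) = min (rk S + 1) r` with `r` the
rank of `𝓜` (so that, taking `S = E`, the extension does not change the rank). -/
structure IsGeneralExtension [DecidableEq α] (𝓝 : OrientedMatroid α) (star : α)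
    (𝓜 : OrientedMatroid α) : Prop where
  star_notMem : star ∉ 𝓜.E
  ground_eq : 𝓝.E = insert star 𝓜.E
  covectors_eq : 𝓜.covectors = (fun X => Function.update X star 0) '' 𝓝.covectors
  general : ∀ S ⊆ 𝓜.E,
    𝓝.matroid.eRk (insert star S) = min (𝓝.matroid.eRk S + 1) 𝓜.matroid.eRank

variable (𝓜)

/-- The tope or covector `X` is bounded with respect to the element `star`: every nonzero face `Y`
of `X` has `Y star = +`. -/
def IsBounded (star : α) (X : α → SignType) : Prop :=
  ∀ Y ∈ 𝓜.covectors, Y ≠ 0 → IsSignFace Y X → Y star = 1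

end OrientedMatroid

/-- The set `𝓣^⋆` of topes `P` of `𝓜` such that `(+, P)` is a bounded tope of the extension `𝓝`
of `𝓜` by `star`. -/
def boundedTopes {α : Type*} [DecidableEq α] (𝓝 : OrientedMatroid α) (star : α)
    (𝓜 : OrientedMatroid α) : Set (α → SignType) :=
  {P | 𝓜.IsTope P ∧ 𝓝.IsTope (Function.update P star 1) ∧
    𝓝.IsBounded star (Function.update P star 1)}

/-- The set `𝓣^B` of topes `P` of `𝓜` in the bounded part of `B`: `P` agrees on `B` with the signed
fundamental circuit `C` of `𝓝` on `B ∪ star` normalised by `C star = -`. -/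
def topesInBasis {α : Type*} (𝓝 : OrientedMatroid α) (star : α) (𝓜 : OrientedMatroid α)
    (B : Set α) : Set (α → SignType) :=
  {P | 𝓜.IsTope P ∧ ∃ C, 𝓝.IsSignedCircuit C ∧ {e | C e ≠ 0} = insert star B ∧ C star = -1 ∧
    ∀ b ∈ B, P b = C b}

/-! ## The Orlik–Solomon algebra -/

section OrlikSolomon

variable {α : Type*}

/-- The exterior algebra over `ℤ` on generators indexed by `α`. -/
abbrev ExtAlg (α : Type*) : Type _ := ExteriorAlgebra ℤ (α →₀ ℤ)

/-- The generator of the exterior algebra attached to `a`. -/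
def gen (a : α) : ExtAlg α := ExteriorAlgebra.ι ℤ (Finsupp.single a 1)

/-- `e_S = e_{s_k} ∧ ⋯ ∧ e_{s_1}` for the ordered set `S = (s_1, …, s_k)`. -/
def extMonomial (s : List α) : ExtAlg α := (s.reverse.map gen).prod

/-- The functional with value `1` on the generators in `c` and `0` on the others. -/
def indicatorDual (c : Set α) : Module.Dual ℤ (α →₀ ℤ) :=
  Finsupp.linearCombination ℤ (c.indicator (fun _ => (1 : ℤ)))

/-- Contraction from the right with the functional `indicatorDual c`, that is, the map
`e_1 ∧ ⋯ ∧ e_k ↦ ∑ (-1)^(k-i) e_1 ∧ ⋯ ∧ ê_i ∧ ⋯ ∧ e_k`, the sum being over all `i` with `e_i ∈ c`. -/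
def contractGens (c : Set α) : ExtAlg α →ₗ[ℤ] ExtAlg α :=
  CliffordAlgebra.contractRight.flip (indicatorDual c)

/-- The differential `∂ (e_1 ∧ ⋯ ∧ e_k) = ∑ (-1)^(k-i) e_1 ∧ ⋯ ∧ ê_i ∧ ⋯ ∧ e_k`. -/
def extDiff : ExtAlg α →ₗ[ℤ] ExtAlg α := contractGens Set.univ

/-- The relations of the Orlik–Solomon algebra: `∂ e_S` for all dependent `S ⊆ E`. The generators
outside the ground set `E` are set to zero as well, which reduces the exterior algebra on `α` to the
exterior algebra on `E`. -/
def osRelations (M : Matroid α) : Set (ExtAlg α) :=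
  {x | ∃ a ∉ M.E, x = gen a} ∪
    {x | ∃ s : List α, s.Nodup ∧ M.Dep {a | a ∈ s} ∧ x = extDiff (extMonomial s)}

/-- The Orlik–Solomon ideal. -/
def osIdeal (M : Matroid α) : Ideal (ExtAlg α) :=
  (TwoSidedIdeal.span (osRelations M)).asIdeal

instance (M : Matroid α) : (osIdeal M).IsTwoSided :=
  inferInstanceAs (TwoSidedIdeal.asIdeal _).IsTwoSided

/-- The Orlik–Solomon algebra `A^•(M)`. -/
abbrev OS (M : Matroid α) : Type _ := ExtAlg α ⧸ osIdeal M

/-- The quotient map onto the Orlik–Solomon algebra. -/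
def osMk (M : Matroid α) : ExtAlg α →ₗ[ℤ] OS M :=
  ((osIdeal M).mkQ).restrictScalars ℤ

/-- A `ℤ`-linear map on the exterior algebra that kills the Orlik–Solomon ideal descends. -/
def osLift (M : Matroid α) {N : Type*} [AddCommGroup N] (f : ExtAlg α →ₗ[ℤ] N)
    (h : ∀ x ∈ osIdeal M, f x = 0) : OS M →ₗ[ℤ] N :=
  (((osIdeal M).restrictScalars ℤ).liftQ f fun x hx => h x hx) ∘ₗ
    (Submodule.Quotient.restrictScalarsEquiv ℤ (osIdeal M)).symm.toLinearMap

theorem osLift_osMk (M : Matroid α) {N : Type*} [AddCommGroup N] (f : ExtAlg α →ₗ[ℤ] N)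
    (h : ∀ x ∈ osIdeal M, f x = 0) (x : ExtAlg α) : osLift M f h (osMk M x) = f x := rfl

/-- The homogeneous component `A^k(M)`. -/
def osDegree (M : Matroid α) (k : ℕ) : Submodule ℤ (OS M) :=
  (⋀[ℤ]^k (α →₀ ℤ)).map (osMk M)


/-! ### The residue maps descend to the Orlik–Solomon algebras -/

theorem contractGens_mul_gen (c : Set α) (x : ExtAlg α) (a : α) :
    contractGens c (x * gen a) = c.indicator (fun _ => (1 : ℤ)) a • x - contractGens c x * gen a := by
  have h := CliffordAlgebra.contractRight_mul_ι (Q := (0 : QuadraticForm ℤ (α →₀ ℤ)))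
    (indicatorDual c) (Finsupp.single a 1) x
  have h2 : indicatorDual c (Finsupp.single a 1) = c.indicator (fun _ => (1 : ℤ)) a := by
    simp [indicatorDual]
  rw [h2] at h
  exact h

theorem contractGens_mul_gen_of_mem {c : Set α} (x : ExtAlg α) {a : α} (ha : a ∈ c) :
    contractGens c (x * gen a) = x - contractGens c x * gen a := by
  simp [contractGens_mul_gen, ha]

theorem contractGens_mul_gen_of_notMem {c : Set α} (x : ExtAlg α) {a : α} (ha : a ∉ c) :
    contractGens c (x * gen a) = -(contractGens c x * gen a) := by
  simp [contractGens_mul_gen, ha]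

theorem extDiff_mul_gen (x : ExtAlg α) (a : α) :
    extDiff (x * gen a) = x - extDiff x * gen a :=
  contractGens_mul_gen_of_mem x (Set.mem_univ a)

theorem contractGens_one (c : Set α) : contractGens c (1 : ExtAlg α) = 0 :=
  CliffordAlgebra.contractRight_one (Q := (0 : QuadraticForm ℤ (α →₀ ℤ))) (indicatorDual c)

theorem contractGens_extDiff (c : Set α) (x : ExtAlg α) :
    contractGens c (extDiff x) = -extDiff (contractGens c x) :=
  CliffordAlgebra.contractRight_comm (Q := (0 : QuadraticForm ℤ (α →₀ ℤ)))
    (indicatorDual Set.univ) (indicatorDual c) x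

/-- The grade involution. -/
def extInv : ExtAlg α →ₐ[ℤ] ExtAlg α :=
  CliffordAlgebra.involute (Q := (0 : QuadraticForm ℤ (α →₀ ℤ)))

theorem extInv_ι (v : α →₀ ℤ) : extInv (ExteriorAlgebra.ι ℤ v) = -ExteriorAlgebra.ι ℤ v :=
  CliffordAlgebra.involute_ι _

theorem contractGens_mul_ι (c : Set α) (x : ExtAlg α) (v : α →₀ ℤ) :
    contractGens c (x * ExteriorAlgebra.ι ℤ v) =
      indicatorDual c v • x - contractGens c x * ExteriorAlgebra.ι ℤ v :=
  CliffordAlgebra.contractRight_mul_ι (Q := (0 : QuadraticForm ℤ (α →₀ ℤ))) (indicatorDual c) v x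

theorem contractGens_algebraMap (c : Set α) (r : ℤ) :
    contractGens c (algebraMap ℤ (ExtAlg α) r) = 0 :=
  CliffordAlgebra.contractRight_algebraMap (Q := (0 : QuadraticForm ℤ (α →₀ ℤ))) (indicatorDual c) r

theorem contractGens_mul (c : Set α) (x y : ExtAlg α) :
    contractGens c (x * y) = x * contractGens c y + contractGens c x * extInv y := by
  induction y using CliffordAlgebra.right_induction with
  | algebraMap r =>
    change contractGens c (x * algebraMap ℤ (ExtAlg α) r) =
      x * contractGens c (algebraMap ℤ (ExtAlg α) r) +
        contractGens c x * extInv (algebraMap ℤ (ExtAlg α) r)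
    rw [contractGens_algebraMap, AlgHom.commutes, mul_zero, zero_add, ← Algebra.commutes,
      ← Algebra.smul_def, map_smul, ← Algebra.commutes, ← Algebra.smul_def]
  | add y z hy hz => rw [mul_add, map_add, hy, hz, map_add, map_add]; noncomm_ring
  | mul_ι v y hy =>
    change contractGens c (x * (y * ExteriorAlgebra.ι ℤ v)) =
      x * contractGens c (y * ExteriorAlgebra.ι ℤ v) +
        contractGens c x * extInv (y * ExteriorAlgebra.ι ℤ v)
    rw [← mul_assoc, contractGens_mul_ι, contractGens_mul_ι, hy, map_mul, extInv_ι]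
    simp only [mul_sub, add_mul, mul_neg, mul_smul_comm, mul_assoc]
    abel

theorem extInv_contractGens (c : Set α) (x : ExtAlg α) :
    extInv (contractGens c x) = -contractGens c (extInv x) := by
  induction x using CliffordAlgebra.right_induction with
  | algebraMap r =>
    change extInv (contractGens c (algebraMap ℤ (ExtAlg α) r)) =
      -contractGens c (extInv (algebraMap ℤ (ExtAlg α) r))
    rw [AlgHom.commutes, contractGens_algebraMap]; simp
  | add y z hy hz => simp only [map_add, hy, hz, neg_add]
  | mul_ι v y hy =>
    change extInv (contractGens c (y * ExteriorAlgebra.ι ℤ v)) =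
      -contractGens c (extInv (y * ExteriorAlgebra.ι ℤ v))
    rw [contractGens_mul_ι, map_sub, map_mul, hy, map_mul, extInv_ι, map_smul,
      show extInv y * -ExteriorAlgebra.ι ℤ v = -(extInv y * ExteriorAlgebra.ι ℤ v) from mul_neg _ _,
      map_neg, contractGens_mul_ι]
    simp only [neg_mul, mul_neg, neg_neg]

theorem extMonomial_cons (a : α) (s : List α) : extMonomial (a :: s) = extMonomial s * gen a := by
  simp [extMonomial]

theorem gen_mul_gen_swap (a b : α) : gen a * gen b = -(gen b * gen a) :=
  eq_neg_of_add_eq_zero_left (ExteriorAlgebra.ι_add_mul_swap _ _)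

theorem gen_mul_gen_self (a : α) : gen a * gen a = 0 := ExteriorAlgebra.ι_sq_zero _

theorem extMonomial_perm {s t : List α} (h : s.Perm t) :
    extMonomial s = extMonomial t ∨ extMonomial s = -extMonomial t := by
  induction h with
  | nil => exact Or.inl rfl
  | cons x _ ih =>
    rw [extMonomial_cons, extMonomial_cons]
    rcases ih with h | h <;> simp [h]
  | swap x y l =>
    right
    simp only [extMonomial_cons, mul_assoc]
    rw [gen_mul_gen_swap x y, mul_neg]
  | trans _ _ ih1 ih2 => rcases ih1 with h | h <;> rcases ih2 with h' | h' <;> simp [h, h']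

theorem extInv_extMonomial (s : List α) :
    extInv (extMonomial s) = extMonomial s ∨ extInv (extMonomial s) = -extMonomial s := by
  induction s with
  | nil => left; simp [extMonomial]
  | cons a s ih =>
    rw [extMonomial_cons, map_mul, gen, extInv_ι]
    rcases ih with h | h <;> simp [h]

theorem extMonomial_mul_gen_of_mem {s : List α} {a : α} (ha : a ∈ s) :
    extMonomial s * gen a = 0 := by
  classical
  rcases extMonomial_perm (List.perm_cons_erase ha) with h | h <;>
    rw [h, extMonomial_cons] <;> simp [mul_assoc, gen_mul_gen_self]

theorem contractGens_extMonomial {c : Set α} {s : List α} (h : ∀ a ∈ s, a ∉ c) :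
    contractGens c (extMonomial s) = 0 := by
  induction s with
  | nil => exact contractGens_one c
  | cons a s ih =>
    rw [extMonomial_cons, contractGens_mul_gen_of_notMem _ (h a (by simp)),
      ih fun b hb => h b (List.mem_cons_of_mem _ hb)]
    simp

theorem osIdeal_mul_left {M : Matroid α} (a : ExtAlg α) {x : ExtAlg α} (h : x ∈ osIdeal M) :
    a * x ∈ osIdeal M := (osIdeal M).mul_mem_left a h

theorem osIdeal_mul_right {M : Matroid α} {x : ExtAlg α} (b : ExtAlg α) (h : x ∈ osIdeal M) :
    x * b ∈ osIdeal M := (osIdeal M).mul_mem_right b h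

theorem gen_mem_osIdeal {M : Matroid α} {a : α} (h : a ∉ M.E) : gen a ∈ osIdeal M :=
  TwoSidedIdeal.subset_span (Or.inl ⟨a, h, rfl⟩)

theorem extDiff_mem_osIdeal {M : Matroid α} {s : List α} (hs : s.Nodup)
    (h : M.Dep {a | a ∈ s}) : extDiff (extMonomial s) ∈ osIdeal M :=
  TwoSidedIdeal.subset_span (Or.inr ⟨s, hs, h, rfl⟩)

theorem extMonomial_mem_osIdeal {M : Matroid α} {s : List α} (hs : s.Nodup)
    (h : M.Dep {a | a ∈ s}) : extMonomial s ∈ osIdeal M := by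
  obtain ⟨a, ha⟩ := h.nonempty
  have h0 := extDiff_mul_gen (extMonomial s) a
  rw [extMonomial_mul_gen_of_mem ha, map_zero] at h0
  rw [sub_eq_zero.1 h0.symm]
  exact osIdeal_mul_right _ (extDiff_mem_osIdeal hs h)

/-- An atom of the lattice of flats: a flat of rank one. -/
def IsAtomFlat (M : Matroid α) (c : Set α) : Prop := M.IsFlat c ∧ M.eRk c = 1

theorem dep_contract_of_disjoint {M : Matroid α} {c T : Set α} (h : M.Dep T) (hd : ∀ a ∈ T, a ∉ c) :
    (M.contract c).Dep T :=
  ⟨fun hi => h.not_indep hi.of_contract, fun a ha => ⟨h.subset_ground ha, hd a ha⟩⟩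

theorem dep_contract_of_insert {M : Matroid α} [M.Loopless] {c T : Set α} (hc : IsAtomFlat M c)
    {a : α} (ha : a ∈ c) (h : M.Dep (insert a T)) (hd : ∀ b ∈ T, b ∉ c) :
    (M.contract c).Dep T := by
  have haE : a ∈ M.E := hc.1.subset_ground ha
  have hai : M.Indep {a} := Matroid.indep_singleton.2 (Matroid.isNonloop_of_loopless haE)
  have hb : M.IsBasis {a} c := by
    refine hai.isBasis_of_eRk_ge (Set.finite_singleton a) (Set.singleton_subset_iff.2 ha) ?_
      hc.1.subset_ground
    rw [hc.2, hai.eRk_eq_encard, Set.encard_singleton]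
  refine ⟨fun hi => h.not_indep ?_, fun b hbT =>
    ⟨h.subset_ground (Set.mem_insert_of_mem _ hbT), hd b hbT⟩⟩
  have := (hb.contract_indep_iff.1 hi).1
  rwa [Set.union_singleton] at this

theorem residue_extDiff_mem {M : Matroid α} [M.Loopless] {c : Set α} (hc : IsAtomFlat M c)
    {s : List α} (hs : s.Nodup) (h : M.Dep {a | a ∈ s}) :
    extDiff (extMonomial s) ∈ osIdeal (M.contract c) ∧
      contractGens c (extDiff (extMonomial s)) ∈ osIdeal (M.contract c) := by
  classical
  set J := osIdeal (M.contract c) with hJ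
  have hgen : ∀ a ∈ c, gen a ∈ J := fun a ha => gen_mem_osIdeal fun h' => h'.2 ha
  by_cases hsc : ∀ a ∈ s, a ∉ c
  · refine ⟨extDiff_mem_osIdeal hs (dep_contract_of_disjoint h hsc), ?_⟩
    rw [contractGens_extDiff, contractGens_extMonomial hsc]
    simp
  push Not at hsc
  obtain ⟨a, has, hac⟩ := hsc
  set t := s.erase a with ht
  have hperm : s.Perm (a :: t) := List.perm_cons_erase has
  have hnd : (a :: t).Nodup := hperm.nodup_iff.1 hs
  have hdep : M.Dep (insert a {b | b ∈ t}) := by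
    convert h using 1
    ext x
    simp [hperm.mem_iff]
  have key1 : extMonomial t ∈ J ∧
      extDiff (extMonomial t) - contractGens c (extMonomial t) ∈ J := by
    by_cases htc : ∀ b ∈ t, b ∉ c
    · have hd := dep_contract_of_insert hc hac hdep htc
      have hnt : t.Nodup := (List.nodup_cons.1 hnd).2
      refine ⟨extMonomial_mem_osIdeal hnt hd, ?_⟩
      rw [contractGens_extMonomial htc, sub_zero]
      exact extDiff_mem_osIdeal hnt hd
    · push Not at htc
      obtain ⟨b, hbt, hbc⟩ := htc
      have h1 : extMonomial (b :: t.erase b) ∈ J := by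
        rw [extMonomial_cons]; exact osIdeal_mul_left _ (hgen b hbc)
      have h2 : extDiff (extMonomial (b :: t.erase b)) -
          contractGens c (extMonomial (b :: t.erase b)) ∈ J := by
        rw [extMonomial_cons, extDiff_mul_gen, contractGens_mul_gen_of_mem _ hbc, sub_sub_sub_cancel_left]
        exact J.sub_mem (osIdeal_mul_left _ (hgen b hbc)) (osIdeal_mul_left _ (hgen b hbc))
      rcases extMonomial_perm (List.perm_cons_erase hbt) with h' | h'
      · rw [h']; exact ⟨h1, h2⟩
      · rw [h', map_neg, map_neg, neg_sub_neg, ← neg_sub]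
        exact ⟨J.neg_mem h1, J.neg_mem h2⟩
  have h1 : extDiff (extMonomial (a :: t)) ∈ J := by
    rw [extMonomial_cons, extDiff_mul_gen]
    exact J.sub_mem key1.1 (osIdeal_mul_left _ (hgen a hac))
  have h2 : contractGens c (extDiff (extMonomial (a :: t))) ∈ J := by
    rw [contractGens_extDiff, extMonomial_cons, contractGens_mul_gen_of_mem _ hac, map_sub,
      extDiff_mul_gen]
    refine J.neg_mem ?_
    rw [← sub_add]
    exact J.add_mem key1.2 (osIdeal_mul_left _ (hgen a hac))
  rcases extMonomial_perm hperm with h' | h'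
  · rw [h']; exact ⟨h1, h2⟩
  · rw [h', map_neg, map_neg]; exact ⟨J.neg_mem h1, J.neg_mem h2⟩

theorem contractGens_mem_osIdeal {M : Matroid α} [M.Loopless] {c : Set α} (hc : IsAtomFlat M c)
    {x : ExtAlg α} (hx : x ∈ osIdeal M) : contractGens c x ∈ osIdeal (M.contract c) := by
  set J := osIdeal (M.contract c) with hJ
  suffices h : x ∈ J ∧ contractGens c x ∈ J ∧ extInv x ∈ J from h.2.1
  refine TwoSidedIdeal.span_induction (s := osRelations M)
    (p := fun x _ => x ∈ J ∧ contractGens c x ∈ J ∧ extInv x ∈ J) ?_ ?_ ?_ ?_ ?_ ?_ hx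
  · rintro x (⟨a, ha, rfl⟩ | ⟨s, hs, hd, rfl⟩)
    · have hac : a ∉ c := fun h => ha (hc.1.subset_ground h)
      have hg : gen a ∈ J := gen_mem_osIdeal fun h => ha h.1
      refine ⟨hg, ?_, ?_⟩
      · have := contractGens_mul_gen_of_notMem (1 : ExtAlg α) hac
        rw [one_mul, contractGens_one] at this
        rw [this]; simp
      · rw [gen, extInv_ι]; exact J.neg_mem hg
    · obtain ⟨h1, h2⟩ := residue_extDiff_mem hc hs hd
      refine ⟨h1, h2, ?_⟩
      rw [extDiff, extInv_contractGens]
      rcases extInv_extMonomial s with h | h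
      · rw [h]; exact J.neg_mem h1
      · rw [h, map_neg, neg_neg]; exact h1
  · simp
  · rintro x y _ _ ⟨h1, h2, h3⟩ ⟨h1', h2', h3'⟩
    simp only [map_add]
    exact ⟨J.add_mem h1 h1', J.add_mem h2 h2', J.add_mem h3 h3'⟩
  · rintro x _ ⟨h1, h2, h3⟩
    simp only [map_neg]
    exact ⟨J.neg_mem h1, J.neg_mem h2, J.neg_mem h3⟩
  · rintro a x _ ⟨h1, h2, h3⟩
    rw [contractGens_mul, map_mul]
    exact ⟨osIdeal_mul_left _ h1, J.add_mem (osIdeal_mul_left _ h2) (osIdeal_mul_left _ h3),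
      osIdeal_mul_left _ h3⟩
  · rintro b x _ ⟨h1, h2, h3⟩
    rw [contractGens_mul, map_mul]
    exact ⟨osIdeal_mul_right _ h1, J.add_mem (osIdeal_mul_right _ h1) (osIdeal_mul_right _ h2),
      osIdeal_mul_right _ h3⟩

theorem algebraMapInv_osIdeal {M : Matroid α} [M.Loopless] {x : ExtAlg α} (hx : x ∈ osIdeal M) :
    ExteriorAlgebra.algebraMapInv (R := ℤ) x = 0 := by
  have hgen : ∀ a : α, ExteriorAlgebra.algebraMapInv (R := ℤ) (gen a) = 0 := fun a => by
    simp [gen, ExteriorAlgebra.algebraMapInv]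
  refine TwoSidedIdeal.span_induction (s := osRelations M)
    (p := fun x _ => ExteriorAlgebra.algebraMapInv (R := ℤ) x = 0) ?_ ?_ ?_ ?_ ?_ ?_ hx
  · rintro x (⟨a, ha, rfl⟩ | ⟨s, hs, hd, rfl⟩)
    · exact hgen a
    · match s, hd with
      | [], hd => exact absurd hd.nonempty (by simp)
      | [a], hd =>
        have : M.IsLoop a := Matroid.singleton_dep.1 (by simpa using hd)
        exact absurd this (M.not_isLoop a)
      | a :: b :: s, _ =>
        rw [extMonomial_cons, extDiff_mul_gen, extMonomial_cons]
        simp [hgen]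
  · exact map_zero _
  · intro x y _ _ h h'; rw [map_add, h, h', add_zero]
  · intro x _ h; rw [map_neg, h, neg_zero]
  · intro a x _ h; rw [map_mul, h, mul_zero]
  · intro b x _ h; rw [map_mul, h, zero_mul]

/-! ### Residue maps -/

theorem residue_osIdeal {M : Matroid α} {c : Set α} (h : M.Loopless ∧ IsAtomFlat M c) :
    ∀ x ∈ osIdeal M, (osMk (M.contract c) ∘ₗ contractGens c) x = 0 := fun _ hx =>
  haveI := h.1
  (Submodule.Quotient.mk_eq_zero _).2 (contractGens_mem_osIdeal h.2 hx)

theorem degZero_osIdeal {M : Matroid α} (h : M.Loopless) :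
    ∀ x ∈ osIdeal M,
      (ExteriorAlgebra.algebraMapInv (R := ℤ) (M := α →₀ ℤ)).toLinearMap x = 0 :=
  fun _ hx => haveI := h; algebraMapInv_osIdeal hx

open Classical in
/-- The residue map `Res_c : A^•(M) → A^{•-1}(M/c)` at an atom `c` of the lattice of flats of a
loopless matroid `M`: it sends `ω ∧ e` to `ω` and `ω` to `0` when `e ∈ c` and `ω` is a monomial in
generators outside `c`. (Junk value `0` if `M` has loops or `c` is not an atom.) -/
def res (M : Matroid α) (c : Set α) : OS M →ₗ[ℤ] OS (M.contract c) :=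
  if h : M.Loopless ∧ IsAtomFlat M c then
    osLift M (osMk (M.contract c) ∘ₗ contractGens c) (residue_osIdeal h)
  else 0

open Classical in
/-- The projection of the Orlik–Solomon algebra of a loopless matroid onto its degree `0` component
`A^0(M) ≅ ℤ`. (Junk value `0` if `M` has loops.) -/
def degZero (M : Matroid α) : OS M →ₗ[ℤ] ℤ :=
  if h : M.Loopless then
    osLift M (ExteriorAlgebra.algebraMapInv (R := ℤ) (M := α →₀ ℤ)).toLinearMap
      (degZero_osIdeal h)
  else 0

/-- The set `Fl^k(M)` of saturated flags `F_0 ⊂ F_1 ⊂ ⋯ ⊂ F_k` of flats with `rk F_i = i`. -/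
def flags (M : Matroid α) (k : ℕ) : Set (Fin (k + 1) → Set α) :=
  {F | Monotone F ∧ ∀ i, M.IsFlat (F i) ∧ M.eRk (F i) = (i : ℕ)}

/-- The residue `Res_{F_•} : A^•(M) → A^{•-k}(M/F_k) → A^0(M/F_k) ≅ ℤ` along a saturated flag, as
the composition `Res_{F_k/F_{k-1}} ∘ ⋯ ∘ Res_{F_2/F_1} ∘ Res_{F_1}`: take the residue at `F_1`, then
the residue along the flag `F_1/F_1 ⊂ F_2/F_1 ⊂ ⋯ ⊂ F_k/F_1` of `M/F_1`. -/
def flagRes : (k : ℕ) → (M : Matroid α) → (Fin (k + 1) → Set α) → (OS M →ₗ[ℤ] ℤ)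
  | 0, M, _ => degZero M
  | k + 1, M, F => flagRes k (M.contract (F 1)) (fun i => F i.succ \ F 1) ∘ₗ res M (F 1)

end OrlikSolomon

/-! ## The intersection forms -/

section Forms

variable {α : Type*} [Finite α]

/-- The field `Q = Frac ℤ[a_e : e ∈ E]`. -/
abbrev ParamField (M : Matroid α) : Type _ := FractionRing (MvPolynomial M.E ℤ)

/-- The elements of `S` in the ground set, as a finite set of elements of the ground set. -/
def elemsIn (M : Matroid α) (S : Set α) : Finset M.E :=
  (Set.toFinite {e : M.E | (e : α) ∈ S}).toFinset

/-- `a_S = ∑_{e ∈ S} a_e`. -/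
def aSum (M : Matroid α) (S : Set α) : ParamField M :=
  algebraMap (MvPolynomial M.E ℤ) _ (∑ e ∈ elemsIn M S, MvPolynomial.X e)

/-- `a^S = ∏_{e ∈ S} a_e`. -/
def aProd (M : Matroid α) (S : Set α) : ParamField M :=
  algebraMap (MvPolynomial M.E ℤ) _ (∏ e ∈ elemsIn M S, MvPolynomial.X e)

/-- `1/a_{F_•} = ∏_{i=1}^{k-1} 1/a_{F_i}`. -/
def flagWeight (M : Matroid α) {k : ℕ} (F : Fin (k + 1) → Set α) : ParamField M :=
  ∏ i with i ≠ 0 ∧ i ≠ Fin.last k, 1 / aSum M (F i)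

/-- `1/a'_{F_•} = ∏_{i=1}^{k} 1/a_{F_i}`. -/
def flagWeight' (M : Matroid α) {k : ℕ} (F : Fin (k + 1) → Set α) : ParamField M :=
  ∏ i with i ≠ 0, 1 / aSum M (F i)

/-- The `Q`-valued deRham cohomology intersection form
`⟨x, y⟩^{dR} = ∑_{F_•} Res_{F_•}(x) (1/a_{F_•}) Res_{F_•}(y)` on `A^k(M)`. -/
def dRForm (M : Matroid α) (k : ℕ) (x y : osDegree M k) : ParamField M :=
  ∑ F ∈ (Set.toFinite (flags M k)).toFinset,
    (flagRes k M F x : ParamField M) * flagWeight M F * (flagRes k M F y : ParamField M)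

/-- The primed form `⟨x, y⟩'^{dR} = ∑_{F_•} Res_{F_•}(x) (1/a'_{F_•}) Res_{F_•}(y)` on `A^k(M)`. -/
def dRForm' (M : Matroid α) (k : ℕ) (x y : osDegree M k) : ParamField M :=
  ∑ F ∈ (Set.toFinite (flags M k)).toFinset,
    (flagRes k M F x : ParamField M) * flagWeight' M F * (flagRes k M F y : ParamField M)

/-- The deRham homology intersection form `⟨P, Q⟩_{dR} = ∑_{B ∈ 𝓑(P, Q)} a^B`, where `𝓑(P, Q)` is
the set of bases `B` of `𝓜` with `P, Q ∈ 𝓣^B`. -/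
def dRHomForm (𝓝 : OrientedMatroid α) (star : α) (𝓜 : OrientedMatroid α)
    (P Q : α → SignType) : ParamField 𝓜.matroid :=
  ∑ B ∈ (Set.toFinite {B : Set α | 𝓜.matroid.IsBase B ∧
      P ∈ topesInBasis 𝓝 star 𝓜 B ∧ Q ∈ topesInBasis 𝓝 star 𝓜 B}).toFinset,
    aProd 𝓜.matroid B

instance boundedTopesFintype [DecidableEq α] (𝓝 : OrientedMatroid α) (star : α)
    (𝓜 : OrientedMatroid α) : Fintype (boundedTopes 𝓝 star 𝓜) := Fintype.ofFinite _

instance boundedTopesDecidableEq [DecidableEq α] (𝓝 : OrientedMatroid α) (star : α)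
    (𝓜 : OrientedMatroid α) : DecidableEq (boundedTopes 𝓝 star 𝓜) := Classical.decEq _

end Forms

/-! ## Canonical forms -/

section CanonicalForms

variable {α : Type*}

/-- `c` belongs to the face lattice `L(P)`: it is the zero set of a covector that is a face of `P`.
Here `M` is the underlying matroid and `𝓛` the set of covectors. -/
def IsFaceFlat (M : Matroid α) (𝓛 : Set (α → SignType)) (P : α → SignType) (c : Set α) : Prop :=
  ∃ X ∈ 𝓛, IsSignFace X P ∧ {e | e ∈ M.E ∧ X e = 0} = c

/-- The recursion that characterises the canonical form `ω = Ω_P` of a tope `P` of an oriented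
matroid of rank `k` with underlying matroid `M`, covectors `𝓛` and chirotope `χ`.

In rank `0`, `Ω_P = χ(∅) ∈ A^0(M)`. In rank `k + 1`, `Ω_P ∈ A^{k+1}(M)`, and for every atom `c` of the
lattice of flats and every `e ∈ c`, one has `Res_c Ω_P = P(e) Ω_{P/c}` if `c ∈ L(P)` and
`Res_c Ω_P = 0` otherwise. Here the contraction by `c` has underlying matroid `M/c`, its covectors are
the covectors in `𝓛` that vanish on `c`, its chirotope is `(e_1, …, e_k) ↦ χ (e_1, …, e_k, e)`, and
`P/c` is the restriction of `P` to the complement of `c`. -/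
def IsCanonicalForm : (k : ℕ) → (M : Matroid α) → (𝓛 : Set (α → SignType)) →
    (χ : (Fin k → α) → SignType) → (P : α → SignType) → OS M → Prop
  | 0, M, _, χ, _, ω => ω = (χ ![] : ℤ) • osMk M 1
  | k + 1, M, 𝓛, χ, P, ω => ω ∈ osDegree M (k + 1) ∧
      ∀ c, IsAtomFlat M c → ∀ e ∈ c,
        (IsFaceFlat M 𝓛 P c → ∃ ω' : OS (M.contract c),
          IsCanonicalForm k (M.contract c) {X | X ∈ 𝓛 ∧ ∀ f ∈ c, X f = 0}
            (fun x => χ (Fin.snoc x e)) (cᶜ.indicator P) ω' ∧ res M c ω = (P e : ℤ) • ω') ∧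
        (¬IsFaceFlat M 𝓛 P c → res M c ω = 0)

open Classical in
/-- The canonical form `Ω_P ∈ A(M) = A^r(M)` of a tope `P` of an oriented matroid `𝓜` of rank `r` with
chirotope `χ`: the element that satisfies the recursion. (Junk value `0` if there is none.) -/
def canonicalForm (𝓜 : OrientedMatroid α) {r : ℕ} (χ : (Fin r → α) → SignType)
    (P : α → SignType) : osDegree 𝓜.matroid r :=
  if h : ∃ ω : osDegree 𝓜.matroid r, IsCanonicalForm r 𝓜.matroid 𝓜.covectors χ P ω then
    h.choose
  else 0

/-- The matrix of `⟨·, ·⟩^{dR}` on the canonical forms `Ω_P`, `P ∈ 𝓣^⋆`. -/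
def dRMatrix [Finite α] [DecidableEq α] (𝓝 : OrientedMatroid α) (star : α)
    (𝓜 : OrientedMatroid α) {r : ℕ} (χ : (Fin r → α) → SignType) :
    Matrix (boundedTopes 𝓝 star 𝓜) (boundedTopes 𝓝 star 𝓜) (ParamField 𝓜.matroid) :=
  Matrix.of fun P Q => dRForm 𝓜.matroid r (canonicalForm 𝓜 χ P) (canonicalForm 𝓜 χ Q)

/-- The matrix of the primed form `⟨·, ·⟩'^{dR}` on the canonical forms `Ω_P`, `P ∈ 𝓣^⋆`. -/
def dRMatrix' [Finite α] [DecidableEq α] (𝓝 : OrientedMatroid α) (star : α)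
    (𝓜 : OrientedMatroid α) {r : ℕ} (χ : (Fin r → α) → SignType) :
    Matrix (boundedTopes 𝓝 star 𝓜) (boundedTopes 𝓝 star 𝓜) (ParamField 𝓜.matroid) :=
  Matrix.of fun P Q => dRForm' 𝓜.matroid r (canonicalForm 𝓜 χ P) (canonicalForm 𝓜 χ Q)

/-- The matrix of `⟨·, ·⟩_{dR}` on `𝓣^⋆`. -/
def dRHomMatrix [Finite α] [DecidableEq α] (𝓝 : OrientedMatroid α) (star : α)
    (𝓜 : OrientedMatroid α) :
    Matrix (boundedTopes 𝓝 star 𝓜) (boundedTopes 𝓝 star 𝓜) (ParamField 𝓜.matroid) :=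
  Matrix.of fun P Q => dRHomForm 𝓝 star 𝓜 P Q

end CanonicalForms

end OMForms

end

/-!
The proof works with residues along flags throughout. The residue of a monomial along a flag is the
determinant of the incidence matrix of its generators with the steps of the flag (`flagRes_wedge`).
The key identity is `flag_expansion`: modulo the Orlik–Solomon ideal, a monomial `e_u` is the sum,
over all flags `F`, of its residue along `F` times the product over the steps of `F` of any weighted
averages, with total weight `1`, of the generators in `F_i`. Two choices of weights are used.

* Weights concentrated on one element of each flat have no denominators and show that an element of
  `A^k(M)` is determined by its residues (`eq_of_flagRes_eq`).
* The weights `a_b / a_{F_i}` turn the product of averages into the terms `a^B` divided by the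
  product of the `a_{F_i}`, for bases `B` that are transversals of `F`
  (`sum_flagRes_mul_flagEval`, `sum_isBase_eq_flagEval`).

The functions on flags that are given by residues are exactly those satisfying the local relations
`FlagRel`: for a flag with one inner flat removed, the values at all its completions sum to zero
(`exists_flagRes_eq`, where monomials without broken circuits interpolate any prescribed values at
the corresponding flags). Unfolding its recursion, the canonical form of a tope `P` is
the element whose residue along a flag is the sign of `P` on a transversal of the flag, if the flag
consists of zero sets of faces of `P`, and zero otherwise (`isCanonicalForm_iff`). This function on
flags satisfies the relations because of the diamond property of the face lattice of `P`
(`diamond`, `flagRel_topeFlagVal`): at most two completions contribute, with opposite signs. Hence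
canonical forms exist and are unique.

For a basis `B`, the sum of `Ω_P` over the topes `P` in `𝓣^B` is `± e_B` (`sum_topeFlagVal_eq`): if
`B` is a transversal of a flag, exactly one tope with the prescribed signs on `B` has that flag, and
otherwise these topes cancel in pairs. Since `𝓣^B ⊆ 𝓣^⋆`, the canonical forms of the bounded topes
span `A(M)`. They are independent by induction on the rank
(`IsGeneralExtension.eq_zero_of_sum_eq_zero`): taking residues at the zero set of a wall, and using
the contraction, the coefficients in a linear relation agree on both sides of every wall. From any
bounded tope one can walk through walls towards a fixed unbounded tope, so all coefficients vanish.

For the matrices, let `φ` be the coordinate of `Ω_P`. By the preceding sum, `φ(e_B)` is `± 1` if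
`P ∈ 𝓣^B` and zero otherwise, and with the same sign the residues of the `Ω_Q`, `Q ∈ 𝓣^B`, add up
to those of `e_B`. So the entry at `P, R` of the product of the homology matrix with the primed
cohomology matrix is the sum, over bases and flags, of `a^B φ(e_B) Res_F(e_B) Res_F(Ω_R)` divided by
the product of the `a_{F_i}`, which is `φ(Ω_R)` by the flag expansion. The unprimed form is the primed
one times `a_E`.
-/

open scoped BigOperators

noncomputable section

namespace OMForms

/-! ### Ranks of flats and saturated flags -/

section Flats

variable {α : Type*} {M : Matroid α}

theorem eRk_contract_add (M : Matroid α) (C X : Set α) :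
    (M.contract C).eRk X + M.eRk C = M.eRk (X ∪ C) := by
  obtain ⟨I, hI⟩ := M.exists_isBasis' C
  obtain ⟨K, hK⟩ := (M.contract C).exists_isBasis' X
  have hKi := hI.contract_indep_iff.1 hK.indep
  have hd : Disjoint K I := (hKi.2.mono_left hI.subset).symm
  rw [hK.eRk_eq_encard, hI.eRk_eq_encard, ← Set.encard_union_eq hd, ← hKi.1.eRk_eq_encard,
    ← M.eRk_union_closure_right_eq K I, hI.closure_eq_closure, M.eRk_union_closure_right_eq]
  refine le_antisymm (M.eRk_mono (Set.union_subset_union_left _ hK.subset)) ?_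
  rw [← M.eRk_closure_eq (K ∪ C), ← M.eRk_inter_ground]
  refine M.eRk_mono ?_
  rintro e ⟨he | he, heE⟩
  · by_cases heC : e ∈ C
    · exact M.mem_closure_of_mem' (Or.inr heC) heE
    have h1 : e ∈ (M.contract C).closure K := by
      rw [hK.closure_eq_closure]
      exact (M.contract C).mem_closure_of_mem' he ⟨heE, heC⟩
    rw [Matroid.contract_closure_eq] at h1
    exact h1.1
  · exact M.mem_closure_of_mem' (Or.inr he) heE

theorem isFlat_contract_iff {C F : Set α} (hC : C ⊆ F) (hF : F ⊆ M.E) :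
    (M.contract C).IsFlat (F \ C) ↔ M.IsFlat F := by
  rw [Matroid.isFlat_iff_closure_eq, Matroid.isFlat_iff_closure_eq, Matroid.contract_closure_eq,
    Set.sdiff_union_of_subset hC]
  constructor
  · intro h
    have h1 : C ⊆ M.closure F := hC.trans (M.subset_closure F hF)
    rw [← Set.sdiff_union_of_subset h1, h, Set.sdiff_union_of_subset hC]
  · intro h; rw [h]

theorem loopless_contract {c : Set α} (hc : M.IsFlat c) : (M.contract c).Loopless := by
  rw [Matroid.loopless_iff, Matroid.contract_loops_eq, hc.closure, Set.sdiff_self]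

/-- Two nested flats of the same finite rank agree. -/
theorem isFlat_eq_of_subset {F G : Set α} {n : ℕ} (hF : M.IsFlat F) (hG : M.IsFlat G)
    (hFG : F ⊆ G) (h1 : M.eRk F = n) (h2 : M.eRk G = n) : F = G := by
  have hfin : M.IsRkFinite F := by
    rw [← Matroid.eRk_lt_top_iff, h1]; exact ENat.natCast_lt_top n
  have := hfin.closure_eq_closure_of_subset_of_eRk_ge_eRk hFG (by rw [h1, h2])
  rwa [hF.closure, hG.closure] at this

/-- A flat covering the flat `G` is spanned by `G` and any one of its further elements. -/
theorem closure_insert_eq_of_eRk {G H : Set α} {n : ℕ} {e : α} (hG : M.IsFlat G) (hH : M.IsFlat H)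
    (hGH : G ⊆ H) (h1 : M.eRk G = n) (h2 : M.eRk H = (n + 1 : ℕ)) (he : e ∈ H \ G) :
    M.closure (insert e G) = H := by
  refine isFlat_eq_of_subset (Matroid.isFlat_closure _) hH ?_ (n := n + 1) ?_ h2
  · rw [← hH.closure]
    exact M.closure_subset_closure (Set.insert_subset he.1 hGH)
  · rw [M.eRk_closure_eq, Matroid.eRk_insert_eq_add_one, h1]; · rfl
    rw [hG.closure]
    exact ⟨hH.subset_ground he.1, he.2⟩

/-- Two distinct flats covering the same flat `G` meet in `G`. -/
theorem inter_eq_of_cover {G H H' : Set α} {n : ℕ} (hG : M.IsFlat G) (hH : M.IsFlat H)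
    (hH' : M.IsFlat H') (hGH : G ⊆ H) (hGH' : G ⊆ H') (h1 : M.eRk G = n)
    (h2 : M.eRk H = (n + 1 : ℕ)) (h2' : M.eRk H' = (n + 1 : ℕ)) {e : α}
    (he : e ∈ H) (he' : e ∈ H') (heG : e ∉ G) : H = H' := by
  rw [← closure_insert_eq_of_eRk hG hH hGH h1 h2 ⟨he, heG⟩,
    ← closure_insert_eq_of_eRk hG hH' hGH' h1 h2' ⟨he', heG⟩]

theorem flags_isFlat {k : ℕ} {F : Fin (k + 1) → Set α} (hF : F ∈ flags M k) (i) : M.IsFlat (F i) :=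
  (hF.2 i).1

theorem flags_eRk {k : ℕ} {F : Fin (k + 1) → Set α} (hF : F ∈ flags M k) (i) :
    M.eRk (F i) = (i : ℕ) :=
  (hF.2 i).2

theorem flags_zero_eq_empty [M.Loopless] {k : ℕ} {F : Fin (k + 1) → Set α} (hF : F ∈ flags M k) :
    F 0 = ∅ := by
  have h1 := flags_eRk hF 0
  have h2 := (flags_isFlat hF 0).subset_ground
  rw [Fin.val_zero, Nat.cast_zero, Matroid.eRk_eq_zero_iff h2, M.loops_eq_empty] at h1
  exact Set.subset_empty_iff.1 h1

theorem flags_isAtomFlat {k : ℕ} {F : Fin (k + 2) → Set α} (hF : F ∈ flags M (k + 1)) :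
    IsAtomFlat M (F 1) :=
  ⟨flags_isFlat hF 1, by simpa using flags_eRk hF 1⟩

theorem flags_subset {k : ℕ} {F : Fin (k + 1) → Set α} (hF : F ∈ flags M k) (i : Fin k) :
    F i.castSucc ⊆ F i.succ :=
  hF.1 (Fin.castSucc_lt_succ).le

theorem flags_exists_mem_sdiff {k : ℕ} {F : Fin (k + 1) → Set α} (hF : F ∈ flags M k) (i : Fin k) :
    ∃ e, e ∈ F i.succ \ F i.castSucc := by
  by_contra hcon
  push Not at hcon
  have h1 : F i.succ = F i.castSucc := by
    refine Set.Subset.antisymm (fun e he => ?_) (flags_subset hF i)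
    by_contra h'
    exact hcon e ⟨he, h'⟩
  have h2 := flags_eRk hF i.succ
  have h3 := flags_eRk hF i.castSucc
  rw [h1, h3] at h2
  simp only [Fin.val_castSucc, Fin.val_succ, Nat.cast_inj] at h2
  omega

/-- The flag of `M / F_1` induced by a flag of `M`. -/
def flagTail {k : ℕ} (F : Fin (k + 2) → Set α) : Fin (k + 1) → Set α := fun i => F i.succ \ F 1

theorem flagTail_mem {k : ℕ} {F : Fin (k + 2) → Set α} (hF : F ∈ flags M (k + 1)) :
    flagTail F ∈ flags (M.contract (F 1)) k := by
  have hsub : ∀ i : Fin (k + 1), F 1 ⊆ F i.succ := fun i => hF.1 (by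
    rw [Fin.le_def]; simp)
  refine ⟨fun i j hij => Set.sdiff_subset_sdiff_left (hF.1 (Fin.succ_le_succ_iff.2 hij)),
    fun i => ⟨(isFlat_contract_iff (hsub i) (flags_isFlat hF _).subset_ground).2
      (flags_isFlat hF _), ?_⟩⟩
  have h1 := eRk_contract_add M (F 1) (flagTail F i)
  rw [flagTail, Set.sdiff_union_of_subset (hsub i), flags_eRk hF, flags_eRk hF] at h1
  have h2 : (M.contract (F 1)).eRk (F i.succ \ F 1) + 1 = (i : ℕ) + 1 := by
    simpa using h1
  exact ENat.add_left_injective_of_ne_top ENat.one_ne_top h2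

/-- The flag of `M` with first atom `c` induced by a flag of `M / c`. -/
def flagCons {k : ℕ} (c : Set α) (F : Fin (k + 1) → Set α) : Fin (k + 2) → Set α :=
  Fin.cons ∅ fun i => F i ∪ c

theorem flagCons_mem [M.Loopless] {k : ℕ} {c : Set α} (hc : IsAtomFlat M c)
    {F : Fin (k + 1) → Set α} (hF : F ∈ flags (M.contract c) k) :
    flagCons c F ∈ flags M (k + 1) := by
  refine ⟨?_, ?_⟩
  · intro i j hij
    induction i using Fin.cases with
    | zero => simp [flagCons]
    | succ i =>
      induction j using Fin.cases with
      | zero => exact absurd hij (by simp)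
      | succ j =>
        simp only [flagCons, Fin.cons_succ]
        exact Set.union_subset_union_left _ (hF.1 (Fin.succ_le_succ_iff.1 hij))
  · intro i
    induction i using Fin.cases with
    | zero =>
      refine ⟨?_, by simp [flagCons]⟩
      rw [Matroid.isFlat_iff_closure_eq]
      simp [flagCons, Matroid.closure_empty]
    | succ i =>
      have hd : (F i ∪ c) \ c = F i := by
        rw [Set.union_sdiff_right]
        refine sdiff_eq_left.2 (Set.disjoint_left.2 fun e he => ?_)
        exact ((flags_isFlat hF i).subset_ground he).2
      have hE : F i ∪ c ⊆ M.E :=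
        Set.union_subset (fun e he => ((flags_isFlat hF i).subset_ground he).1) hc.1.subset_ground
      simp only [flagCons, Fin.cons_succ]
      refine ⟨(isFlat_contract_iff Set.subset_union_right hE).1 ?_, ?_⟩
      · rw [hd]; exact flags_isFlat hF i
      · rw [← eRk_contract_add, hc.2, flags_eRk hF]
        simp

theorem flagCons_one [M.Loopless] {k : ℕ} {c : Set α} (hc : IsAtomFlat M c)
    {F : Fin (k + 1) → Set α} (hF : F ∈ flags (M.contract c) k) : flagCons c F 1 = c := by
  have := loopless_contract hc.1
  have : flagCons c F 1 = F 0 ∪ c := rfl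
  rw [this, flags_zero_eq_empty hF, Set.empty_union]

theorem flagTail_flagCons [M.Loopless] {k : ℕ} {c : Set α} (hc : IsAtomFlat M c)
    {F : Fin (k + 1) → Set α} (hF : F ∈ flags (M.contract c) k) : flagTail (flagCons c F) = F := by
  funext i
  rw [flagTail, flagCons_one hc hF]
  simp only [flagCons, Fin.cons_succ]
  rw [Set.union_sdiff_right]
  refine sdiff_eq_left.2 (Set.disjoint_left.2 fun e he => ?_)
  exact ((flags_isFlat hF i).subset_ground he).2

/-- A transversal of a flag: one element of each difference `F_{i+1} \ F_i`. -/
def IsTransversal {k : ℕ} (F : Fin (k + 1) → Set α) (u : Fin k → α) : Prop :=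
  ∀ i, u i ∈ F i.succ \ F i.castSucc

theorem exists_isTransversal {k : ℕ} {F : Fin (k + 1) → Set α} (hF : F ∈ flags M k) :
    ∃ u, IsTransversal F u :=
  ⟨fun i => (flags_exists_mem_sdiff hF i).choose,
    fun i => (flags_exists_mem_sdiff hF i).choose_spec⟩

/-- Up to the `i`-th flat, a flag is spanned by the first entries of a transversal. -/
theorem IsTransversal.closure_eq [M.Loopless] {k : ℕ} {F : Fin (k + 1) → Set α}
    (hF : F ∈ flags M k) {u : Fin k → α} (hu : IsTransversal F u) (i : Fin (k + 1)) :
    M.closure (u '' {j | j.castSucc < i}) = F i := by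
  induction i using Fin.induction with
  | zero =>
    rw [flags_zero_eq_empty hF]
    have : {j : Fin k | j.castSucc < 0} = ∅ := by ext j; simp
    rw [this, Set.image_empty, Matroid.closure_empty, M.loops_eq_empty]
  | succ i ih =>
    have h1 : {j : Fin k | j.castSucc < i.succ} = insert i {j | j.castSucc < i.castSucc} := by
      ext j
      simp only [Set.mem_ofPred_eq, Set.mem_insert_iff, Fin.lt_def, Fin.val_castSucc, Fin.val_succ,
        Fin.ext_iff]
      omega
    rw [h1, Set.image_insert_eq, ← Matroid.closure_insert_closure_eq_closure_insert, ih]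
    refine closure_insert_eq_of_eRk (flags_isFlat hF _) (flags_isFlat hF _) (flags_subset hF i)
      (flags_eRk hF _) ?_ (hu i)
    simpa using flags_eRk hF i.succ

theorem IsTransversal.mem_last {k : ℕ} {F : Fin (k + 1) → Set α} (hF : F ∈ flags M k)
    {u : Fin k → α} (hu : IsTransversal F u) (i : Fin k) : u i ∈ F (Fin.last k) :=
  hF.1 (Fin.le_last _) (hu i).1

theorem IsTransversal.injective {k : ℕ} {F : Fin (k + 1) → Set α}
    (hF : F ∈ flags M k) {u : Fin k → α} (hu : IsTransversal F u) : Function.Injective u := by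
  have key : ∀ i j, i < j → u i ≠ u j := by
    intro i j hij h
    refine (hu j).2 (hF.1 ?_ (h ▸ (hu i).1))
    rw [Fin.le_def]; simpa using hij
  intro i j h
  rcases lt_trichotomy i j with h' | h' | h'
  · exact absurd h (key i j h')
  · exact h'
  · exact absurd h.symm (key j i h')

theorem IsTransversal.indep [M.Loopless] {k : ℕ} {F : Fin (k + 1) → Set α}
    (hF : F ∈ flags M k) {u : Fin k → α} (hu : IsTransversal F u) : M.Indep (Set.range u) := by
  have hcl := hu.closure_eq hF (Fin.last k)
  have h1 : {j : Fin k | j.castSucc < Fin.last k} = Set.univ := by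
    ext j; simp [Fin.castSucc_lt_last]
  rw [h1, Set.image_univ] at hcl
  rw [Matroid.indep_iff_eRk_eq_encard_of_finite (Set.finite_range u), ← M.eRk_closure_eq, hcl,
    flags_eRk hF, ← Set.image_univ, (hu.injective hF).encard_image, Set.encard_univ]
  simp

end Flats

/-! ### Monomials and residues along flags -/

section Monomials

variable {α : Type*}

/-- The monomial `e_{u_{k-1}} ∧ ⋯ ∧ e_{u_0}` of a tuple of generators; the order is reversed so that
the residue along a flag pairs `u_i` with the `i`-th step of the flag. -/
def wedge {k : ℕ} (u : Fin k → α) : ExtAlg α := extMonomial (List.ofFn u)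

theorem wedge_zero (u : Fin 0 → α) : wedge u = 1 := by simp [wedge, extMonomial]

theorem wedge_succ {k : ℕ} (u : Fin (k + 1) → α) :
    wedge u = wedge (Fin.tail u) * gen (u 0) := by
  rw [wedge, List.ofFn_succ, extMonomial_cons]; rfl

theorem wedge_snoc {k : ℕ} (u : Fin k → α) (b : α) :
    wedge (Fin.snoc u b : Fin (k + 1) → α) = gen b * wedge u := by
  rw [wedge, List.ofFn_succ', extMonomial, List.concat_eq_append, List.reverse_append]
  simp [wedge, extMonomial]

theorem wedge_eq_ιMulti {k : ℕ} (u : Fin k → α) :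
    wedge u = ExteriorAlgebra.ιMulti ℤ k (fun i => Finsupp.single (u i.rev) (1 : ℤ)) := by
  rw [ExteriorAlgebra.ιMulti_apply, wedge, extMonomial, List.map_reverse, List.map_ofFn]
  congr 1
  refine List.ext_getElem (by simp) fun i h1 h2 => ?_
  simp only [List.getElem_reverse, List.getElem_ofFn, List.length_ofFn, Function.comp_apply, gen]
  congr 3
  simp only [Fin.ext_iff, Fin.val_rev]
  omega

theorem wedge_comp_perm {k : ℕ} (u : Fin k → α) (σ : Equiv.Perm (Fin k)) :
    wedge (u ∘ σ) = (Equiv.Perm.sign σ : ℤ) • wedge u := by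
  rw [wedge_eq_ιMulti, wedge_eq_ιMulti]
  have h := (ExteriorAlgebra.ιMulti ℤ k).map_perm
    (fun i => Finsupp.single (u i.rev) (1 : ℤ)) (Fin.revPerm.symm.permCongr σ)
  rw [Equiv.Perm.sign_permCongr] at h
  rw [Units.smul_def] at h
  convert h using 2
  ext i
  simp

theorem wedge_mem (k : ℕ) (u : Fin k → α) : wedge u ∈ ⋀[ℤ]^k (α →₀ ℤ) := by
  rw [wedge_eq_ιMulti]
  exact ExteriorAlgebra.ιMulti_range ℤ k ⟨_, rfl⟩

theorem span_wedge (k : ℕ) :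
    Submodule.span ℤ (Set.range (wedge : (Fin k → α) → ExtAlg α)) = ⋀[ℤ]^k (α →₀ ℤ) := by
  rw [← exteriorPower.ιMulti_span_fixedDegree_of_span_eq_top (R := ℤ) (s := Set.range
    fun a : α => Finsupp.single a (1 : ℤ))]
  · congr 1
    ext x
    constructor
    · rintro ⟨u, rfl⟩
      refine ⟨_, ?_, (wedge_eq_ιMulti u).symm⟩
      rintro _ ⟨i, rfl⟩
      exact ⟨_, rfl⟩
    · rintro ⟨v, hv, rfl⟩
      choose w hw using fun i => hv ⟨i, rfl⟩
      refine ⟨w ∘ Fin.rev, ?_⟩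
      rw [wedge_eq_ιMulti]
      congr 1
      ext1 i
      simpa using hw i
  · have := (Finsupp.basisSingleOne (R := ℤ) (ι := α)).span_eq
    simpa using this

theorem extInv_wedge {k : ℕ} (u : Fin k → α) : extInv (wedge u) = (-1 : ℤ) ^ k • wedge u := by
  induction k with
  | zero => rw [wedge_zero]; simp
  | succ k ih =>
    rw [wedge_succ, map_mul, ih, gen, extInv_ι, pow_succ, smul_mul_assoc, mul_smul, mul_neg,
      neg_one_smul]

theorem contractGens_gen_mul {c : Set α} (b : α) (x : ExtAlg α) :
    contractGens c (gen b * x) =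
      gen b * contractGens c x + c.indicator (fun _ => (1 : ℤ)) b • extInv x := by
  have h := contractGens_mul_gen c (1 : ExtAlg α) b
  rw [one_mul, contractGens_one, zero_mul, sub_zero] at h
  rw [contractGens_mul, h, smul_mul_assoc, one_mul]

theorem contractGens_wedge {k : ℕ} (c : Set α) (u : Fin (k + 1) → α) :
    contractGens c (wedge u) = ∑ j : Fin (k + 1),
      ((-1) ^ (j : ℕ) * c.indicator (fun _ => (1 : ℤ)) (u j)) • wedge (u ∘ j.succAbove) := by
  induction k with
  | zero =>
    rw [wedge_succ, contractGens_mul_gen, wedge_zero, contractGens_one]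
    simp [wedge_zero]
  | succ k ih =>
    rw [wedge_succ, contractGens_mul_gen, ih, Fin.sum_univ_succ (n := k + 1), sub_eq_add_neg,
      Finset.sum_mul, ← Finset.sum_neg_distrib]
    congr 1
    · simp; rfl
    · refine Finset.sum_congr rfl fun j _ => ?_
      rw [wedge_succ (u ∘ j.succ.succAbove)]
      have h1 : Fin.tail (u ∘ j.succ.succAbove) = Fin.tail u ∘ j.succAbove := by
        funext i; simp [Fin.tail]
      rw [h1, smul_mul_assoc, ← neg_smul]
      simp [Fin.tail, pow_succ]

theorem extDiff_gen_mul_wedge {k : ℕ} (b : α) (u : Fin k → α) :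
    extDiff (gen b * wedge u) = gen b * extDiff (wedge u) + (-1 : ℤ) ^ k • wedge u := by
  rw [extDiff, contractGens_gen_mul, extInv_wedge]
  simp

variable {M : Matroid α}

theorem wedge_eq_zero_of_not_injective {k : ℕ} {u : Fin k → α} (h : ¬Function.Injective u) :
    wedge u = 0 := by
  rw [wedge_eq_ιMulti]
  simp only [Function.Injective, not_forall] at h
  obtain ⟨i, j, hij, hne⟩ := h
  exact (ExteriorAlgebra.ιMulti ℤ k).map_eq_zero_of_eq _ (i := i.rev) (j := j.rev)
    (by simp [hij]) (fun h => hne (Fin.rev_injective h))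

theorem wedge_mem_osIdeal {k : ℕ} {u : Fin k → α} (h : ¬M.Indep (Set.range u)) :
    wedge u ∈ osIdeal M := by
  by_cases hi : Function.Injective u
  · by_cases hE : Set.range u ⊆ M.E
    · exact extMonomial_mem_osIdeal (List.nodup_ofFn.2 hi) (by
        have h1 : {a | a ∈ List.ofFn u} = Set.range u := by ext; simp
        rw [h1]; exact ⟨h, hE⟩)
    · obtain ⟨_, ⟨i, rfl⟩, hi⟩ := Set.not_subset.1 hE
      have hw : ∀ l : List α, u i ∈ l → extMonomial l ∈ osIdeal M := by
        intro l
        induction l with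
        | nil => simp
        | cons a l ih =>
          intro hl
          rw [extMonomial_cons]
          rcases List.mem_cons.1 hl with h | h
          · exact osIdeal_mul_left _ (gen_mem_osIdeal (h ▸ hi))
          · exact osIdeal_mul_right _ (ih h)
      exact hw _ (by simp)
  · rw [wedge_eq_zero_of_not_injective hi]; exact (osIdeal M).zero_mem

theorem extDiff_wedge_mem_osIdeal {k : ℕ} {u : Fin k → α} (hE : Set.range u ⊆ M.E)
    (h : ¬M.Indep (Set.range u)) : extDiff (wedge u) ∈ osIdeal M := by
  by_cases hi : Function.Injective u
  · exact extDiff_mem_osIdeal (List.nodup_ofFn.2 hi) (by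
        have h1 : {a | a ∈ List.ofFn u} = Set.range u := by ext; simp
        rw [h1]; exact ⟨h, hE⟩)
  · rw [wedge_eq_zero_of_not_injective hi, map_zero]; exact (osIdeal M).zero_mem

/-- The incidence matrix of a tuple with the successive differences of a flag. -/
def flagMatrix {k : ℕ} (F : Fin (k + 1) → Set α) (u : Fin k → α) : Matrix (Fin k) (Fin k) ℤ :=
  Matrix.of fun i j => (F i.succ \ F i.castSucc).indicator (fun _ => (1 : ℤ)) (u j)

theorem res_osMk [M.Loopless] {c : Set α} (hc : IsAtomFlat M c) (x : ExtAlg α) :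
    res M c (osMk M x) = osMk (M.contract c) (contractGens c x) := by
  rw [res, dif_pos ⟨inferInstance, hc⟩, osLift_osMk]; rfl

theorem flagRes_succ {k : ℕ} (F : Fin (k + 2) → Set α) (x : OS M) :
    flagRes (k + 1) M F x = flagRes k (M.contract (F 1)) (flagTail F) (res M (F 1) x) := rfl

/-- The residue of a monomial along a flag is the determinant of the incidence matrix. -/
theorem flagRes_wedge [hM : M.Loopless] {k : ℕ} {F : Fin (k + 1) → Set α} (hF : F ∈ flags M k)
    (u : Fin k → α) : flagRes k M F (osMk M (wedge u)) = (flagMatrix F u).det := by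
  induction k generalizing M with
  | zero =>
    rw [Matrix.det_fin_zero, wedge_zero, flagRes, degZero, dif_pos hM, osLift_osMk]
    simp
  | succ k ih =>
    have hc := flags_isAtomFlat hF
    have := loopless_contract hc.1
    rw [flagRes_succ, res_osMk hc, contractGens_wedge, map_sum, map_sum, Matrix.det_succ_row_zero]
    refine Finset.sum_congr rfl fun j _ => ?_
    rw [map_smul, map_smul, ih (flagTail_mem hF), smul_eq_mul]
    congr 1
    · congr 1
      rw [flagMatrix, Matrix.of_apply, Fin.castSucc_zero, flags_zero_eq_empty hF, Set.sdiff_empty]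
      rfl
    · congr 1
      ext i l
      simp only [flagMatrix, Matrix.of_apply, Matrix.submatrix_apply, Function.comp_apply]
      congr 1
      have h1 : F 1 ⊆ F i.succ.castSucc := hF.1 (by rw [Fin.le_def]; simp)
      ext e
      simp only [flagTail, Set.mem_sdiff, ← Fin.succ_castSucc] at *
      constructor
      · rintro ⟨⟨h2, h3⟩, h4⟩; exact ⟨h2, fun h => h4 ⟨h, h3⟩⟩
      · rintro ⟨h2, h3⟩; exact ⟨⟨h2, fun h => h3 (h1 h)⟩, fun h => h3 h.1⟩

theorem osDegree_induction {k : ℕ} {p : OS M → Prop} (h0 : p 0)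
    (hadd : ∀ x y, p x → p y → p (x + y)) (hsmul : ∀ (n : ℤ) x, p x → p (n • x))
    (hw : ∀ u : Fin k → α, p (osMk M (wedge u))) {x : OS M} (hx : x ∈ osDegree M k) : p x := by
  obtain ⟨y, hy, rfl⟩ := hx
  rw [SetLike.mem_coe, ← span_wedge] at hy
  induction hy using Submodule.span_induction with
  | mem x h => obtain ⟨u, rfl⟩ := h; exact hw u
  | zero => rw [map_zero]; exact h0
  | add x y _ _ hx hy => rw [map_add]; exact hadd _ _ hx hy
  | smul a x _ hx => rw [map_smul]; exact hsmul _ _ hx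

theorem osMk_wedge_mem {k : ℕ} (u : Fin k → α) : osMk M (wedge u) ∈ osDegree M k :=
  ⟨_, wedge_mem k u, rfl⟩

theorem res_mem_osDegree [M.Loopless] {k : ℕ} {c : Set α} (hc : IsAtomFlat M c) {x : OS M}
    (hx : x ∈ osDegree M (k + 1)) : res M c x ∈ osDegree (M.contract c) k := by
  refine osDegree_induction (p := fun x => res M c x ∈ osDegree (M.contract c) k) ?_ ?_ ?_ ?_ hx
  · rw [map_zero]; exact Submodule.zero_mem _
  · intro x y h h'; rw [map_add]; exact Submodule.add_mem _ h h'
  · intro n x h; rw [map_smul]; exact Submodule.smul_mem _ _ h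
  · intro u
    rw [res_osMk hc, contractGens_wedge, map_sum]
    refine Submodule.sum_mem _ fun j _ => ?_
    rw [map_smul]
    exact Submodule.smul_mem _ _ (osMk_wedge_mem _)

theorem osMk_eq_zero {x : ExtAlg α} (h : x ∈ osIdeal M) : osMk M x = 0 :=
  (Submodule.Quotient.mk_eq_zero _).2 h

theorem det_flagMatrix_eq_zero_of_disjoint {k : ℕ} {F : Fin (k + 1) → Set α}
    {u : Fin k → α} (i : Fin k) (h : ∀ j, u j ∉ F i.succ \ F i.castSucc) :
    (flagMatrix F u).det = 0 :=
  Matrix.det_eq_zero_of_row_eq_zero i fun j => by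
    simp only [flagMatrix, Matrix.of_apply]
    exact Set.indicator_of_notMem (h j) _

theorem flagMatrix_transversal {k : ℕ} {F : Fin (k + 1) → Set α}
    (hF : F ∈ flags M k) {u : Fin k → α} (hu : IsTransversal F u) : flagMatrix F u = 1 := by
  ext i j
  simp only [flagMatrix, Matrix.of_apply]
  by_cases hij : i = j
  · subst hij; rw [Set.indicator_of_mem (hu i), Matrix.one_apply_eq]
  · rw [Matrix.one_apply_ne hij]
    refine Set.indicator_of_notMem (fun h => ?_) _
    rcases lt_or_gt_of_ne hij with h' | h'
    · exact (hu j).2 (hF.1 (by rw [Fin.le_def]; simpa using h') h.1)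
    · exact h.2 (hF.1 (by rw [Fin.le_def]; simpa using h') (hu j).1)

theorem det_flagMatrix_comp_perm {k : ℕ} (F : Fin (k + 1) → Set α) (u : Fin k → α)
    (σ : Equiv.Perm (Fin k)) :
    (flagMatrix F (u ∘ σ)).det = (Equiv.Perm.sign σ : ℤ) * (flagMatrix F u).det := by
  have h := Matrix.det_permute' σ (flagMatrix F u)
  rw [Int.cast_id] at h
  rw [← h]
  rfl

/-- A tuple with nonzero residue along a flag is a reordered transversal. -/
theorem exists_perm_isTransversal {k : ℕ} {F : Fin (k + 1) → Set α} (hF : F ∈ flags M k)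
    {u : Fin k → α} (h : (flagMatrix F u).det ≠ 0) :
    ∃ σ : Equiv.Perm (Fin k), IsTransversal F (u ∘ σ) := by
  have h1 : ∀ i : Fin k, ∃ j, u j ∈ F i.succ \ F i.castSucc := by
    intro i
    by_contra hcon
    push Not at hcon
    exact h (det_flagMatrix_eq_zero_of_disjoint i hcon)
  choose s hs using h1
  have ht : IsTransversal F (u ∘ s) := hs
  have hinj : Function.Injective s := Function.Injective.of_comp (ht.injective hF)
  exact ⟨Equiv.ofBijective s (Finite.injective_iff_bijective.1 hinj), hs⟩

end Monomials

/-! ### The flag expansion -/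

section FlagExpansion

variable {α : Type*} {M : Matroid α}

theorem flags_exists_step [M.Loopless] {k : ℕ} {F : Fin (k + 1) → Set α} (hF : F ∈ flags M k)
    {e : α} (i : Fin (k + 1)) (he : e ∈ F i) :
    ∃ j : Fin k, j.castSucc < i ∧ e ∈ F j.succ \ F j.castSucc := by
  induction i using Fin.induction with
  | zero => rw [flags_zero_eq_empty hF] at he; exact he.elim
  | succ i ih =>
    by_cases h : e ∈ F i.castSucc
    · obtain ⟨j, hj, hj'⟩ := ih h
      exact ⟨j, hj.trans Fin.castSucc_lt_succ, hj'⟩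
    · exact ⟨i, Fin.castSucc_lt_succ, he, h⟩

theorem flags_step_unique {k : ℕ} {F : Fin (k + 1) → Set α} (hF : F ∈ flags M k)
    {e : α} {i j : Fin k} (hi : e ∈ F i.succ \ F i.castSucc) (hj : e ∈ F j.succ \ F j.castSucc) :
    i = j := by
  by_contra hne
  rcases lt_or_gt_of_ne hne with h | h
  · exact hj.2 (hF.1 (by rw [Fin.le_def]; simpa using h) hi.1)
  · exact hi.2 (hF.1 (by rw [Fin.le_def]; simpa using h) hj.1)

theorem snoc_mem_flags_iff {k : ℕ} {F : Fin (k + 1) → Set α} {G : Set α} :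
    (Fin.snoc F G : Fin (k + 2) → Set α) ∈ flags M (k + 1) ↔
      F ∈ flags M k ∧ M.IsFlat G ∧ M.eRk G = (k + 1 : ℕ) ∧ F (Fin.last k) ⊆ G := by
  constructor
  · rintro ⟨h1, h2⟩
    refine ⟨⟨fun i j hij => ?_, fun i => ?_⟩, ?_, ?_, ?_⟩
    · simpa using h1 (Fin.castSucc_le_castSucc_iff.2 hij)
    · simpa using h2 i.castSucc
    · simpa using (h2 (Fin.last _)).1
    · simpa using (h2 (Fin.last _)).2
    · simpa using h1 (Fin.castSucc_lt_last (Fin.last k)).le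
  · rintro ⟨h1, h2, h3, h4⟩
    refine ⟨fun i j hij => ?_, fun i => ?_⟩
    · induction j using Fin.lastCases with
      | last =>
        induction i using Fin.lastCases with
        | last => exact le_rfl
        | cast i =>
          simp only [Fin.snoc_castSucc, Fin.snoc_last]
          exact (h1.1 (Fin.le_last i)).trans h4
      | cast j =>
        induction i using Fin.lastCases with
        | last => exact absurd hij (not_le.2 (Fin.castSucc_lt_last j))
        | cast i =>
          simp only [Fin.snoc_castSucc]
          exact h1.1 (Fin.castSucc_le_castSucc_iff.1 hij)
    · induction i using Fin.lastCases with
      | last => simpa using ⟨h2, h3⟩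
      | cast i => simpa using h1.2 i

theorem isTransversal_snoc_iff {k : ℕ} {F : Fin (k + 1) → Set α} {G : Set α} {t : Fin k → α}
    {b : α} : IsTransversal (Fin.snoc F G : Fin (k + 2) → Set α) (Fin.snoc t b : Fin (k + 1) → α) ↔
      IsTransversal F t ∧ b ∈ G \ F (Fin.last k) := by
  rw [IsTransversal, Fin.forall_fin_succ']
  refine and_congr (forall_congr' fun i => ?_) ?_
  · rw [Fin.snoc_castSucc, Fin.snoc_castSucc, Fin.succ_castSucc, Fin.snoc_castSucc]
  · rw [Fin.snoc_last, Fin.snoc_castSucc, Fin.succ_last, Fin.snoc_last]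

theorem not_injective_and_indep {k : ℕ} {u : Fin k → α} {X : Set α} (hu : ∀ i, u i ∈ X)
    (hX : M.eRk X < k) : ¬(Function.Injective u ∧ M.Indep (Set.range u)) := by
  rintro ⟨h1, h2⟩
  have h3 := h2.encard_le_eRk_of_subset (Set.range_subset_iff.2 hu)
  rw [← Set.image_univ, h1.encard_image, Set.encard_univ] at h3
  exact absurd hX (not_lt.2 (by simpa using h3))

/-- A monomial of degree exceeding the rank of its set of generators vanishes in the
Orlik–Solomon algebra. -/
theorem wedge_mem_osIdeal_of_eRk_lt {k : ℕ} {u : Fin k → α} {X : Set α} (hu : ∀ i, u i ∈ X)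
    (hX : M.eRk X < k) : wedge u ∈ osIdeal M := by
  by_cases hi : Function.Injective u
  · exact wedge_mem_osIdeal fun h => not_injective_and_indep hu hX ⟨hi, h⟩
  · rw [wedge_eq_zero_of_not_injective hi]; exact (osIdeal M).zero_mem

theorem extDiff_wedge_mem_osIdeal_of_eRk_lt {k : ℕ} {u : Fin k → α} {X : Set α}
    (hu : ∀ i, u i ∈ X) (hXE : X ⊆ M.E) (hX : M.eRk X < k) : extDiff (wedge u) ∈ osIdeal M := by
  by_cases hi : Function.Injective u
  · exact extDiff_wedge_mem_osIdeal ((Set.range_subset_iff.2 hu).trans hXE)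
      fun h => not_injective_and_indep hu hX ⟨hi, h⟩
  · rw [wedge_eq_zero_of_not_injective hi, map_zero]; exact (osIdeal M).zero_mem

theorem extDiff_wedge {k : ℕ} (u : Fin (k + 1) → α) :
    extDiff (wedge u) = ∑ j : Fin (k + 1), (-1 : ℤ) ^ (j : ℕ) • wedge (u ∘ j.succAbove) := by
  rw [extDiff, contractGens_wedge]
  simp

/-- Expansion of the residue along the last step of a flag, for monomials in generators contained
in the last flat. Adding all rows of the incidence matrix to the last one makes that row constant. -/
theorem det_flagMatrix_snoc [M.Loopless] {k : ℕ} {F : Fin (k + 1) → Set α} {G : Set α}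
    (hF : (Fin.snoc F G : Fin (k + 2) → Set α) ∈ flags M (k + 1)) {u : Fin (k + 1) → α}
    (hu : ∀ j, u j ∈ G) :
    (flagMatrix (Fin.snoc F G : Fin (k + 2) → Set α) u).det =
      ∑ j : Fin (k + 1), (-1) ^ (k + j : ℕ) * (flagMatrix F (u ∘ j.succAbove)).det := by
  set A := flagMatrix (Fin.snoc F G : Fin (k + 2) → Set α) u with hA
  have h1 := Matrix.det_updateRow_sum A (Fin.last k) (fun _ => 1)
  have hrow : (∑ i, (1 : ℤ) • A i) = fun _ => 1 := by
    funext j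
    have hs : (∑ i, (1 : ℤ) • A i) j = ∑ i, A i j := by
      simp only [one_smul]
      exact Finset.sum_apply _ _ _
    rw [hs]
    obtain ⟨i, -, hi⟩ := flags_exists_step hF (e := u j) (Fin.last _) (by simpa using hu j)
    rw [Finset.sum_eq_single i]
    · exact Set.indicator_of_mem hi (fun _ => (1 : ℤ))
    · intro i' _ hne
      exact Set.indicator_of_notMem (fun h => hne (flags_step_unique hF h hi)) (fun _ => (1 : ℤ))
    · simp
  rw [hrow, one_smul] at h1
  rw [← h1, Matrix.det_succ_row _ (Fin.last k)]
  refine Finset.sum_congr rfl fun j _ => ?_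
  rw [Matrix.updateRow_self, mul_one, Fin.val_last]
  congr 2
  ext i l
  rw [Matrix.submatrix_apply, Fin.succAbove_last, Matrix.updateRow_ne (Fin.castSucc_lt_last i).ne]
  simp only [hA, flagMatrix, Matrix.of_apply, Function.comp_apply]
  rw [Fin.succ_castSucc, Fin.snoc_castSucc, Fin.snoc_castSucc]

theorem last_eq_closure_of_det_flagMatrix_ne_zero [M.Loopless] {k : ℕ} {F : Fin (k + 1) → Set α}
    (hF : F ∈ flags M k) {u : Fin k → α} (h : (flagMatrix F u).det ≠ 0) :
    F (Fin.last k) = M.closure (Set.range u) := by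
  obtain ⟨σ, hσ⟩ := exists_perm_isTransversal hF h
  rw [← hσ.closure_eq hF (Fin.last k)]
  have : {j : Fin k | j.castSucc < Fin.last k} = Set.univ := by
    ext j; simp [Fin.castSucc_lt_last]
  rw [this, Set.image_univ, σ.surjective.range_comp]

/-- Left multiplication by a generator, followed by `φ`. -/
def genComp {N : Type*} [AddCommGroup N] (b : α) (φ : ExtAlg α →ₗ[ℤ] N) : ExtAlg α →ₗ[ℤ] N :=
  φ ∘ₗ LinearMap.mulLeft ℤ (gen b)

theorem genComp_eq_zero {N : Type*} [AddCommGroup N] (b : α) {φ : ExtAlg α →ₗ[ℤ] N}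
    (hφ : ∀ x ∈ osIdeal M, φ x = 0) : ∀ x ∈ osIdeal M, genComp b φ x = 0 :=
  fun _ hx => hφ _ (osIdeal_mul_left _ hx)

/-- For `b` in the flat spanned by `u`, the product of `e_b` with the differential of the monomial
of `u` is, up to sign, that monomial. -/
theorem apply_gen_mul_extDiff {N : Type*} [AddCommGroup N] {φ : ExtAlg α →ₗ[ℤ] N}
    (hφ : ∀ x ∈ osIdeal M, φ x = 0) {k : ℕ} {u : Fin (k + 1) → α} {G : Set α}
    (hu : ∀ i, u i ∈ G) (hGE : G ⊆ M.E) (hG : M.eRk G = (k + 1 : ℕ)) {b : α} (hb : b ∈ G) :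
    φ (gen b * extDiff (wedge u)) = (-1 : ℤ) ^ k • φ (wedge u) := by
  have h1 := extDiff_gen_mul_wedge b u
  rw [← wedge_snoc] at h1
  have h2 : φ (extDiff (wedge (Fin.snoc u b : Fin (k + 2) → α))) = 0 := by
    refine hφ _ (extDiff_wedge_mem_osIdeal_of_eRk_lt (X := G) (fun i => ?_) hGE ?_)
    · induction i using Fin.lastCases with
      | last => simpa using hb
      | cast i => simpa using hu i
    · rw [hG, Nat.cast_lt]; omega
  have h3 : φ (gen b * extDiff (wedge u)) + (-1 : ℤ) ^ (k + 1) • φ (wedge u) = 0 := by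
    rw [← map_smul, ← map_add, ← h1, h2]
  rw [eq_neg_of_add_eq_zero_left h3, pow_succ, mul_neg_one, neg_smul, neg_neg]

variable [Fintype α]

open Classical in
/-- The functional `φ` evaluated on the product, over the steps of the flag `F`, of the weighted
sums `∑ v F_i b • e_b` over the elements `b` of `F_i \ F_{i-1}`. -/
def flagEval {K N : Type*} [CommRing K] [AddCommGroup N] [Module K N] (v : Set α → α → K)
    {k : ℕ} (F : Fin (k + 1) → Set α) (φ : ExtAlg α →ₗ[ℤ] N) : N :=
  ∑ t : Fin k → α, if IsTransversal F t then (∏ i, v (F i.succ) (t i)) • φ (wedge t) else 0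

open Classical in
/-- The last factor of the product may be extended to all of the last flat, because the additional
terms are dependent monomials. -/
theorem flagEval_snoc {K N : Type*} [CommRing K] [AddCommGroup N] [Module K N]
    (v : Set α → α → K) {k : ℕ} {F : Fin (k + 1) → Set α} {G : Set α}
    (hF : (Fin.snoc F G : Fin (k + 2) → Set α) ∈ flags M (k + 1))
    (φ : ExtAlg α →ₗ[ℤ] N) (hφ : ∀ x ∈ osIdeal M, φ x = 0) :
    flagEval v (Fin.snoc F G : Fin (k + 2) → Set α) φ =
      ∑ b : α, if b ∈ G then v G b • flagEval v F (genComp b φ) else 0 := by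
  have hF' := snoc_mem_flags_iff.1 hF
  rw [flagEval, ← (Fin.snocEquiv fun _ : Fin (k + 1) => α).sum_comp, Fintype.sum_prod_type]
  refine Finset.sum_congr rfl fun b _ => ?_
  have hse : ∀ t : Fin k → α,
      (Fin.snocEquiv fun _ : Fin (k + 1) => α) (b, t) = (Fin.snoc t b : Fin (k + 1) → α) :=
    fun _ => rfl
  simp only [hse]
  rw [flagEval]
  split_ifs with hb
  · rw [Finset.smul_sum]
    refine Finset.sum_congr rfl fun t _ => ?_
    rw [smul_ite, smul_zero]
    by_cases ht : IsTransversal F t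
    · rw [if_pos ht]
      have hval : genComp b φ (wedge t) = φ (wedge (Fin.snoc t b : Fin (k + 1) → α)) := by
        rw [wedge_snoc]; rfl
      by_cases hbF : b ∈ F (Fin.last k)
      · have h0 : φ (wedge (Fin.snoc t b : Fin (k + 1) → α)) = 0 := by
          refine hφ _ (wedge_mem_osIdeal_of_eRk_lt (X := F (Fin.last k)) (fun i => ?_) ?_)
          · induction i using Fin.lastCases with
            | last => simpa using hbF
            | cast i => simpa using ht.mem_last hF'.1 i
          · rw [flags_eRk hF'.1]
            simp only [Fin.val_last, Nat.cast_lt]; omega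
        rw [hval, h0]; simp
      · rw [if_pos (isTransversal_snoc_iff.2 ⟨ht, hb, hbF⟩), hval, Fin.prod_univ_castSucc]
        simp only [Fin.snoc_castSucc, Fin.snoc_last, Fin.succ_castSucc, Fin.succ_last]
        rw [mul_comm, mul_smul]
    · rw [if_neg ht, if_neg fun h => ht (isTransversal_snoc_iff.1 h).1]
  · refine Finset.sum_eq_zero fun t _ => if_neg fun h => hb (isTransversal_snoc_iff.1 h).2.1

open Classical in
/-- **Flag expansion.** A functional on the Orlik–Solomon algebra is recovered on monomials from
their residues along flags, by replacing each step `F_i` of a flag by a weighted average of the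
generators in `F_i`. The proof is by induction on the degree: removing the last step of the flags
expands the residues of a monomial as those of its differential, and multiplying the differential
by any generator in the closure of the monomial recovers the monomial up to sign. -/
theorem flag_expansion [M.Loopless] {K N : Type*} [CommRing K] [AddCommGroup N] [Module K N]
    {v : Set α → α → K}
    (hv : ∀ G, M.IsFlat G → G.Nonempty → (∑ b : α, if b ∈ G then v G b else 0) = 1)
    (k : ℕ) (φ : ExtAlg α →ₗ[ℤ] N) (hφ : ∀ x ∈ osIdeal M, φ x = 0) (u : Fin k → α) :
    ∑ F ∈ (Set.toFinite (flags M k)).toFinset, (flagMatrix F u).det • flagEval v F φ =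
      φ (wedge u) := by
  induction k generalizing φ with
  | zero =>
    have h1 : (Set.toFinite (flags M 0)).toFinset = {fun _ => ∅} := by
      ext F
      rw [Set.Finite.mem_toFinset, Finset.mem_singleton]
      constructor
      · intro hF
        funext i
        rw [Fin.fin_one_eq_zero i, flags_zero_eq_empty hF]
      · rintro rfl
        refine ⟨fun _ _ _ => le_rfl, fun i => ⟨?_, by simp⟩⟩
        rw [Matroid.isFlat_iff_closure_eq, Matroid.closure_empty, M.loops_eq_empty]
    have h2 : IsTransversal (fun _ : Fin 1 => (∅ : Set α)) (default : Fin 0 → α) :=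
      fun i => i.elim0
    rw [h1, Finset.sum_singleton, flagEval, Fintype.sum_unique, if_pos h2]
    simp [wedge_zero]
  | succ k ih =>
    by_cases hind : Function.Injective u ∧ M.Indep (Set.range u)
    swap
    · have h0 : wedge u ∈ osIdeal M := by
        by_cases hi : Function.Injective u
        · exact wedge_mem_osIdeal fun h => hind ⟨hi, h⟩
        · rw [wedge_eq_zero_of_not_injective hi]; exact (osIdeal M).zero_mem
      rw [hφ _ h0]
      refine Finset.sum_eq_zero fun F hF => ?_
      rw [Set.Finite.mem_toFinset] at hF
      rw [← flagRes_wedge hF, osMk_eq_zero h0, map_zero]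
      simp
    obtain ⟨hinj, hind⟩ := hind
    set G := M.closure (Set.range u) with hG
    have hGf : M.IsFlat G := Matroid.isFlat_closure _
    have hGE := hGf.subset_ground
    have huG : ∀ i, u i ∈ G := fun i => M.subset_closure _ hind.subset_ground ⟨i, rfl⟩
    have hGr : M.eRk G = (k + 1 : ℕ) := by
      rw [hG, M.eRk_closure_eq, hind.eRk_eq_encard, ← Set.image_univ, hinj.encard_image,
        Set.encard_univ]
      simp
    have hv1 := hv G hGf ⟨_, huG 0⟩
    -- only flags ending in the closure of `u` contribute
    have hsum : ∑ F ∈ (Set.toFinite (flags M (k + 1))).toFinset,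
        (flagMatrix F u).det • flagEval v F φ =
        ∑ F ∈ (Set.toFinite (flags M k)).toFinset with F (Fin.last k) ⊆ G,
          (flagMatrix (Fin.snoc F G : Fin (k + 2) → Set α) u).det •
            flagEval v (Fin.snoc F G : Fin (k + 2) → Set α) φ := by
      rw [← Finset.sum_filter_of_ne (p := fun F => F (Fin.last (k + 1)) = G)]
      · refine Finset.sum_nbij' (fun F => Fin.init F)
          (fun F => (Fin.snoc F G : Fin (k + 2) → Set α)) ?_ ?_ ?_ ?_ ?_
        · intro F hF
          rw [Finset.mem_filter, Set.Finite.mem_toFinset] at hF ⊢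
          obtain ⟨hF1, hF2⟩ := hF
          rw [← Fin.snoc_init_self F, hF2, snoc_mem_flags_iff] at hF1
          exact ⟨hF1.1, hF1.2.2.2⟩
        · intro F hF
          rw [Finset.mem_filter, Set.Finite.mem_toFinset] at hF ⊢
          exact ⟨snoc_mem_flags_iff.2 ⟨hF.1, hGf, hGr, hF.2⟩, by simp⟩
        · intro F hF
          rw [Finset.mem_filter] at hF
          rw [← hF.2, Fin.snoc_init_self]
        · intro F _
          simp
        · intro F hF
          rw [Finset.mem_filter] at hF
          rw [← hF.2, Fin.snoc_init_self]
      · intro F hF h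
        rw [Set.Finite.mem_toFinset] at hF
        exact last_eq_closure_of_det_flagMatrix_ne_zero hF fun h0 => h (by rw [h0]; simp)
    have hterm : ∀ F ∈ flags M k, F (Fin.last k) ⊆ G →
        (flagMatrix (Fin.snoc F G : Fin (k + 2) → Set α) u).det •
            flagEval v (Fin.snoc F G : Fin (k + 2) → Set α) φ =
        ∑ b : α, if b ∈ G then v G b • ∑ j : Fin (k + 1), (-1 : ℤ) ^ (k + j : ℕ) •
          ((flagMatrix F (u ∘ j.succAbove)).det • flagEval v F (genComp b φ)) else 0 := by
      intro F hF hFG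
      have hs := snoc_mem_flags_iff.2 ⟨hF, hGf, hGr, hFG⟩
      rw [flagEval_snoc v hs φ hφ, det_flagMatrix_snoc hs huG, Finset.smul_sum]
      refine Finset.sum_congr rfl fun b _ => ?_
      split_ifs
      · rw [smul_comm, Finset.sum_smul]
        congr 1
        exact Finset.sum_congr rfl fun j _ => mul_smul _ _ _
      · simp
    rw [hsum, Finset.sum_congr rfl fun F hF => hterm F
      ((Set.Finite.mem_toFinset _).1 (Finset.mem_filter.1 hF).1) (Finset.mem_filter.1 hF).2]
    rw [Finset.sum_filter_of_ne]
    swap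
    · intro F hF h
      rw [Set.Finite.mem_toFinset] at hF
      obtain ⟨b, -, hb⟩ := Finset.exists_ne_zero_of_sum_ne_zero h
      obtain ⟨-, hb⟩ := ite_ne_right_iff.1 hb
      obtain ⟨j, -, hj⟩ := Finset.exists_ne_zero_of_sum_ne_zero (right_ne_zero_of_smul hb)
      have h1 : (flagMatrix F (u ∘ j.succAbove)).det ≠ 0 := fun h0 => hj (by rw [h0]; simp)
      rw [last_eq_closure_of_det_flagMatrix_ne_zero hF h1]
      exact M.closure_subset_closure (Set.range_comp_subset_range _ _)
    rw [Finset.sum_comm]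
    calc _ = ∑ b : α, if b ∈ G then v G b • φ (wedge u) else 0 := by
          refine Finset.sum_congr rfl fun b _ => ?_
          split_ifs with hb
          · rw [← Finset.smul_sum, Finset.sum_comm]
            congr 1
            simp_rw [← Finset.smul_sum, ih (genComp b φ) (genComp_eq_zero b hφ)]
            have h1 := apply_gen_mul_extDiff hφ huG hGE hGr hb
            have h2 : φ (gen b * extDiff (wedge u)) =
                ∑ j : Fin (k + 1), (-1 : ℤ) ^ (j : ℕ) • genComp b φ (wedge (u ∘ j.succAbove)) := by
              change genComp b φ (extDiff (wedge u)) = _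
              rw [extDiff_wedge, map_sum]
              exact Finset.sum_congr rfl fun j _ => map_smul _ _ _
            simp_rw [pow_add, mul_smul]
            rw [← Finset.smul_sum, ← h2, h1, smul_smul, ← mul_pow]
            simp
          · exact Finset.sum_const_zero
      _ = φ (wedge u) := by
          simp_rw [← ite_zero_smul]
          rw [← Finset.sum_smul, hv1, one_smul]

end FlagExpansion

/-! ### Residues along flags determine the elements of the Orlik–Solomon algebra -/

section FlagSpace

variable {α : Type*} {M : Matroid α}

open Classical in
/-- An element of `A^k(M)` is determined by its residues along flags. -/
theorem eq_of_flagRes_eq [Finite α] [M.Loopless] {k : ℕ} {x y : OS M} (hx : x ∈ osDegree M k)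
    (hy : y ∈ osDegree M k) (h : ∀ F ∈ flags M k, flagRes k M F x = flagRes k M F y) : x = y := by
  have := Fintype.ofFinite α
  -- weights concentrated on one element of each flat, so that no denominators occur
  let v : Set α → α → ℤ := fun G b => if h : G.Nonempty then if b = h.choose then 1 else 0 else 0
  have hv : ∀ G, M.IsFlat G → G.Nonempty → (∑ b : α, if b ∈ G then v G b else 0) = 1 := by
    intro G _ hG
    rw [Finset.sum_eq_single hG.choose]
    · rw [if_pos hG.choose_spec]; simp [v, hG]
    · intro b _ hb
      simp [v, hG, hb]
    · simp
  have key : ∀ x ∈ osDegree M k, x = ∑ F ∈ (Set.toFinite (flags M k)).toFinset,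
      flagRes k M F x • flagEval v F (osMk M) := by
    intro x hx
    refine osDegree_induction (p := fun x => x = ∑ F ∈ (Set.toFinite (flags M k)).toFinset,
      flagRes k M F x • flagEval v F (osMk M)) ?_ ?_ ?_ ?_ hx
    · simp
    · intro x y hx hy
      simp only [map_add, add_smul, Finset.sum_add_distrib]
      rw [← hx, ← hy]
    · intro n x hx
      simp only [map_smul, smul_assoc]
      rw [← Finset.smul_sum, ← hx]
    · intro u
      rw [← flag_expansion hv k (osMk M) (fun x hx => osMk_eq_zero hx) u]
      refine Finset.sum_congr rfl fun F hF => ?_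
      rw [Set.Finite.mem_toFinset] at hF
      rw [← flagRes_wedge hF, flag_expansion hv k (osMk M) (fun x hx => osMk_eq_zero hx) u]
  rw [key x hx, key y hy]
  refine Finset.sum_congr rfl fun F hF => ?_
  rw [h F ((Set.Finite.mem_toFinset _).1 hF)]

theorem flags_update_mem_iff {k : ℕ} {F : Fin (k + 1) → Set α} (hF : F ∈ flags M k) {a b : Fin k}
    (hab : (b : ℕ) = a + 1) (H : Set α) :
    Function.update F a.succ H ∈ flags M k ↔
      M.IsFlat H ∧ M.eRk H = (a + 1 : ℕ) ∧ F a.castSucc ⊆ H ∧ H ⊆ F b.succ := by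
  have h1 : a.castSucc ≠ a.succ := Fin.castSucc_lt_succ.ne
  have h2 : b.succ ≠ a.succ := fun h => by rw [Fin.ext_iff] at h; simp at h; omega
  constructor
  · intro h
    refine ⟨?_, ?_, ?_, ?_⟩
    · simpa using flags_isFlat h a.succ
    · simpa using flags_eRk h a.succ
    · simpa [h1] using h.1 (Fin.castSucc_lt_succ (i := a)).le
    · have h3 : a.succ ≤ b.succ := by rw [Fin.le_def]; simp; omega
      simpa [h2] using h.1 h3
  · rintro ⟨hH, hr, hl, hu⟩
    refine ⟨fun i j hij => ?_, fun i => ?_⟩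
    · rw [Fin.le_def] at hij
      by_cases hi : i = a.succ <;> by_cases hj : j = a.succ
      · rw [hi, hj]
      · subst hi
        rw [Function.update_self, Function.update_of_ne hj]
        refine hu.trans (hF.1 ?_)
        rw [Fin.ext_iff] at hj
        rw [Fin.le_def]
        simp only [Fin.val_succ] at *
        omega
      · subst hj
        rw [Function.update_self, Function.update_of_ne hi]
        refine Set.Subset.trans (hF.1 ?_) hl
        rw [Fin.ext_iff] at hi
        rw [Fin.le_def]
        simp only [Fin.val_succ, Fin.val_castSucc] at *
        omega
      · rw [Function.update_of_ne hj, Function.update_of_ne hi]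
        exact hF.1 hij
    · by_cases hi : i = a.succ
      · subst hi; rw [Function.update_self]; exact ⟨hH, by simpa using hr⟩
      · rw [Function.update_of_ne hi]; exact hF.2 i

open Classical in
/-- The relations between the values of a function on flags: for each flag with one inner step
removed, the values at all flags that complete it sum to zero. -/
def FlagRel [Fintype α] (M : Matroid α) (k : ℕ) (f : (Fin (k + 1) → Set α) → ℤ) : Prop :=
  ∀ F ∈ flags M k, ∀ a b : Fin k, (b : ℕ) = a + 1 →
    ∑ H : Set α with Function.update F a.succ H ∈ flags M k, f (Function.update F a.succ H) = 0

theorem det_updateRow_sum_eq {n : ℕ} {ι : Type*} (A : Matrix (Fin n) (Fin n) ℤ) (a : Fin n)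
    (s : Finset ι) (h : ι → Fin n → ℤ) :
    ∑ i ∈ s, (A.updateRow a (h i)).det = (A.updateRow a (∑ i ∈ s, h i)).det :=
  (map_sum ((Matrix.detRowAlternating (R := ℤ) (n := Fin n)).toMultilinearMap.toLinearMap A a)
    h s).symm

open Classical in
theorem flagRel_det [Fintype α] (M : Matroid α) {k : ℕ} (u : Fin k → α) :
    FlagRel M k fun F => (flagMatrix F u).det := by
  intro F hF a b hab
  have hba : a.succ = b.castSucc := by ext; simp [hab]
  have hne : a ≠ b := fun h => by rw [h] at hab; omega
  set d : Fin k → ℤ := fun j => (F b.succ \ F a.castSucc).indicator (fun _ => 1) (u j) with hd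
  set h : Set α → Fin k → ℤ := fun H j => (H \ F a.castSucc).indicator (fun _ => 1) (u j) with hh
  have hA : ∀ H : Set α, Function.update F a.succ H ∈ flags M k →
      (flagMatrix (Function.update F a.succ H) u).det =
        (((flagMatrix F u).updateRow b d).updateRow a (h H)).det := by
    intro H hH
    obtain ⟨-, -, hl, hu⟩ := (flags_update_mem_iff hF hab H).1 hH
    rw [← Matrix.det_updateRow_add_self (flagMatrix (Function.update F a.succ H) u) hne.symm]
    congr 1
    ext i j
    by_cases hib : i = b
    · subst hib
      rw [Matrix.updateRow_self, Matrix.updateRow_ne hne.symm, Matrix.updateRow_self, Pi.add_apply]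
      simp only [flagMatrix, Matrix.of_apply, hd]
      have h2 : i.succ ≠ a.succ := fun h => hne (Fin.succ_injective _ h).symm
      rw [← hba, Function.update_self, Function.update_of_ne h2,
        Function.update_of_ne Fin.castSucc_lt_succ.ne]
      by_cases h3 : u j ∈ H
      · simp [Set.indicator_apply, h3, hu h3]
      · have h4 : u j ∉ F a.castSucc := fun h => h3 (hl h)
        simp [Set.indicator_apply, h3, h4]
    · rw [Matrix.updateRow_ne hib]
      by_cases hia : i = a
      · subst hia
        rw [Matrix.updateRow_self]
        simp only [flagMatrix, Matrix.of_apply, hh]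
        rw [Function.update_self, Function.update_of_ne Fin.castSucc_lt_succ.ne]
      · rw [Matrix.updateRow_ne hia, Matrix.updateRow_ne hib]
        simp only [flagMatrix, Matrix.of_apply]
        rw [Function.update_of_ne fun h => hia (Fin.succ_injective _ h),
          Function.update_of_ne fun h => hib (Fin.castSucc_injective _ (h.trans hba))]
  rw [Finset.sum_congr rfl fun H hH => hA H (Finset.mem_filter.1 hH).2, det_updateRow_sum_eq]
  -- the flats strictly between two neighbours of the removed step partition their difference
  have hsum : ∑ H : Set α with Function.update F a.succ H ∈ flags M k, h H = d := by
    funext j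
    rw [Finset.sum_apply]
    have hfl := flags_isFlat hF a.castSucc
    have hr := flags_eRk hF a.castSucc
    rw [Fin.val_castSucc] at hr
    by_cases hj : u j ∈ F b.succ \ F a.castSucc
    · have hd1 : d j = 1 := Set.indicator_of_mem hj (fun _ => (1 : ℤ))
      have hjE : u j ∈ M.E := (flags_isFlat hF _).subset_ground hj.1
      have hsub : insert (u j) (F a.castSucc) ⊆ M.E := Set.insert_subset hjE hfl.subset_ground
      have hab' : F a.castSucc ⊆ F b.succ := hF.1 (by rw [Fin.le_def]; simp; omega)
      rw [hd1, Finset.sum_eq_single (M.closure (insert (u j) (F a.castSucc)))]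
      · exact Set.indicator_of_mem (s := M.closure (insert (u j) (F a.castSucc)) \ F a.castSucc)
          ⟨M.subset_closure _ hsub (Set.mem_insert _ _), hj.2⟩ (fun _ => (1 : ℤ))
      · intro H hH hHne
        obtain ⟨hf, hr', hl, hu⟩ := (flags_update_mem_iff hF hab H).1 (Finset.mem_filter.1 hH).2
        refine Set.indicator_of_notMem (fun hm => hHne ?_) _
        exact (closure_insert_eq_of_eRk hfl hf hl hr hr' hm).symm
      · intro hH
        refine absurd (Finset.mem_filter.2 ⟨Finset.mem_univ _, ?_⟩) hH
        rw [flags_update_mem_iff hF hab]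
        refine ⟨Matroid.isFlat_closure _, ?_, ?_, ?_⟩
        · rw [M.eRk_closure_eq, Matroid.eRk_insert_eq_add_one, hr]
          · rfl
          · rw [hfl.closure]; exact ⟨hjE, hj.2⟩
        · exact (Set.subset_insert _ _).trans (M.subset_closure _ hsub)
        · rw [← (flags_isFlat hF b.succ).closure]
          exact M.closure_subset_closure (Set.insert_subset hj.1 hab')
    · have hd0 : d j = 0 := Set.indicator_of_notMem hj _
      rw [hd0]
      refine Finset.sum_eq_zero fun H hH => ?_
      obtain ⟨hf, hr', hl, hu⟩ := (flags_update_mem_iff hF hab H).1 (Finset.mem_filter.1 hH).2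
      exact Set.indicator_of_notMem (fun hm => hj ⟨hu hm.1, hm.2⟩) _
  rw [hsum]
  have := Matrix.det_updateRow_eq_zero (M := (flagMatrix F u).updateRow b d) hne.symm
  rwa [Matrix.updateRow_self] at this

theorem flagRel_flagRes [Fintype α] [M.Loopless] {k : ℕ} {x : OS M} (hx : x ∈ osDegree M k) :
    FlagRel M k fun F => flagRes k M F x := by
  classical
  refine osDegree_induction (p := fun x => FlagRel M k fun F => flagRes k M F x) ?_ ?_ ?_ ?_ hx
  · intro F hF a b hab; simp
  · intro x y hx hy F hF a b hab
    simp only [map_add, Finset.sum_add_distrib]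
    have h1 := hx F hF a b hab
    have h2 := hy F hF a b hab
    simp only at h1 h2
    rw [h1, h2, add_zero]
  · intro n x hx F hF a b hab
    simp only [map_smul]
    rw [← Finset.smul_sum]
    have h1 := hx F hF a b hab
    simp only at h1
    rw [h1, smul_zero]
  · intro u F hF a b hab
    have h1 := flagRel_det M u F hF a b hab
    refine Eq.trans (Finset.sum_congr rfl fun H hH => ?_) h1
    exact flagRes_wedge (Finset.mem_filter.1 hH).2 u

/-! ### Functions on flags that come from the Orlik–Solomon algebra -/

/-- The smallest label of an element of `G`. -/
def minLabel (ρ : α → ℕ) (G : Set α) : ℕ := sInf (ρ '' G)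

theorem minLabel_le {ρ : α → ℕ} {G : Set α} {e : α} (he : e ∈ G) : minLabel ρ G ≤ ρ e :=
  Nat.sInf_le ⟨e, he, rfl⟩

theorem exists_minLabel {ρ : α → ℕ} {G : Set α} (hG : G.Nonempty) : ∃ e ∈ G, ρ e = minLabel ρ G :=
  Nat.sInf_mem (hG.image ρ)

/-- The smallest labels of the flats of a flag strictly decrease. Such flags correspond to the bases
without broken circuits. -/
def IsNbcFlag (ρ : α → ℕ) {k : ℕ} (F : Fin (k + 1) → Set α) : Prop :=
  ∀ a b : Fin k, (b : ℕ) = a + 1 → minLabel ρ (F b.succ) < minLabel ρ (F a.succ)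

theorem flags_succ_nonempty {k : ℕ} {F : Fin (k + 1) → Set α} (hF : F ∈ flags M k) (i : Fin k) :
    (F i.succ).Nonempty :=
  (flags_exists_mem_sdiff hF i).imp fun _ h => h.1

/-- If the minimal labels strictly decrease before the step `a`, the element of minimal label in the
flat of step `a` is new at that step. -/
theorem notMem_castSucc_of_minLabel [M.Loopless] {ρ : α → ℕ} {k : ℕ} {F : Fin (k + 1) → Set α}
    (hF : F ∈ flags M k) {a : Fin k}
    (h : ∀ a' : Fin k, (a : ℕ) = a' + 1 → minLabel ρ (F a.succ) < minLabel ρ (F a'.succ))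
    {e : α} (he : ρ e = minLabel ρ (F a.succ)) : e ∉ F a.castSucc := by
  intro h'
  by_cases ha : (a : ℕ) = 0
  · have : a.castSucc = 0 := by ext; simp [ha]
    rw [this, flags_zero_eq_empty hF] at h'
    exact h'
  · have hlt : (a : ℕ) - 1 < k := by omega
    have h1 : (⟨a - 1, hlt⟩ : Fin k).succ = a.castSucc := by
      ext; simp only [Fin.val_succ, Fin.val_castSucc]; omega
    have h2 := h ⟨a - 1, hlt⟩ (by simp only; omega)
    rw [h1, ← he] at h2
    exact absurd (minLabel_le (ρ := ρ) h') (not_le.2 h2)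

open Classical in
/-- A function on flags that satisfies the flag relations and vanishes on the flags with decreasing
minimal labels vanishes identically: where two consecutive minimal labels agree, the relation
expresses a value in terms of values at flags with larger labels. -/
theorem flagRel_eq_zero [Fintype α] [M.Loopless] {ρ : α → ℕ} (hρ : Function.Injective ρ) {k : ℕ}
    {f : (Fin (k + 1) → Set α) → ℤ} (hf : FlagRel M k f)
    (h0 : ∀ F ∈ flags M k, IsNbcFlag ρ F → f F = 0) : ∀ F ∈ flags M k, f F = 0 := by
  obtain ⟨C, hC⟩ : ∃ C, ∀ e, ρ e ≤ C := ⟨∑ e, ρ e, fun e =>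
    Finset.single_le_sum (fun _ _ => Nat.zero_le _) (Finset.mem_univ e)⟩
  have hbound : ∀ F ∈ flags M k, ∑ i : Fin k, minLabel ρ (F i.succ) ≤ k * C := by
    intro F hF
    refine (Finset.sum_le_card_nsmul _ _ C fun i _ => ?_).trans (by simp)
    obtain ⟨e, -, he⟩ := exists_minLabel (ρ := ρ) (flags_succ_nonempty hF i)
    rw [← he]; exact hC e
  have key : ∀ n : ℕ, ∀ F ∈ flags M k, k * C - ∑ i : Fin k, minLabel ρ (F i.succ) = n →
      f F = 0 := by
    intro n
    induction n using Nat.strong_induction_on with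
    | _ n ih =>
      intro F hF hn
      by_cases hnbc : IsNbcFlag ρ F
      · exact h0 F hF hnbc
      -- take the first step at which the minimal label does not decrease
      have hex : ∃ m : ℕ, ∃ a b : Fin k, (a : ℕ) = m ∧ (b : ℕ) = a + 1 ∧
          ¬minLabel ρ (F b.succ) < minLabel ρ (F a.succ) := by
        simp only [IsNbcFlag, not_forall] at hnbc
        obtain ⟨a, b, hab, h⟩ := hnbc
        exact ⟨a, a, b, rfl, hab, h⟩
      obtain ⟨a, b, ha, hab, hlab⟩ := Nat.find_spec hex
      have hmin : ∀ a' : Fin k, (a : ℕ) = a' + 1 →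
          minLabel ρ (F a.succ) < minLabel ρ (F a'.succ) := by
        intro a' haa'
        by_contra hcon
        exact Nat.find_min hex (m := a') (by omega) ⟨a', a, rfl, haa', hcon⟩
      obtain ⟨e, he, hel⟩ := exists_minLabel (ρ := ρ) (flags_succ_nonempty hF a)
      have heF := notMem_castSucc_of_minLabel hF hmin hel
      have hrel := hf F hF a b hab
      rw [Finset.sum_eq_single (F a.succ)] at hrel
      · rwa [Function.update_eq_self] at hrel
      · intro H hH hne
        have hHm := (Finset.mem_filter.1 hH).2
        obtain ⟨hHf, hHr, hl, hu⟩ := (flags_update_mem_iff hF hab H).1 hHm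
        have heH : e ∉ H := fun h => hne (inter_eq_of_cover (flags_isFlat hF a.castSucc) hHf
          (flags_isFlat hF a.succ) hl (flags_subset hF a) (by simpa using flags_eRk hF a.castSucc)
          hHr (by simpa using flags_eRk hF a.succ) h he heF)
        have hlt : minLabel ρ (F a.succ) < minLabel ρ H := by
          obtain ⟨x, hx, hxl⟩ := exists_minLabel (ρ := ρ) (G := H)
            (by simpa using flags_succ_nonempty hHm a)
          rw [← hxl, ← hel]
          refine lt_of_le_of_ne ?_ fun h => heH (hρ h ▸ hx)
          rw [hel]
          exact (not_lt.1 hlab).trans (minLabel_le (hu hx))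
        have hsum : ∑ i : Fin k, minLabel ρ (F i.succ) <
            ∑ i : Fin k, minLabel ρ (Function.update F a.succ H i.succ) := by
          refine Finset.sum_lt_sum (fun i _ => ?_) ⟨a, Finset.mem_univ _, by simpa using hlt⟩
          by_cases hi : i = a
          · subst hi; simpa using hlt.le
          · rw [Function.update_of_ne fun h => hi (Fin.succ_injective _ h)]
        have hb := hbound _ hHm
        exact ih _ (by omega) _ hHm rfl
      · intro hH
        exact absurd (Finset.mem_filter.2 ⟨Finset.mem_univ _, by
          rw [Function.update_eq_self]; exact hF⟩) hH
  exact fun F hF => key _ F hF rfl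

/-- Flags with decreasing minimal labels are separated by the monomials in the elements of minimal
label. -/
theorem eq_of_det_flagMatrix_ne_zero [M.Loopless] {ρ : α → ℕ} {k : ℕ}
    {F G : Fin (k + 1) → Set α} (hF : F ∈ flags M k) (hG : G ∈ flags M k) (hFn : IsNbcFlag ρ F)
    (hGn : IsNbcFlag ρ G) {t : Fin k → α} (ht : ∀ i, t i ∈ F i.succ)
    (htl : ∀ i, ρ (t i) = minLabel ρ (F i.succ)) (h : (flagMatrix G t).det ≠ 0) : G = F := by
  have htr : IsTransversal F t := fun i =>
    ⟨ht i, notMem_castSucc_of_minLabel hF (fun a' h => hFn a' i h) (htl i)⟩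
  obtain ⟨σ, hσ⟩ := exists_perm_isTransversal hG h
  have key : ∀ i : Fin (k + 1), G i = F i ∧ ∀ j : Fin k, i ≤ j.castSucc → σ j = j := by
    intro i
    induction i using Fin.reverseInduction with
    | last =>
      refine ⟨?_, fun j hj => absurd hj (not_le.2 (Fin.castSucc_lt_last j))⟩
      rw [last_eq_closure_of_det_flagMatrix_ne_zero hG h, ← htr.closure_eq hF (Fin.last k)]
      have : {j : Fin k | j.castSucc < Fin.last k} = Set.univ := by
        ext j; simp [Fin.castSucc_lt_last]
      rw [this, Set.image_univ]
    | cast i ih =>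
      obtain ⟨hGF, hfix⟩ := ih
      -- `t i` has minimal label in the flat `G i.succ` and hence is new at the step `i` of `G`
      have hi : t i ∈ G i.succ \ G i.castSucc := by
        refine ⟨hGF ▸ ht i, notMem_castSucc_of_minLabel hG (fun a' h => hGn a' i h) ?_⟩
        rw [htl, hGF]
      have hσi : σ i = i := by
        have h1 := hσ (σ.symm i)
        simp only [Function.comp_apply, Equiv.apply_symm_apply] at h1
        have h2 := flags_step_unique hG hi h1
        exact (Equiv.eq_symm_apply σ).1 h2
      have hfix' : ∀ j : Fin k, i.castSucc ≤ j.castSucc → σ j = j := by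
        intro j hj
        rcases hj.eq_or_lt with h1 | h1
        · rw [← Fin.castSucc_injective _ h1, hσi]
        · exact hfix j (by rw [Fin.le_def]; simpa using h1)
      refine ⟨?_, hfix'⟩
      rw [← hσ.closure_eq hG i.castSucc, ← htr.closure_eq hF i.castSucc, Set.image_comp]
      congr 2
      ext j
      simp only [Set.mem_image, Set.mem_ofPred_eq]
      constructor
      · rintro ⟨l, hl, rfl⟩
        by_contra hcon
        have h1 := hfix' (σ l) (not_lt.1 hcon)
        rw [σ.injective h1] at hcon
        exact hcon hl
      · intro hj
        refine ⟨σ.symm j, ?_, by simp⟩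
        by_contra hcon
        have h1 := hfix' (σ.symm j) (not_lt.1 hcon)
        rw [Equiv.apply_symm_apply] at h1
        rw [← h1] at hcon
        exact hcon hj
  exact funext fun i => (key i).1

open Classical in
/-- Every function on flags that satisfies the flag relations is given by the residues of an element
of the Orlik–Solomon algebra. -/
theorem exists_flagRes_eq [Fintype α] [M.Loopless] {k : ℕ} {f : (Fin (k + 1) → Set α) → ℤ}
    (hf : FlagRel M k f) : ∃ ω ∈ osDegree M k, ∀ F ∈ flags M k, flagRes k M F ω = f F := by
  let ρ : α → ℕ := fun e => Fintype.equivFin α e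
  have hρ : Function.Injective ρ := Fin.val_injective.comp (Fintype.equivFin α).injective
  by_cases hk : Nonempty (Fin k → α)
  swap
  · exact ⟨0, Submodule.zero_mem _, fun F hF => absurd ⟨(exists_isTransversal hF).choose⟩ hk⟩
  have hex : ∀ F : Fin (k + 1) → Set α, ∃ t : Fin k → α, F ∈ flags M k →
      ∀ i, t i ∈ F i.succ ∧ ρ (t i) = minLabel ρ (F i.succ) := by
    intro F
    by_cases hF : F ∈ flags M k
    · choose t ht using fun i => exists_minLabel (ρ := ρ) (flags_succ_nonempty hF i)
      exact ⟨t, fun _ => ht⟩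
    · exact ⟨hk.some, fun h => absurd h hF⟩
  choose t ht using hex
  set ω : OS M := ∑ F ∈ (Set.toFinite (flags M k)).toFinset with IsNbcFlag ρ F,
    f F • osMk M (wedge (t F)) with hω
  have hωd : ω ∈ osDegree M k :=
    Submodule.sum_mem _ fun F _ => Submodule.smul_mem _ _ (osMk_wedge_mem _)
  refine ⟨ω, hωd, ?_⟩
  have hrel : FlagRel M k fun F => flagRes k M F ω - f F := by
    intro F hF a b hab
    rw [Finset.sum_sub_distrib, hf F hF a b hab, flagRel_flagRes hωd F hF a b hab, sub_zero]
  intro G hG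
  refine sub_eq_zero.1 (flagRel_eq_zero hρ hrel ?_ G hG)
  intro G hG hGn
  rw [sub_eq_zero, hω, map_sum, Finset.sum_eq_single G]
  · have htr : IsTransversal G (t G) := fun i =>
      ⟨(ht G hG i).1, notMem_castSucc_of_minLabel hG (fun a' h => hGn a' i h) (ht G hG i).2⟩
    rw [map_smul, flagRes_wedge hG, flagMatrix_transversal hG htr]
    simp
  · intro F hF hne
    rw [Finset.mem_filter, Set.Finite.mem_toFinset] at hF
    rw [map_smul, flagRes_wedge hG]
    by_cases h : (flagMatrix G (t F)).det = 0
    · rw [h, smul_zero]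
    · exact absurd (eq_of_det_flagMatrix_ne_zero hF.1 hG hF.2 hGn (fun i => (ht F hF.1 i).1)
        (fun i => (ht F hF.1 i).2) h).symm hne
  · intro h
    exact absurd (Finset.mem_filter.2 ⟨(Set.Finite.mem_toFinset _).2 hG, hGn⟩) h

end FlagSpace

/-! ### Covectors, flats and contractions of oriented matroids -/

namespace OrientedMatroid

section Covectors

variable {α : Type*} {𝓜 : OrientedMatroid α}

theorem matroid_indep_iff {I : Set α} : 𝓜.matroid.Indep I ↔ 𝓜.IsIndep I := Iff.rfl

theorem closure_eq_cl_of_isIndep {I : Set α} (hI : 𝓜.IsIndep I) :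
    𝓜.matroid.closure I = 𝓜.cl I := by
  ext e
  have hIi : 𝓜.matroid.Indep I := hI
  rw [hIi.mem_closure_iff]
  constructor
  · rintro (h | h)
    · by_contra hcl
      exact h.not_indep (isIndep_insert hI (h.subset_ground (Set.mem_insert _ _)) hcl)
    · exact subset_cl hI.1 h
  · intro h
    by_cases heI : e ∈ I
    · exact Or.inr heI
    · refine Or.inl ⟨fun hi => ?_, Set.insert_subset h.1 hI.1⟩
      refine (matroid_indep_iff.1 hi).2 e (Set.mem_insert _ _) ?_
      rwa [Set.insert_sdiff_self_of_notMem heI]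

theorem closure_eq_cl {S : Set α} (hS : S ⊆ 𝓜.E) : 𝓜.matroid.closure S = 𝓜.cl S := by
  obtain ⟨I, hI⟩ := 𝓜.matroid.exists_isBasis S hS
  have hcl := closure_eq_cl_of_isIndep (matroid_indep_iff.1 hI.indep)
  rw [← hI.closure_eq_closure, hcl]
  refine Set.Subset.antisymm (cl_mono hI.subset) (cl_subset_of_subset_cl ?_)
  rw [← hcl]
  exact hI.subset_closure

theorem isFlat_iff {F : Set α} : 𝓜.matroid.IsFlat F ↔ F ⊆ 𝓜.E ∧ 𝓜.cl F ⊆ F := by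
  constructor
  · intro h
    have hE : F ⊆ 𝓜.E := h.subset_ground
    exact ⟨hE, by rw [← closure_eq_cl hE, h.closure]⟩
  · rintro ⟨hE, h⟩
    rw [Matroid.isFlat_iff_closure_eq, closure_eq_cl hE]
    exact Set.Subset.antisymm h (subset_cl hE)

variable (𝓜) in
/-- The zero set of a sign vector in the ground set. -/
def zeroSet (X : α → SignType) : Set α := {e | e ∈ 𝓜.E ∧ X e = 0}

theorem eq_zero_of_notMem {X : α → SignType} (hX : X ∈ 𝓜.covectors) {e : α} (he : e ∉ 𝓜.E) :
    X e = 0 := by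
  by_contra h
  exact he (𝓜.mem_E X hX e h)

theorem isFlat_zeroSet {X : α → SignType} (hX : X ∈ 𝓜.covectors) :
    𝓜.matroid.IsFlat (𝓜.zeroSet X) :=
  isFlat_iff.2 ⟨fun _ h => h.1, fun _ he => ⟨he.1, he.2 X hX fun _ hf => hf.2⟩⟩

theorem signComp_of_ne {X Y : α → SignType} {e : α} (h : X e ≠ 0) : signComp X Y e = X e :=
  if_neg h

theorem signComp_of_eq {X Y : α → SignType} {e : α} (h : X e = 0) : signComp X Y e = Y e :=
  if_pos h

/-- Every flat is the zero set of a covector. -/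
theorem exists_zeroSet_eq {F : Set α} (hF : 𝓜.matroid.IsFlat F) :
    ∃ X ∈ 𝓜.covectors, 𝓜.zeroSet X = F := by
  have hF' := isFlat_iff.1 hF
  have key : ∀ T : Set α, T.Finite → T ⊆ 𝓜.E \ F →
      ∃ X ∈ 𝓜.covectors, (∀ f ∈ F, X f = 0) ∧ ∀ e ∈ T, X e ≠ 0 := by
    intro T hT
    induction T, hT using Set.Finite.induction_on with
    | empty => exact fun _ => ⟨0, 𝓜.zero_mem, by simp, by simp⟩
    | insert _ _ ih =>
      rename_i e T _ _
      intro hsub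
      obtain ⟨X, hX, hX0, hXT⟩ := ih ((Set.subset_insert _ _).trans hsub)
      have he := hsub (Set.mem_insert _ _)
      obtain ⟨Y, hY, hY0, hYe⟩ := (notMem_cl_iff he.1).1 fun h => he.2 (hF'.2 h)
      refine ⟨signComp X Y, 𝓜.comp_mem X hX Y hY, fun f hf => ?_, ?_⟩
      · rw [signComp_of_eq (hX0 f hf), hY0 f hf]
      · rintro f (rfl | hf)
        · by_cases h : X f = 0
          · rwa [signComp_of_eq h]
          · rwa [signComp_of_ne h]
        · rw [signComp_of_ne (hXT f hf)]; exact hXT f hf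
  obtain ⟨X, hX, h0, h1⟩ := key (𝓜.E \ F) 𝓜.finite_E.sdiff subset_rfl
  refine ⟨X, hX, Set.Subset.antisymm ?_ fun e he => ⟨hF'.1 he, h0 e he⟩⟩
  rintro e ⟨he, he0⟩
  by_contra h
  exact h1 e ⟨he, h⟩ he0

/-- Covectors that vanish on `F` agree up to a sign on elements that are parallel modulo `F`. -/
theorem mul_eq_mul_of_mem_cl {F : Set α} {e f : α} (h : f ∈ 𝓜.cl (insert e F))
    {X Y : α → SignType} (hX : X ∈ 𝓜.covectors) (hY : Y ∈ 𝓜.covectors) (hX0 : ∀ g ∈ F, X g = 0)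
    (hY0 : ∀ g ∈ F, Y g = 0) : X e * Y f = X f * Y e := by
  have key : ∀ Z ∈ 𝓜.covectors, (∀ g ∈ F, Z g = 0) → Z e = 0 → Z f = 0 := by
    intro Z hZ hZ0 hZe
    refine h.2 Z hZ ?_
    rintro g (rfl | hg)
    exacts [hZe, hZ0 g hg]
  have main : ∀ Y ∈ 𝓜.covectors, (∀ g ∈ F, Y g = 0) → X e ≠ 0 → Y e = -X e → Y f = -X f := by
    intro Y hY hY0 hXe hYe
    obtain ⟨Z, hZ, hZe, hZ'⟩ := 𝓜.elim X hX Y hY e hXe hYe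
    have hZF : ∀ g ∈ F, Z g = 0 := fun g hg => by
      rw [hZ' g (by simp [hX0 g hg]), signComp_of_eq (hX0 g hg), hY0 g hg]
    have hZf := key Z hZ hZF hZe
    by_contra hne
    by_cases hXf : X f = 0
    · rw [hZ' f (by simp [hXf]), signComp_of_eq hXf] at hZf
      exact hne (by rw [hZf, hXf]; rfl)
    · rw [hZ' f (by simp [hne]), signComp_of_ne hXf] at hZf
      exact hXf hZf
  by_cases hXe : X e = 0
  · rw [hXe, key X hX hX0 hXe, zero_mul, zero_mul]
  by_cases hYe : Y e = 0
  · rw [hYe, key Y hY hY0 hYe, mul_zero, mul_zero]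
  by_cases hs : Y e = -X e
  · rw [hs, main Y hY hY0 hXe hs]
    generalize X e = a, X f = b
    revert a b; decide
  · have hs' : (-Y) e = -X e := by
      rw [Pi.neg_apply]
      revert hXe hYe hs
      generalize X e = a, Y e = b
      revert a b; decide
    have h1 := main (-Y) (𝓜.neg_mem Y hY) (fun g hg => by simp [hY0 g hg]) hXe hs'
    rw [Pi.neg_apply, neg_inj] at h1 hs'
    rw [h1, hs', mul_comm]

variable (𝓜) in
/-- The contraction of `𝓜` by `C`: its covectors are the covectors of `𝓜` that vanish on `C`. -/
def contraction (C : Set α) : OrientedMatroid α where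
  E := 𝓜.E \ C
  finite_E := 𝓜.finite_E.sdiff
  covectors := {X | X ∈ 𝓜.covectors ∧ ∀ f ∈ C, X f = 0}
  mem_E := fun X hX e he => ⟨𝓜.mem_E X hX.1 e he, fun h => he (hX.2 e h)⟩
  zero_mem := ⟨𝓜.zero_mem, fun _ _ => rfl⟩
  neg_mem := fun X hX => ⟨𝓜.neg_mem X hX.1, fun f hf => by simp [hX.2 f hf]⟩
  comp_mem := fun X hX Y hY => ⟨𝓜.comp_mem X hX.1 Y hY.1, fun f hf => by
    rw [signComp_of_eq (hX.2 f hf), hY.2 f hf]⟩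
  elim := fun X hX Y hY e he hYe => by
    obtain ⟨Z, hZ, hZe, hZ'⟩ := 𝓜.elim X hX.1 Y hY.1 e he hYe
    refine ⟨Z, ⟨hZ, fun f hf => ?_⟩, hZe, hZ'⟩
    rw [hZ' f (by simp [hX.2 f hf]), signComp_of_eq (hX.2 f hf), hY.2 f hf]

theorem cl_contraction (C S : Set α) : (𝓜.contraction C).cl S = 𝓜.cl (S ∪ C) \ C := by
  ext e
  constructor
  · rintro ⟨⟨he, heC⟩, h⟩
    exact ⟨⟨he, fun X hX h0 => h X ⟨hX, fun f hf => h0 f (Or.inr hf)⟩ fun f hf =>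
      h0 f (Or.inl hf)⟩, heC⟩
  · rintro ⟨⟨he, h⟩, heC⟩
    refine ⟨⟨he, heC⟩, fun X hX h0 => h X hX.1 ?_⟩
    rintro f (hf | hf)
    exacts [h0 f hf, hX.2 f hf]

theorem matroid_contraction {C : Set α} (hC : C ⊆ 𝓜.E) :
    (𝓜.contraction C).matroid = 𝓜.matroid.contract C := by
  refine Matroid.ext_indep rfl fun I hI => ?_
  rw [Matroid.indep_iff_forall_notMem_closure_sdiff (M := 𝓜.matroid.contract C) hI,
    matroid_indep_iff, IsIndep]
  have hIE : I ⊆ 𝓜.E \ C := hI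
  refine (and_iff_right hI).trans (forall₂_congr fun e _ => ?_)
  have h1 : I \ {e} ∪ C ⊆ 𝓜.E :=
    Set.union_subset (Set.sdiff_subset.trans fun x hx => (hIE hx).1) hC
  rw [cl_contraction, Matroid.contract_closure_eq, closure_eq_cl h1]

theorem exists_ne_zero_of_loopless (h : 𝓜.matroid.Loopless) {e : α} (he : e ∈ 𝓜.E) :
    ∃ X ∈ 𝓜.covectors, X e ≠ 0 := by
  have h1 : e ∉ 𝓜.cl ∅ := by
    rw [← closure_eq_cl (Set.empty_subset _), Matroid.closure_empty, 𝓜.matroid.loops_eq_empty]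
    exact Set.notMem_empty e
  obtain ⟨X, hX, -, hXe⟩ := (notMem_cl_iff he).1 h1
  exact ⟨X, hX, hXe⟩

theorem isTope_of_forall_ne {P : α → SignType} (hP : P ∈ 𝓜.covectors)
    (h : ∀ e ∈ 𝓜.E, P e ≠ 0) : 𝓜.IsTope P := by
  refine ⟨hP, fun Y hY hf => funext fun e => ?_⟩
  by_cases he : e ∈ 𝓜.E
  · exact (hf e (h e he)).symm
  · rw [eq_zero_of_notMem hY he, eq_zero_of_notMem hP he]

theorem IsTope.ne_zero (h : 𝓜.matroid.Loopless) {P : α → SignType} (hP : 𝓜.IsTope P) {e : α}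
    (he : e ∈ 𝓜.E) : P e ≠ 0 := by
  intro h0
  obtain ⟨X, hX, hXe⟩ := exists_ne_zero_of_loopless h he
  have h1 := hP.2 (signComp P X) (𝓜.comp_mem P hP.1 X hX) fun f hf =>
    (signComp_of_ne (Y := X) hf).symm
  apply hXe
  rw [← signComp_of_eq (Y := X) h0, h1, h0]

end Covectors

/-! ### Facets of a covector, and the diamond property -/

section Facets

variable {α : Type*} {𝓜 : OrientedMatroid α}

theorem sign_eq_neg_of_ne {a b : SignType} (ha : a ≠ 0) (hb : b ≠ 0) (h : a ≠ b) : a = -b := by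
  revert a b; decide

/-- If some covector other than `P` agrees with `P` outside a part `S` of the support of `P`, then
`P` has a facet `Y` that agrees with `P` outside `S`: the zero set of `Y` is spanned by that of `P`
and any one element of `S` at which `Y` vanishes. It is a covector that differs from `P` at as few
elements as possible. -/
theorem exists_facet [Finite α] {P Z : α → SignType} {S : Set α} (hP : P ∈ 𝓜.covectors)
    (hZ : Z ∈ 𝓜.covectors) (hne : Z ≠ P) (hS : ∀ e ∈ S, P e ≠ 0) (hZS : ∀ e, e ∉ S → Z e = P e) :
    ∃ Y ∈ 𝓜.covectors, IsSignFace Y P ∧ (∀ e, e ∉ S → Y e = P e) ∧ (∃ e ∈ S, Y e = 0) ∧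
      ∀ e ∈ S, Y e = 0 → ∀ g, Y g = 0 → g ∈ 𝓜.E → g ∈ 𝓜.cl (insert e (𝓜.zeroSet P)) := by
  let A : Set (α → SignType) := {Z | Z ∈ 𝓜.covectors ∧ Z ≠ P ∧ ∀ e, e ∉ S → Z e = P e}
  let D : (α → SignType) → Set α := fun Z => {g | Z g ≠ P g}
  -- elimination against `P` keeps only the elements at which the signs are opposite
  have step : ∀ Z ∈ A, ∀ f, P f ≠ 0 → Z f = -P f →
      ∃ Z' ∈ A, Z' f = 0 ∧ D Z' ⊆ {g | P g ≠ 0 ∧ Z g = -P g} := by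
    rintro Z ⟨hZ, -, hZS⟩ f hPf hZf
    obtain ⟨Z', hZ', h0, h1⟩ := 𝓜.elim P hP Z hZ f hPf hZf
    have h2 : ∀ g, ¬(P g ≠ 0 ∧ Z g = -P g) → P g ≠ 0 ∨ Z g = 0 → Z' g = P g := by
      intro g hg hor
      rw [h1 g hg]
      by_cases hPg : P g = 0
      · rw [signComp_of_eq hPg, hPg]; exact hor.resolve_left (not_not.2 hPg)
      · exact signComp_of_ne hPg
    have h3 : ∀ g, g ∈ S → P g ≠ 0 ∨ Z g = 0 := fun g hg => Or.inl (hS g hg)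
    have h4 : ∀ g, g ∉ S → Z' g = P g := by
      intro g hg
      have hzg := hZS g hg
      refine h2 g (fun h => h.1 ?_) ?_
      · rw [hzg] at h
        obtain ⟨ha, hb⟩ := h
        revert ha hb
        generalize P g = a
        revert a; decide
      · by_cases hPg : P g = 0
        · exact Or.inr (hzg.trans hPg)
        · exact Or.inl hPg
    refine ⟨Z', ⟨hZ', fun h => hPf ?_, h4⟩, h0, fun g hg => ?_⟩
    · rw [← h, h0]
    · by_contra hcon
      by_cases hgS : g ∈ S
      · exact hg (h2 g hcon (h3 g hgS))
      · exact hg (h4 g hgS)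
  obtain ⟨Z₀, hZ₀, hmin⟩ := Set.exists_min_image A (fun Z => (D Z).ncard) (Set.toFinite A)
    ⟨Z, hZ, hne, hZS⟩
  have hlt : ∀ Z Z' : α → SignType, D Z' ⊆ D Z → ∀ g ∈ D Z, g ∉ D Z' → Z' ∉ A ∨
      (D Z₀).ncard < (D Z).ncard := by
    intro Z Z' hsub g hg hg'
    by_cases hA : Z' ∈ A
    · exact Or.inr ((hmin Z' hA).trans_lt (Set.ncard_lt_ncard ⟨hsub, fun h => hg' (h hg)⟩
        (Set.toFinite _)))
    · exact Or.inl hA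
  obtain ⟨Y, hYA, hYD, hYneg⟩ : ∃ Y ∈ A, (D Y).ncard ≤ (D Z₀).ncard ∧
      ∀ f, P f ≠ 0 → Y f ≠ -P f := by
    by_cases hneg : ∃ f, P f ≠ 0 ∧ Z₀ f = -P f
    · obtain ⟨f, hPf, hZf⟩ := hneg
      obtain ⟨Z', hZ'A, hZ'f, hZ'D⟩ := step Z₀ hZ₀ f hPf hZf
      have hsub : D Z' ⊆ D Z₀ := by
        intro g hg
        obtain ⟨h1, h2⟩ := hZ'D hg
        change Z₀ g ≠ P g
        rw [h2]
        revert h1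
        generalize P g = a
        revert a; decide
      have hle := Set.ncard_le_ncard hsub (Set.toFinite _)
      refine ⟨Z', hZ'A, hle, fun g hPg hZg => ?_⟩
      obtain ⟨Z'', hZ''A, -, hZ''D⟩ := step Z' hZ'A g hPg hZg
      have hsub' : D Z'' ⊆ D Z' := by
        intro x hx
        obtain ⟨h1, h2⟩ := hZ''D hx
        change Z' x ≠ P x
        rw [h2]
        revert h1
        generalize P x = a
        revert a; decide
      rcases hlt Z' Z'' hsub' f (by change Z' f ≠ P f; rw [hZ'f]; exact hPf.symm) (fun h => by
        have := (hZ''D h).2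
        rw [hZ'f] at this
        apply hPf
        revert this
        generalize P f = a
        revert a; decide) with h | h
      · exact h hZ''A
      · omega
    · push Not at hneg
      exact ⟨Z₀, hZ₀, le_rfl, hneg⟩
  have hYS : ∀ g, Y g ≠ P g → P g ≠ 0 ∧ Y g = 0 := by
    intro g hg
    have hgS : g ∈ S := by by_contra h; exact hg (hYA.2.2 g h)
    refine ⟨hS g hgS, ?_⟩
    by_contra h0
    exact hYneg g (hS g hgS) (sign_eq_neg_of_ne h0 (hS g hgS) hg)
  have hface : IsSignFace Y P := by
    intro e he
    by_contra h
    exact he (hYS e h).2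
  refine ⟨Y, hYA.1, hface, hYA.2.2, ?_, ?_⟩
  · by_contra hcon
    push Not at hcon
    refine hYA.2.1 (funext fun g => ?_)
    by_contra hg
    refine hcon g ?_ (hYS g hg).2
    by_contra h
    exact hg (hYA.2.2 g h)
  · intro e heS hYe g hYg hgE
    refine ⟨hgE, ?_⟩
    have main : ∀ W ∈ 𝓜.covectors, (∀ f ∈ insert e (𝓜.zeroSet P), W f = 0) →
        W g ≠ P g ∨ W g = 0 := by
      intro W hW hW0
      by_contra hcon
      push Not at hcon
      obtain ⟨hWg, hWg0⟩ := hcon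
      have hPW : ∀ x, P x = 0 → W x = 0 := by
        intro x hx
        by_cases hxE : x ∈ 𝓜.E
        · exact hW0 x (Or.inr ⟨hxE, hx⟩)
        · exact eq_zero_of_notMem hW hxE
      have hVA : signComp Y W ∈ A := by
        refine ⟨𝓜.comp_mem Y hYA.1 W hW, fun h => hS e heS ?_, fun x hx => ?_⟩
        · rw [← h, signComp_of_eq hYe, hW0 e (Or.inl rfl)]
        · by_cases hYx : Y x = 0
          · have hPx : P x = 0 := (hYA.2.2 x hx).symm.trans hYx
            rw [signComp_of_eq hYx, hPW x hPx, hPx]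
          · rw [signComp_of_ne hYx, hYA.2.2 x hx]
      have hsub : D (signComp Y W) ⊆ D Y := by
        intro x hx
        by_cases hYx : Y x = 0
        · change Y x ≠ P x
          rw [hYx]
          intro h
          apply hx
          rw [signComp_of_eq hYx, hPW x h.symm, ← h]
        · change signComp Y W x ≠ P x at hx
          rw [signComp_of_ne hYx] at hx
          exact hx
      rcases hlt Y _ hsub g (by change Y g ≠ P g; rw [hYg, ← hWg]; exact hWg0.symm)
        (by change ¬(signComp Y W g ≠ P g); rw [signComp_of_eq hYg, hWg]; simp) with h | h
      · exact h hVA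
      · omega
    intro W hW hW0
    by_contra hWg
    rcases main W hW hW0 with h | h
    · have hPg : P g ≠ 0 := by
        intro hPg
        exact hWg (hW0 g (Or.inr ⟨hgE, hPg⟩))
      rcases main (-W) (𝓜.neg_mem W hW) (fun f hf => by simp [hW0 f hf]) with h' | h'
      · apply h'
        rw [Pi.neg_apply, sign_eq_neg_of_ne hWg hPg h, neg_neg]
      · exact hWg (by simpa using h')
    · exact hWg h

/-- The zero set of a facet covers the zero set of the covector. -/
theorem eRk_zeroSet_facet {P Y : α → SignType} (hP : P ∈ 𝓜.covectors) (hY : Y ∈ 𝓜.covectors)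
    (hface : IsSignFace Y P) {e : α} (hPe : P e ≠ 0) (hYe : Y e = 0)
    (h : ∀ g, Y g = 0 → g ∈ 𝓜.E → g ∈ 𝓜.cl (insert e (𝓜.zeroSet P))) :
    𝓜.matroid.eRk (𝓜.zeroSet Y) = 𝓜.matroid.eRk (𝓜.zeroSet P) + 1 := by
  have heE := 𝓜.mem_E P hP e hPe
  have hsub : insert e (𝓜.zeroSet P) ⊆ 𝓜.zeroSet Y := by
    rintro g (rfl | hg)
    · exact ⟨heE, hYe⟩
    · refine ⟨hg.1, ?_⟩
      by_contra hne
      exact hne ((hface g hne).trans hg.2)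
  have hE : insert e (𝓜.zeroSet P) ⊆ 𝓜.E := hsub.trans fun _ h => h.1
  have h1 : 𝓜.zeroSet Y = 𝓜.matroid.closure (insert e (𝓜.zeroSet P)) := by
    rw [closure_eq_cl hE]
    refine Set.Subset.antisymm (fun g hg => h g hg.2 hg.1) ?_
    exact (cl_mono hsub).trans (isFlat_iff.1 (isFlat_zeroSet hY)).2
  rw [h1, Matroid.eRk_closure_eq, Matroid.eRk_insert_eq_add_one]
  refine ⟨heE, ?_⟩
  rw [(isFlat_zeroSet hP).closure]
  exact fun h => hPe h.2

theorem _root_.OMForms.IsSignFace.trans {X Y Z : α → SignType} (h : IsSignFace X Y)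
    (h' : IsSignFace Y Z) : IsSignFace X Z := fun e he => by
  have h1 := h e he
  rw [h1, h' e (h1 ▸ he)]

theorem _root_.OMForms.IsSignFace.zeroSet_subset {X Y : α → SignType} (h : IsSignFace X Y) :
    𝓜.zeroSet Y ⊆ 𝓜.zeroSet X := fun e he => ⟨he.1, by
  by_contra h0
  exact h0 ((h e h0).trans he.2)⟩

/-- **Diamond property.** Between two flats of a tope `P` whose ranks differ by two, there are
exactly two flats of `P`. -/
theorem diamond [Finite α] {P : α → SignType} {G L : Set α} {n : ℕ}
    (hG : IsFaceFlat 𝓜.matroid 𝓜.covectors P G) (hL : IsFaceFlat 𝓜.matroid 𝓜.covectors P L)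
    (hGL : G ⊆ L) (hGr : 𝓜.matroid.eRk G = n) (hLr : 𝓜.matroid.eRk L = (n + 2 : ℕ)) :
    ∃ H₁ H₂ : Set α, H₁ ≠ H₂ ∧ ∀ H, (𝓜.matroid.IsFlat H ∧ 𝓜.matroid.eRk H = (n + 1 : ℕ) ∧
      G ⊆ H ∧ H ⊆ L ∧ IsFaceFlat 𝓜.matroid 𝓜.covectors P H) ↔ H = H₁ ∨ H = H₂ := by
  obtain ⟨Y, hY, hYP, rfl⟩ := hG
  obtain ⟨X, hX, hXP, rfl⟩ := hL
  change 𝓜.zeroSet Y ⊆ 𝓜.zeroSet X at hGL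
  have hYX : ∀ e, e ∈ 𝓜.E → X e ≠ 0 → Y e ≠ 0 ∧ X e = Y e := by
    intro e he hXe
    have hYe : Y e ≠ 0 := fun h => hXe (hGL ⟨he, h⟩).2
    exact ⟨hYe, (hXP e hXe).trans (hYP e hYe).symm⟩
  -- a covector that differs from `Y` exactly on a nonempty part `S` of the zero set of `X`
  have aux : ∀ (V : α → SignType) (S : Set α), V ∈ 𝓜.covectors → S.Nonempty →
      S ⊆ 𝓜.zeroSet X → (∀ e ∈ S, Y e ≠ 0) → (∀ e ∈ S, V e = -Y e) →
      (∀ e ∈ 𝓜.zeroSet X, e ∉ S → V e = Y e) →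
      ∃ W ∈ 𝓜.covectors, IsSignFace W P ∧ 𝓜.matroid.eRk (𝓜.zeroSet W) = (n + 1 : ℕ) ∧
        𝓜.zeroSet Y ⊆ 𝓜.zeroSet W ∧ 𝓜.zeroSet W ⊆ 𝓜.zeroSet X ∧
        𝓜.zeroSet W \ 𝓜.zeroSet Y ⊆ S := by
    intro V S hV hSn hSX hSY hVS hVo
    have hagree : ∀ e, e ∉ S → signComp X V e = Y e := by
      intro e he
      by_cases heE : e ∈ 𝓜.E
      · by_cases hXe : X e = 0
        · rw [signComp_of_eq hXe]; exact hVo e ⟨heE, hXe⟩ he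
        · rw [signComp_of_ne hXe]; exact (hYX e heE hXe).2
      · rw [eq_zero_of_notMem (𝓜.comp_mem X hX V hV) heE, eq_zero_of_notMem hY heE]
    obtain ⟨s, hs⟩ := hSn
    obtain ⟨W, hW, hWY, hWS, ⟨e, heS, hWe⟩, hmin⟩ := exists_facet hY (𝓜.comp_mem X hX V hV)
      (S := S) (fun h => by
        have h1 := congrFun h s
        rw [signComp_of_eq (hSX hs).2, hVS s hs] at h1
        have h2 := hSY s hs
        revert h1 h2
        generalize Y s = a
        revert a; decide) hSY hagree
    have hsub : 𝓜.zeroSet W \ 𝓜.zeroSet Y ⊆ S := by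
      rintro g ⟨hg, hgY⟩
      by_contra h
      exact hgY ⟨hg.1, (hWS g h).symm.trans hg.2⟩
    refine ⟨W, hW, hWY.trans hYP, ?_, hWY.zeroSet_subset, fun g hg => ?_, hsub⟩
    · rw [eRk_zeroSet_facet hY hW hWY (hSY e heS) hWe (hmin e heS hWe)]
      change 𝓜.matroid.eRk (𝓜.zeroSet Y) = _ at hGr
      rw [hGr]; rfl
    · by_cases hgY : g ∈ 𝓜.zeroSet Y
      · exact hGL hgY
      · exact hSX (hsub ⟨hg, hgY⟩)
  change 𝓜.matroid.eRk (𝓜.zeroSet Y) = _ at hGr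
  change 𝓜.matroid.eRk (𝓜.zeroSet X) = _ at hLr
  have hYf := isFlat_zeroSet hY
  have hXf := isFlat_zeroSet hX
  have hex : ∀ (F F' : Set α) (a b : ℕ), 𝓜.matroid.eRk F = a → 𝓜.matroid.eRk F' = b → a < b →
      (F' \ F).Nonempty := by
    intro F F' a b ha hb hab
    by_contra hcon
    rw [Set.not_nonempty_iff_eq_empty, Set.sdiff_eq_empty] at hcon
    have := 𝓜.matroid.eRk_mono hcon
    rw [ha, hb, Nat.cast_le] at this
    omega
  obtain ⟨W₁, hW₁, hW₁P, hr₁, hl₁, hu₁, hs₁⟩ := aux (-Y) (𝓜.zeroSet X \ 𝓜.zeroSet Y)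
    (𝓜.neg_mem Y hY) (hex _ _ _ _ hGr hLr (by omega)) Set.sdiff_subset
    (fun e he h => he.2 ⟨he.1.1, h⟩) (fun e _ => rfl) (fun e he he' => by
      have h0 : Y e = 0 := by
        by_contra h0
        exact he' ⟨he, fun h => h0 h.2⟩
      simp [h0])
  obtain ⟨W₂, hW₂, hW₂P, hr₂, hl₂, hu₂, hs₂⟩ := aux (signComp (-W₁) Y) (𝓜.zeroSet X \ 𝓜.zeroSet W₁)
    (𝓜.comp_mem _ (𝓜.neg_mem _ hW₁) _ hY) (hex _ _ _ _ hr₁ hLr (by omega)) Set.sdiff_subset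
    (fun e he h => he.2 (hl₁ ⟨he.1.1, h⟩)) (fun e he => by
      have h0 : W₁ e ≠ 0 := fun h => he.2 ⟨he.1.1, h⟩
      have h1 : Y e ≠ 0 := fun h => he.2 (hl₁ ⟨he.1.1, h⟩)
      rw [signComp_of_ne (by simpa using h0), Pi.neg_apply, hW₁P e h0, hYP e h1])
    (fun e he he' => by
      have h0 : W₁ e = 0 := by
        by_contra h0
        exact he' ⟨he, fun h => h0 h.2⟩
      rw [signComp_of_eq (by simp [h0])])
  obtain ⟨e₁, he₁, he₁'⟩ := hex _ _ _ _ hGr hr₁ (by omega)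
  obtain ⟨e₂, he₂, he₂'⟩ := hex _ _ _ _ hGr hr₂ (by omega)
  have hf₁ := isFlat_zeroSet hW₁
  have hf₂ := isFlat_zeroSet hW₂
  have hne : 𝓜.zeroSet W₁ ≠ 𝓜.zeroSet W₂ := fun h => (hs₂ ⟨he₂, he₂'⟩).2 (h ▸ he₂)
  refine ⟨𝓜.zeroSet W₁, 𝓜.zeroSet W₂, hne, fun H => ⟨?_, ?_⟩⟩
  · rintro ⟨hHf, hHr, hHl, hHu, W₃, hW₃, hW₃P, rfl⟩
    change 𝓜.matroid.eRk (𝓜.zeroSet W₃) = _ at hHr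
    change 𝓜.zeroSet Y ⊆ 𝓜.zeroSet W₃ at hHl
    change 𝓜.zeroSet W₃ ⊆ 𝓜.zeroSet X at hHu
    change 𝓜.zeroSet W₃ = _ ∨ 𝓜.zeroSet W₃ = _
    have hf₃ := isFlat_zeroSet hW₃
    by_contra hcon
    push Not at hcon
    obtain ⟨hne₁, hne₂⟩ := hcon
    obtain ⟨e₃, he₃, he₃'⟩ := hex _ _ _ _ hGr hHr (by omega)
    -- three facets would contradict elimination of the third element between the first two
    have hnz : ∀ {W W' : α → SignType} {e : α}, W ∈ 𝓜.covectors → W' ∈ 𝓜.covectors →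
        IsSignFace W' P → 𝓜.matroid.eRk (𝓜.zeroSet W) = (n + 1 : ℕ) →
        𝓜.matroid.eRk (𝓜.zeroSet W') = (n + 1 : ℕ) → 𝓜.zeroSet Y ⊆ 𝓜.zeroSet W →
        𝓜.zeroSet Y ⊆ 𝓜.zeroSet W' → 𝓜.zeroSet W ≠ 𝓜.zeroSet W' → e ∈ 𝓜.zeroSet W →
        e ∉ 𝓜.zeroSet Y → W' e = P e ∧ P e ≠ 0 := by
      intro W W' e hW hW' hWP hr hr' hl hl' hne he heY
      have h0 : W' e ≠ 0 := fun h => hne (inter_eq_of_cover hYf (isFlat_zeroSet hW)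
        (isFlat_zeroSet hW') hl hl' hGr hr hr' he ⟨he.1, h⟩ heY)
      exact ⟨hWP e h0, fun h => h0 ((hWP e h0).trans h)⟩
    have h12 := hnz hW₁ hW₂ hW₂P hr₁ hr₂ hl₁ hl₂ hne he₁ he₁'
    have h13 := hnz hW₁ hW₃ hW₃P hr₁ hHr hl₁ hHl hne₁.symm he₁ he₁'
    have h21 := hnz hW₂ hW₁ hW₁P hr₂ hr₁ hl₂ hl₁ hne.symm he₂ he₂'
    have h23 := hnz hW₂ hW₃ hW₃P hr₂ hHr hl₂ hHl hne₂.symm he₂ he₂'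
    have h31 := hnz hW₃ hW₁ hW₁P hHr hr₁ hHl hl₁ hne₁ he₃ he₃'
    have h32 := hnz hW₃ hW₂ hW₂P hHr hr₂ hHl hl₂ hne₂ he₃ he₃'
    obtain ⟨Z, hZ, hZ₃, hZ'⟩ := 𝓜.elim W₁ hW₁ (-W₂) (𝓜.neg_mem _ hW₂) e₃
      (by rw [h31.1]; exact h31.2) (by rw [Pi.neg_apply, h31.1, h32.1])
    have hZY : ∀ g ∈ 𝓜.zeroSet Y, Z g = 0 := fun g hg => by
      have h1 := (hl₁ hg).2
      rw [hZ' g (by simp [h1]), signComp_of_eq h1, Pi.neg_apply, (hl₂ hg).2, neg_zero]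
    have hZ₁ : Z e₁ = -P e₁ := by
      rw [hZ' e₁ (by simp [he₁.2]), signComp_of_eq he₁.2, Pi.neg_apply, h12.1]
    have hZ₂ : Z e₂ = P e₂ := by
      rw [hZ' e₂ (by
        rw [Pi.neg_apply, he₂.2, h21.1]
        rintro ⟨h, h'⟩
        revert h h'
        generalize P e₂ = a
        revert a; decide), signComp_of_ne (by rw [h21.1]; exact h21.2), h21.1]
    have hcl₃ := closure_insert_eq_of_eRk hYf hf₃ hHl hGr hHr ⟨he₃, he₃'⟩
    have hsub₃ : insert e₃ (𝓜.zeroSet Y) ⊆ 𝓜.E :=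
      Set.insert_subset he₃.1 fun _ h => h.1
    have hZW₃ : ∀ g ∈ 𝓜.zeroSet W₃, Z g = 0 := by
      intro g hg
      rw [← hcl₃, closure_eq_cl hsub₃] at hg
      refine hg.2 Z hZ ?_
      rintro x (rfl | hx)
      exacts [hZ₃, hZY x hx]
    have he₁₃ : e₁ ∉ 𝓜.zeroSet W₃ := fun h => h13.2 (h13.1.symm.trans h.2)
    have hcl := closure_insert_eq_of_eRk hf₃ hXf hHu hHr hLr ⟨hu₁ he₁, he₁₃⟩
    have hsub : insert e₁ (𝓜.zeroSet W₃) ⊆ 𝓜.E := Set.insert_subset he₁.1 fun _ h => h.1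
    have hpar := mul_eq_mul_of_mem_cl (F := 𝓜.zeroSet W₃) (e := e₁) (f := e₂)
      (by rw [← closure_eq_cl hsub, hcl]; exact hu₂ he₂) hZ hW₃ hZW₃ (fun g hg => hg.2)
    rw [hZ₁, hZ₂, h13.1, h23.1] at hpar
    have h1 := h13.2
    have h2 := h23.2
    revert hpar h1 h2
    generalize P e₁ = a, P e₂ = b
    revert a b; decide
  · rintro (rfl | rfl)
    · exact ⟨hf₁, hr₁, hl₁, hu₁, W₁, hW₁, hW₁P, rfl⟩
    · exact ⟨hf₂, hr₂, hl₂, hu₂, W₂, hW₂, hW₂P, rfl⟩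

end Facets

end OrientedMatroid

/-! ### The signs of a tope on its flags -/

namespace OrientedMatroid

section TopeFlags

variable {α : Type*} {𝓜 : OrientedMatroid α}

variable (𝓜) in
/-- A flag all of whose members are zero sets of faces of `P`. -/
def IsFaceFlag (P : α → SignType) {k : ℕ} (F : Fin (k + 1) → Set α) : Prop :=
  ∀ i, IsFaceFlat 𝓜.matroid 𝓜.covectors P (F i)

/-- The sign of `P` on the sequence `u`, relative to the orientation `χ` of the reversed sequence. -/
def topeSign {k : ℕ} (χ : (Fin k → α) → SignType) (P : α → SignType) (u : Fin k → α) : SignType :=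
  (∏ i, P (u i)) * χ (u ∘ Fin.rev)

open Classical in
variable (𝓜) in
/-- The residue of the canonical form of `P` along the flag `F`: the sign of `P` on a transversal of
`F` if `F` is a flag of flats that consists of zero sets of faces of `P`, and `0` otherwise. -/
def topeFlagVal {k : ℕ} (χ : (Fin k → α) → SignType) (P : α → SignType)
    (F : Fin (k + 1) → Set α) : ℤ :=
  if h : F ∈ flags 𝓜.matroid k ∧ 𝓜.IsFaceFlag P F then
    (topeSign χ P (exists_isTransversal h.1).choose : ℤ)
  else 0

theorem topeFlagVal_eq_zero {k : ℕ} {χ : (Fin k → α) → SignType} {P : α → SignType}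
    {F : Fin (k + 1) → Set α} (h : ¬𝓜.IsFaceFlag P F) : 𝓜.topeFlagVal χ P F = 0 :=
  dif_neg fun h' => h h'.2

theorem eq_zero_of_mem_cl {X : α → SignType} (hX : X ∈ 𝓜.covectors) {S : Set α} {e : α}
    (he : e ∈ 𝓜.cl S) (h : ∀ f ∈ S, X f = 0) : X e = 0 := he.2 X hX h

/-- For each entry of an independent tuple, some covector vanishes at all other entries but not at
this one. -/
theorem exists_covector_of_indep {k : ℕ} {u : Fin k → α} (hu : Function.Injective u)
    (hi : 𝓜.matroid.Indep (Set.range u)) (i : Fin k) :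
    ∃ X ∈ 𝓜.covectors, (∀ j, j ≠ i → X (u j) = 0) ∧ X (u i) ≠ 0 := by
  have hi' := matroid_indep_iff.1 hi
  obtain ⟨X, hX, h0, h1⟩ := (notMem_cl_iff (hi'.1 (Set.mem_range_self i))).1
    (hi'.2 _ (Set.mem_range_self i))
  exact ⟨X, hX, fun j hj => h0 _ ⟨Set.mem_range_self j, fun h => hj (hu h)⟩, h1⟩

/-- Within a step of a flag of `P`, the signs of `P` and those of the chirotope vary in the same way,
namely as the values of any covector that vanishes on the lower flat of the step. -/
theorem topeSign_update [𝓜.matroid.Loopless] {k : ℕ} {χ : (Fin k → α) → SignType}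
    (hχ : 𝓜.IsChirotope χ) {P : α → SignType} {F : Fin (k + 1) → Set α}
    (hF : F ∈ flags 𝓜.matroid k) (hP : 𝓜.IsFaceFlag P F) {u : Fin k → α} (hu : IsTransversal F u)
    {i : Fin k} {e : α} (he : e ∈ F i.succ \ F i.castSucc) :
    topeSign χ P (Function.update u i e) = topeSign χ P u := by
  obtain ⟨X, hX, hX0, hXi⟩ := exists_covector_of_indep (hu.injective hF) (hu.indep hF) i
  obtain ⟨Y, hY, hYP, hYz⟩ := hP i.castSucc
  have hE : F i.succ ⊆ 𝓜.E := (flags_isFlat hF _).subset_ground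
  have hYne : ∀ f ∈ F i.succ \ F i.castSucc, Y f ≠ 0 := fun f hf h0 =>
    hf.2 (hYz ▸ ⟨hE hf.1, h0⟩)
  have hYF : ∀ f ∈ F i.castSucc, Y f = 0 := fun f hf => by rw [← hYz] at hf; exact hf.2
  have hXF : ∀ f ∈ F i.castSucc, X f = 0 := by
    intro f hf
    rw [← hu.closure_eq hF, closure_eq_cl] at hf
    · refine eq_zero_of_mem_cl hX hf ?_
      rintro _ ⟨j, hj, rfl⟩
      exact hX0 j fun h => by subst h; exact lt_irrefl _ (Set.mem_ofPred_eq ▸ hj)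
    · rintro _ ⟨j, -, rfl⟩
      exact (flags_isFlat hF _).subset_ground (hu j).1
  have hcl : e ∈ 𝓜.cl (insert (u i) (F i.castSucc)) := by
    rw [← closure_eq_cl (Set.insert_subset (hE (hu i).1) (flags_isFlat hF _).subset_ground),
      closure_insert_eq_of_eRk (flags_isFlat hF _) (flags_isFlat hF i.succ) (flags_subset hF i)
        (flags_eRk hF _) (by simpa using flags_eRk hF i.succ) (hu i)]
    exact he.1
  have h1 := mul_eq_mul_of_mem_cl hcl hX hY hXF hYF
  have hc := hχ.compatible (u ∘ Fin.rev) i.rev e X hX (fun j hj => hX0 _ fun h => hj (by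
    rw [← h, Fin.rev_rev]))
  have h2 : Function.update (u ∘ Fin.rev) i.rev e = Function.update u i e ∘ Fin.rev := by
    ext j
    by_cases hj : j = i.rev
    · subst hj; simp
    · rw [Function.update_of_ne hj, Function.comp_apply, Function.comp_apply, Function.update_of_ne]
      exact fun h => hj (by rw [← h, Fin.rev_rev])
  rw [h2, Function.comp_apply, Fin.rev_rev] at hc
  rw [hYP _ (hYne e he), hYP _ (hYne _ (hu i))] at h1
  have hPe : P e ≠ 0 := hYP _ (hYne e he) ▸ hYne e he
  have hPi : P (u i) ≠ 0 := hYP _ (hYne _ (hu i)) ▸ hYne _ (hu i)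
  have h3 : P e * χ (Function.update u i e ∘ Fin.rev) = P (u i) * χ (u ∘ Fin.rev) := by
    generalize χ (Function.update u i e ∘ Fin.rev) = a, χ (u ∘ Fin.rev) = b at *
    generalize P e = c, P (u i) = d, X e = x, X (u i) = y at *
    clear h2
    have key : ∀ x y c d : SignType, y ≠ 0 → c ≠ 0 → d ≠ 0 → y * c = x * d → x = y * c * d := by
      decide
    have key' : ∀ y c d a b : SignType, y ≠ 0 → c ≠ 0 → d ≠ 0 → y * c * d * b = y * a →
      c * a = d * b := by decide
    rw [key x y c d hXi hPe hPi h1] at hc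
    exact key' y c d a b hXi hPe hPi hc
  have h4 : (fun j => P (Function.update u i e j)) = Function.update (fun j => P (u j)) i (P e) := by
    ext j
    by_cases hj : j = i
    · subst hj; simp
    · simp [hj]
  rw [topeSign, topeSign, h4, Finset.prod_update_of_mem (Finset.mem_univ i), mul_right_comm, h3,
    Finset.prod_eq_mul_prod_sdiff_singleton_of_mem (Finset.mem_univ i), mul_right_comm]

theorem topeSign_eq [𝓜.matroid.Loopless] {k : ℕ} {χ : (Fin k → α) → SignType}
    (hχ : 𝓜.IsChirotope χ) {P : α → SignType} {F : Fin (k + 1) → Set α}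
    (hF : F ∈ flags 𝓜.matroid k) (hP : 𝓜.IsFaceFlag P F) {t u : Fin k → α} (ht : IsTransversal F t)
    (hu : IsTransversal F u) : topeSign χ P t = topeSign χ P u := by
  classical
  have key : ∀ s : Finset (Fin k), topeSign χ P (s.piecewise t u) = topeSign χ P u ∧
      IsTransversal F (s.piecewise t u) := by
    intro s
    induction s using Finset.induction_on with
    | empty => simpa using hu
    | insert j s hj ih =>
      refine ⟨?_, fun i => ?_⟩
      · rw [Finset.piecewise_insert, topeSign_update hχ hF hP ih.2 (ht j), ih.1]
      · by_cases h : i ∈ insert j s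
        · rw [Finset.piecewise_eq_of_mem _ _ _ h]; exact ht i
        · rw [Finset.piecewise_eq_of_notMem _ _ _ h]; exact hu i
  simpa using (key Finset.univ).1

theorem topeFlagVal_eq [𝓜.matroid.Loopless] {k : ℕ} {χ : (Fin k → α) → SignType}
    (hχ : 𝓜.IsChirotope χ) {P : α → SignType} {F : Fin (k + 1) → Set α}
    (hF : F ∈ flags 𝓜.matroid k) (hP : 𝓜.IsFaceFlag P F) {u : Fin k → α} (hu : IsTransversal F u) :
    𝓜.topeFlagVal χ P F = (topeSign χ P u : ℤ) := by
  rw [topeFlagVal, dif_pos ⟨hF, hP⟩, topeSign_eq hχ hF hP (exists_isTransversal hF).choose_spec hu]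

theorem topeSign_comp_perm {k : ℕ} {χ : (Fin k → α) → SignType} (hχ : 𝓜.IsChirotope χ)
    (P : α → SignType) (u : Fin k → α) (σ : Equiv.Perm (Fin k)) :
    topeSign χ P (u ∘ σ) = SignType.sign (Equiv.Perm.sign σ : ℤ) * topeSign χ P u := by
  have h1 : (u ∘ σ) ∘ Fin.rev = (u ∘ Fin.rev) ∘ (Fin.revPerm.permCongr σ) := by
    ext j
    simp
  have h2 : ∏ i, P ((u ∘ σ) i) = ∏ i, P (u i) := Equiv.prod_comp σ fun i => P (u i)
  rw [topeSign, h2, h1, hχ.alternating, Equiv.Perm.sign_permCongr, topeSign, mul_left_comm]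

theorem topeSign_comp_swap {k : ℕ} {χ : (Fin k → α) → SignType} (hχ : 𝓜.IsChirotope χ)
    (P : α → SignType) (u : Fin k → α) {a b : Fin k} (hab : a ≠ b) :
    topeSign χ P (u ∘ Equiv.swap a b) = -topeSign χ P u := by
  rw [topeSign_comp_perm hχ, Equiv.Perm.sign_swap hab]
  simp

theorem topeSign_ne_zero {k : ℕ} {χ : (Fin k → α) → SignType} (hχ : 𝓜.IsChirotope χ)
    {P : α → SignType} {u : Fin k → α} (hu : Function.Injective u)
    (hB : 𝓜.matroid.IsBase (Set.range u)) (hP : ∀ i, P (u i) ≠ 0) : topeSign χ P u ≠ 0 := by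
  refine mul_ne_zero (Finset.prod_ne_zero_iff.2 fun i _ => hP i) ((hχ.ne_zero_iff _).2 ⟨?_, ?_⟩)
  · exact hu.comp Fin.rev_injective
  · rwa [Fin.rev_surjective.range_comp]

theorem flags_eRk_succ_of_eq {M : Matroid α} {k : ℕ} {F : Fin (k + 1) → Set α} (hF : F ∈ flags M k)
    {b : Fin k} {n : ℕ} (h : (b : ℕ) = n + 1) : M.eRk (F b.succ) = (n + 2 : ℕ) := by
  rw [flags_eRk hF, Fin.val_succ, h]

open Classical in
/-- The signs of a tope on its flags satisfy the flag relations: by the diamond property at most two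
terms of a relation are nonzero, and their transversals differ by a transposition. -/
theorem flagRel_topeFlagVal [Fintype α] [𝓜.matroid.Loopless] {k : ℕ} {χ : (Fin k → α) → SignType}
    (hχ : 𝓜.IsChirotope χ) (P : α → SignType) : FlagRel 𝓜.matroid k (𝓜.topeFlagVal χ P) := by
  intro F hF a b hab
  have hba : b.castSucc = a.succ := by rw [Fin.ext_iff]; simpa using hab
  have hne : a ≠ b := fun h => by rw [h] at hab; omega
  have hcast : ∀ i : Fin k, i ≠ b → i.castSucc ≠ a.succ := fun i hi h =>
    hi (Fin.castSucc_injective _ (h.trans hba.symm))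
  have hsucc : ∀ i : Fin k, i ≠ a → i.succ ≠ a.succ := fun i hi h => hi (Fin.succ_injective _ h)
  by_cases hall : ∀ i, i ≠ a.succ → IsFaceFlat 𝓜.matroid 𝓜.covectors P (F i)
  swap
  · push Not at hall
    obtain ⟨i, hi, hni⟩ := hall
    refine Finset.sum_eq_zero fun H _ => topeFlagVal_eq_zero fun h => hni ?_
    simpa [hi] using h i
  have hface : ∀ H, 𝓜.IsFaceFlag P (Function.update F a.succ H) ↔
      IsFaceFlat 𝓜.matroid 𝓜.covectors P H := by
    intro H
    refine ⟨fun h => by simpa using h a.succ, fun h i => ?_⟩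
    by_cases hi : i = a.succ
    · subst hi; simpa using h
    · simpa [hi] using hall i hi
  have hab' : a.castSucc ≤ b.succ := by rw [Fin.le_def]; simp; omega
  obtain ⟨H₁, H₂, h12, hH⟩ := diamond (hall a.castSucc (hcast a hne))
    (hall b.succ (hsucc b hne.symm)) (hF.1 hab') (flags_eRk hF _) (flags_eRk_succ_of_eq hF hab)
  have hm : ∀ H, H = H₁ ∨ H = H₂ → Function.update F a.succ H ∈ flags 𝓜.matroid k ∧
      IsFaceFlat 𝓜.matroid 𝓜.covectors P H := by
    intro H h
    obtain ⟨h1, h2, h3, h4, h5⟩ := (hH H).2 h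
    exact ⟨(flags_update_mem_iff hF hab H).2 ⟨h1, h2, h3, h4⟩, h5⟩
  rw [Finset.sum_eq_add H₁ H₂ h12]
  rotate_left
  · intro H hHm hHne
    refine topeFlagVal_eq_zero fun h => ?_
    rw [hface] at h
    obtain ⟨h1, h2, h3, h4⟩ := (flags_update_mem_iff hF hab H).1 (Finset.mem_filter.1 hHm).2
    rcases (hH H).1 ⟨h1, h2, h3, h4, h⟩ with h' | h'
    exacts [hHne.1 h', hHne.2 h']
  · exact fun h => (h (Finset.mem_filter.2 ⟨Finset.mem_univ _, (hm _ (Or.inl rfl)).1⟩)).elim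
  · exact fun h => (h (Finset.mem_filter.2 ⟨Finset.mem_univ _, (hm _ (Or.inr rfl)).1⟩)).elim
  obtain ⟨hf1, hr1, hG1, hL1, hP1⟩ := (hH H₁).2 (Or.inl rfl)
  obtain ⟨hf2, hr2, hG2, hL2, hP2⟩ := (hH H₂).2 (Or.inr rfl)
  obtain ⟨t, ht⟩ := exists_isTransversal hF
  have hex : ∀ H, H = H₁ ∨ H = H₂ → ∃ e, e ∈ H \ F a.castSucc := by
    intro H h
    obtain ⟨e, he⟩ := flags_exists_mem_sdiff (hm H h).1 a
    refine ⟨e, ?_⟩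
    simpa [(hcast a hne)] using he
  obtain ⟨e₁, he₁⟩ := hex H₁ (Or.inl rfl)
  obtain ⟨e₂, he₂⟩ := hex H₂ (Or.inr rfl)
  have hdisj : ∀ e ∈ H₁, e ∈ H₂ → e ∈ F a.castSucc := by
    intro e h h'
    by_contra hG
    exact h12 (inter_eq_of_cover (flags_isFlat hF _) hf1 hf2 hG1 hG2 (flags_eRk hF _) hr1 hr2
      h h' hG)
  have htrans : ∀ (H : Set α) (e f : α), e ∈ H \ F a.castSucc → f ∈ F b.succ \ H →
      IsTransversal (Function.update F a.succ H) (Function.update (Function.update t a e) b f) := by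
    intro H e f he hf i
    by_cases hib : i = b
    · subst hib
      rw [Function.update_self, Function.update_of_ne (hsucc i hne.symm), hba, Function.update_self]
      exact hf
    · rw [Function.update_of_ne hib, Function.update_of_ne (hcast i hib)]
      by_cases hia : i = a
      · subst hia
        rwa [Function.update_self, Function.update_self]
      · rw [Function.update_of_ne hia, Function.update_of_ne (hsucc i hia)]
        exact ht i
  have ht1 := htrans H₁ e₁ e₂ he₁ ⟨hL2 he₂.1, fun h => he₂.2 (hdisj _ h he₂.1)⟩
  have ht2 := htrans H₂ e₂ e₁ he₂ ⟨hL1 he₁.1, fun h => he₁.2 (hdisj _ he₁.1 h)⟩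
  have hswap : Function.update (Function.update t a e₂) b e₁ =
      Function.update (Function.update t a e₁) b e₂ ∘ Equiv.swap a b := by
    ext i
    by_cases hib : i = b
    · subst hib; simp [hne]
    · by_cases hia : i = a
      · subst hia; simp [hne]
      · simp [hia, hib, Equiv.swap_apply_of_ne_of_ne hia hib]
  rw [topeFlagVal_eq hχ (hm _ (Or.inl rfl)).1 ((hface _).2 hP1) ht1,
    topeFlagVal_eq hχ (hm _ (Or.inr rfl)).1 ((hface _).2 hP2) ht2, hswap,
    topeSign_comp_swap hχ _ _ hne, SignType.coe_neg, add_neg_cancel]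

end TopeFlags

end OrientedMatroid

/-! ### Existence and uniqueness of canonical forms -/

theorem isBasis_singleton_of_isAtomFlat {α : Type*} {M : Matroid α} [M.Loopless] {c : Set α}
    (hc : IsAtomFlat M c) {e : α} (he : e ∈ c) : M.IsBasis {e} c := by
  have hei : M.Indep {e} :=
    Matroid.indep_singleton.2 (Matroid.isNonloop_of_loopless (hc.1.subset_ground he))
  refine hei.isBasis_of_subset_of_subset_closure (by simpa using he) ?_
  have := closure_insert_eq_of_eRk (G := ∅) (n := 0) (Matroid.isFlat_iff_closure_eq.2 (by
    rw [Matroid.closure_empty, M.loops_eq_empty])) hc.1 (Set.empty_subset _) (by simp)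
    (by simpa using hc.2) (e := e) (by simpa using he)
  rw [← this]; simp

theorem isBase_contract_iff {α : Type*} {M : Matroid α} [M.Loopless] {c : Set α}
    (hc : IsAtomFlat M c) {e : α} (he : e ∈ c) {B : Set α} :
    (M.contract c).IsBase B ↔ e ∉ B ∧ M.IsBase (insert e B) := by
  have hbas := isBasis_singleton_of_isAtomFlat hc he
  have hdisj : ∀ J, M.Indep J → e ∈ J → ∀ f ∈ c, f ∈ J → f = e := by
    intro J hJ heJ f hf hfJ
    by_contra hne
    refine hJ.notMem_closure_sdiff_of_mem hfJ (M.closure_subset_closure ?_ (hbas.subset_closure hf))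
    simpa using ⟨heJ, fun h => hne h.symm⟩
  simp only [Matroid.isBase_iff_maximal_indep, maximal_subset_iff, hbas.contract_indep_iff,
    Set.union_singleton]
  constructor
  · rintro ⟨⟨hi, hd⟩, hmax⟩
    have heB : e ∉ B := fun h => Set.disjoint_left.1 hd he h
    refine ⟨heB, hi, fun J hJ hBJ => ?_⟩
    have heJ := hBJ (Set.mem_insert _ _)
    rw [hmax (t := J \ {e}) ⟨by rwa [Set.insert_sdiff_singleton, Set.insert_eq_of_mem heJ],
      Set.disjoint_left.2 fun f hf hfJ => hfJ.2 (hdisj J hJ heJ f hf hfJ.1)⟩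
      fun b hb => ⟨hBJ (Set.mem_insert_of_mem _ hb), fun h => heB (h ▸ hb)⟩,
      Set.insert_sdiff_singleton, Set.insert_eq_of_mem heJ]
  · rintro ⟨heB, hi, hmax⟩
    refine ⟨⟨hi, Set.disjoint_left.2 fun f hf hfB => heB ?_⟩, ?_⟩
    · rwa [← hdisj _ hi (Set.mem_insert _ _) f hf (Set.mem_insert_of_mem _ hfB)]
    · rintro J ⟨hJ, hd⟩ hBJ
      have h := hmax hJ (Set.insert_subset_insert hBJ)
      refine Set.Subset.antisymm hBJ fun f hf => ?_
      rcases (h ▸ Set.mem_insert_of_mem e hf : f ∈ insert e B) with h' | h'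
      · subst h'; exact absurd hf (Set.disjoint_left.1 hd he)
      · exact h'

namespace OrientedMatroid

section Contraction

variable {α : Type*} {𝓜 : OrientedMatroid α}

theorem loopless_contraction [𝓜.matroid.Loopless] {c : Set α} (hc : 𝓜.matroid.IsFlat c) :
    (𝓜.contraction c).matroid.Loopless := by
  rw [matroid_contraction hc.subset_ground]; exact loopless_contract hc

/-- A chirotope of the contraction by an atom. -/
theorem IsChirotope.contraction [𝓜.matroid.Loopless] {k : ℕ} {χ : (Fin (k + 1) → α) → SignType}
    (hχ : 𝓜.IsChirotope χ) {c : Set α} (hc : IsAtomFlat 𝓜.matroid c) {e : α} (he : e ∈ c) :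
    (𝓜.contraction c).IsChirotope fun x : Fin k → α => χ (Fin.snoc x e) := by
  refine ⟨fun x => ?_, fun x σ => ?_, fun x i f X hX hX0 => ?_⟩
  · rw [hχ.ne_zero_iff, matroid_contraction hc.1.subset_ground, isBase_contract_iff hc he,
      Fin.snoc_injective_iff, Fin.range_snoc]
    tauto
  · have h1 : (Fin.snoc (x ∘ σ) e : Fin (k + 1) → α) =
        Fin.snoc x e ∘ (finSuccEquivLast.symm.permCongr (Equiv.optionCongr σ)) := by
      ext j
      refine Fin.lastCases ?_ (fun j => ?_) j
      · simp [Equiv.permCongr_apply]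
      · simp [Equiv.permCongr_apply]
    rw [h1, hχ.alternating, Equiv.Perm.sign_permCongr, Equiv.optionCongr_sign]
  · have h := hχ.compatible (Fin.snoc x e) i.castSucc f X hX.1 (fun j => Fin.lastCases
      (fun _ => by simpa using hX.2 e he) (fun j hj => by
        simpa using hX0 j fun h => hj (by rw [h])) j)
    rw [Fin.snoc_castSucc] at h
    rw [h, Fin.snoc_update]

theorem IsTope.indicator_eq [𝓜.matroid.Loopless] {P Y : α → SignType} (hP : 𝓜.IsTope P)
    (hY : Y ∈ 𝓜.covectors) (hYP : IsSignFace Y P) :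
    (𝓜.zeroSet Y)ᶜ.indicator P = Y := by
  ext e
  by_cases h : e ∈ 𝓜.zeroSet Y
  · rw [Set.indicator_of_notMem (by simpa using h), h.2]
  · rw [Set.indicator_of_mem (by simpa using h)]
    by_cases he : e ∈ 𝓜.E
    · exact (hYP e fun h0 => h ⟨he, h0⟩).symm
    · rw [eq_zero_of_notMem hP.1 he, eq_zero_of_notMem hY he]

theorem IsTope.contraction [𝓜.matroid.Loopless] {P : α → SignType} (hP : 𝓜.IsTope P) {c : Set α}
    (hc : IsFaceFlat 𝓜.matroid 𝓜.covectors P c) :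
    (𝓜.contraction c).IsTope (cᶜ.indicator P) := by
  obtain ⟨Y, hY, hYP, rfl⟩ := hc
  change (𝓜.contraction (𝓜.zeroSet Y)).IsTope ((𝓜.zeroSet Y)ᶜ.indicator P)
  rw [hP.indicator_eq hY hYP]
  exact isTope_of_forall_ne ⟨hY, fun f hf => hf.2⟩ fun e he h0 => he.2 ⟨he.1, h0⟩

theorem IsTope.isFaceFlat_empty (h : 𝓜.matroid.Loopless) {P : α → SignType} (hP : 𝓜.IsTope P) :
    IsFaceFlat 𝓜.matroid 𝓜.covectors P ∅ :=
  ⟨P, hP.1, fun _ _ => rfl, Set.eq_empty_of_forall_notMem fun _ he => hP.ne_zero h he.1 he.2⟩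

/-- The face lattice of `P/c` is the part of the face lattice of `P` above `c`. -/
theorem isFaceFlat_contraction_iff {P : α → SignType} {c G : Set α}
    (hc : IsFaceFlat 𝓜.matroid 𝓜.covectors P c) (hcG : c ⊆ G) :
    IsFaceFlat (𝓜.contraction c).matroid (𝓜.contraction c).covectors (cᶜ.indicator P) (G \ c) ↔
      IsFaceFlat 𝓜.matroid 𝓜.covectors P G := by
  have hcE : c ⊆ 𝓜.E := by obtain ⟨Y, -, -, rfl⟩ := hc; exact fun e he => he.1
  constructor
  · rintro ⟨X, hX, hXP, hXG⟩
    refine ⟨X, hX.1, fun e he => ?_, ?_⟩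
    · rw [hXP e he, Set.indicator_of_mem]
      exact fun hec => he (hX.2 e hec)
    · ext e
      by_cases hec : e ∈ c
      · exact ⟨fun _ => hcG hec, fun _ => ⟨hcE hec, hX.2 e hec⟩⟩
      · have := Set.ext_iff.1 hXG e
        simp only [Set.mem_ofPred_eq, Set.mem_sdiff, hec, not_false_eq_true, and_true] at this
        rw [← this]
        exact ⟨fun h => ⟨⟨h.1, hec⟩, h.2⟩, fun h => ⟨h.1.1, h.2⟩⟩
  · rintro ⟨X, hX, hXP, rfl⟩
    refine ⟨X, ⟨hX, fun f hf => (hcG hf).2⟩, fun e he => ?_, ?_⟩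
    · rw [hXP e he, Set.indicator_of_mem]
      exact fun hec => he (hcG hec).2
    · ext e
      exact ⟨fun h => ⟨⟨h.1.1, h.2⟩, h.1.2⟩, fun h => ⟨⟨h.1.1, h.2⟩, h.1.2⟩⟩

theorem IsTope.isFaceFlag_iff [𝓜.matroid.Loopless] {P : α → SignType} (hP : 𝓜.IsTope P) {k : ℕ}
    {F : Fin (k + 2) → Set α} (hF : F ∈ flags 𝓜.matroid (k + 1))
    (hc : IsFaceFlat 𝓜.matroid 𝓜.covectors P (F 1)) :
    (𝓜.contraction (F 1)).IsFaceFlag ((F 1)ᶜ.indicator P) (flagTail F) ↔ 𝓜.IsFaceFlag P F := by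
  have hsub : ∀ i : Fin (k + 1), F 1 ⊆ F i.succ := fun i => hF.1 (by rw [Fin.le_def]; simp)
  simp only [IsFaceFlag]
  rw [Fin.forall_fin_succ (P := fun i => IsFaceFlat 𝓜.matroid 𝓜.covectors P (F i)),
    flags_zero_eq_empty hF]
  simp only [flagTail, hP.isFaceFlat_empty inferInstance, true_and]
  exact forall_congr' fun i => isFaceFlat_contraction_iff hc (hsub i)

theorem isTransversal_cons {M : Matroid α} [M.Loopless] {k : ℕ} {F : Fin (k + 2) → Set α}
    (hF : F ∈ flags M (k + 1)) {e : α} (he : e ∈ F 1) {u : Fin k → α} :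
    IsTransversal F (Fin.cons e u : Fin (k + 1) → α) ↔ IsTransversal (flagTail F) u := by
  have hsub : ∀ i : Fin (k + 1), F 1 ⊆ F i.succ := fun i => hF.1 (by rw [Fin.le_def]; simp)
  simp only [IsTransversal]
  rw [Fin.forall_fin_succ]
  have h0 : e ∈ F (Fin.succ 0) \ F (Fin.castSucc 0) := by
    rw [Fin.castSucc_zero, flags_zero_eq_empty hF]; simpa using he
  simp only [Fin.cons_zero, h0, true_and, Fin.cons_succ, flagTail]
  refine forall_congr' fun i => ?_
  rw [← Fin.succ_castSucc]
  have := hsub i.castSucc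
  constructor
  · exact fun h => ⟨⟨h.1, fun h' => h.2 (this h')⟩, fun h' => h.2 h'.1⟩
  · exact fun h => ⟨h.1.1, fun h' => h.2 ⟨h', h.1.2⟩⟩

theorem topeSign_cons {k : ℕ} (χ : (Fin (k + 1) → α) → SignType) {P : α → SignType} {c : Set α}
    {e : α} {u : Fin k → α} (hu : ∀ i, u i ∉ c) :
    topeSign χ P (Fin.cons e u : Fin (k + 1) → α) =
      P e * topeSign (fun x => χ (Fin.snoc x e)) (cᶜ.indicator P) u := by
  have h1 : (Fin.cons e u : Fin (k + 1) → α) ∘ Fin.rev = Fin.snoc (u ∘ Fin.rev) e := by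
    ext j
    refine Fin.lastCases ?_ (fun j => ?_) j
    · simp
    · simp [Fin.rev_castSucc]
  rw [topeSign, topeSign, h1, Fin.prod_univ_succ, mul_assoc]
  simp [Set.indicator_of_mem, hu]

/-- The residues of a tope at an atom `c` of its face lattice are, up to the sign of the tope on `c`,
those of the induced tope of the contraction by `c`. -/
theorem topeFlagVal_succ [𝓜.matroid.Loopless] {k : ℕ} {χ : (Fin (k + 1) → α) → SignType}
    (hχ : 𝓜.IsChirotope χ) {P : α → SignType} (hP : 𝓜.IsTope P) {F : Fin (k + 2) → Set α}
    (hF : F ∈ flags 𝓜.matroid (k + 1)) (hc : IsFaceFlat 𝓜.matroid 𝓜.covectors P (F 1)) {e : α}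
    (he : e ∈ F 1) :
    𝓜.topeFlagVal χ P F = (P e : ℤ) * (𝓜.contraction (F 1)).topeFlagVal
      (fun x => χ (Fin.snoc x e)) ((F 1)ᶜ.indicator P) (flagTail F) := by
  have hat := flags_isAtomFlat hF
  have hl : (𝓜.contraction (F 1)).matroid.Loopless := loopless_contraction hat.1
  have hF' : flagTail F ∈ flags (𝓜.contraction (F 1)).matroid k := by
    rw [matroid_contraction hat.1.subset_ground]; exact flagTail_mem hF
  by_cases h : 𝓜.IsFaceFlag P F
  · obtain ⟨u, hu⟩ := exists_isTransversal hF'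
    rw [topeFlagVal_eq hχ hF h ((isTransversal_cons hF he).2 hu),
      topeFlagVal_eq (hχ.contraction hat he) hF' ((hP.isFaceFlag_iff hF hc).2 h) hu,
      topeSign_cons χ fun i => (hu i).1.2, SignType.coe_mul]
  · rw [topeFlagVal_eq_zero h, topeFlagVal_eq_zero fun h' => h ((hP.isFaceFlag_iff hF hc).1 h'),
      mul_zero]

end Contraction

section CanonicalForms

variable {α : Type*}

theorem flagRes_flagCons {M : Matroid α} [M.Loopless] {k : ℕ} {c : Set α} (hc : IsAtomFlat M c)
    {F : Fin (k + 1) → Set α} (hF : F ∈ flags (M.contract c) k) (x : OS M) :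
    flagRes (k + 1) M (flagCons c F) x = flagRes k (M.contract c) F (res M c x) := by
  rw [flagRes_succ, flagTail_flagCons hc hF, flagCons_one hc hF]

variable [Finite α]

/-- The canonical form of a tope is the element of top degree whose residue along each flag is the
sign of the tope on that flag. -/
theorem isCanonicalForm_iff {k : ℕ} {M : Matroid α} (𝓜 : OrientedMatroid α) (hM : 𝓜.matroid = M)
    [hl : M.Loopless] {χ : (Fin k → α) → SignType} (hχ : 𝓜.IsChirotope χ) {P : α → SignType}
    (hP : 𝓜.IsTope P) (ω : OS M) :
    IsCanonicalForm k M 𝓜.covectors χ P ω ↔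
      ω ∈ osDegree M k ∧ ∀ F ∈ flags M k, flagRes k M F ω = 𝓜.topeFlagVal χ P F := by
  have := Fintype.ofFinite α
  induction k generalizing M 𝓜 P with
  | zero =>
    subst hM
    have hmem : (χ ![] : ℤ) • osMk 𝓜.matroid 1 ∈ osDegree 𝓜.matroid 0 :=
      Submodule.smul_mem _ _ (wedge_zero (α := α) ![] ▸ osMk_wedge_mem _)
    have hval : ∀ F ∈ flags 𝓜.matroid 0, flagRes 0 𝓜.matroid F ((χ ![] : ℤ) • osMk 𝓜.matroid 1) =
        𝓜.topeFlagVal χ P F := by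
      intro F hF
      have hface : 𝓜.IsFaceFlag P F := by
        intro i
        rw [Fin.fin_one_eq_zero i, flags_zero_eq_empty hF]
        exact hP.isFaceFlat_empty hl
      rw [topeFlagVal_eq hχ hF hface (u := ![]) (fun i => i.elim0), map_smul,
        ← wedge_zero (α := α) ![], flagRes_wedge hF, Matrix.det_fin_zero, topeSign]
      simp [Matrix.empty_eq]
    constructor
    · rintro rfl
      exact ⟨hmem, hval⟩
    · rintro ⟨h, hv⟩
      exact eq_of_flagRes_eq h hmem fun F hF => (hv F hF).trans (hval F hF).symm
  | succ k ih =>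
    subst hM
    rw [IsCanonicalForm]
    refine and_congr_right fun hω => ?_
    constructor
    · intro h F hF
      have hat := flags_isAtomFlat hF
      obtain ⟨e, he⟩ := flags_exists_mem_sdiff hF 0
      replace he : e ∈ F 1 := he.1
      obtain ⟨h1, h2⟩ := h _ hat e he
      have hl' : (𝓜.matroid.contract (F 1)).Loopless := loopless_contract hat.1
      rw [flagRes_succ]
      by_cases hc : IsFaceFlat 𝓜.matroid 𝓜.covectors P (F 1)
      · obtain ⟨ω', hω', hr⟩ := h1 hc
        have := (ih (𝓜.contraction (F 1)) (matroid_contraction hat.1.subset_ground)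
          (hχ.contraction hat he) (hP.contraction hc) ω').1 hω'
        rw [hr, map_smul, this.2 _ (flagTail_mem hF), topeFlagVal_succ hχ hP hF hc he, smul_eq_mul]
      · rw [h2 hc, map_zero, topeFlagVal_eq_zero fun h' => hc (h' 1)]
    · intro h c hat e he
      have hl' : (𝓜.matroid.contract c).Loopless := loopless_contract hat.1
      have hMc := matroid_contraction (𝓜 := 𝓜) hat.1.subset_ground
      have hlc : (𝓜.contraction c).matroid.Loopless := hMc ▸ hl'
      refine ⟨fun hc => ?_, fun hc => ?_⟩
      · have hrel := flagRel_topeFlagVal (hχ.contraction hat he) (cᶜ.indicator P)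
        rw [hMc] at hrel
        obtain ⟨ω', hω', hres⟩ := exists_flagRes_eq hrel
        refine ⟨ω', (ih (𝓜.contraction c) hMc (hχ.contraction hat he) (hP.contraction hc) ω').2
          ⟨hω', hres⟩, ?_⟩
        refine eq_of_flagRes_eq (res_mem_osDegree hat hω) (Submodule.smul_mem _ _ hω') fun F hF => ?_
        have hF' := flagCons_mem hat hF
        rw [← flagRes_flagCons hat hF, h _ hF', map_smul, hres F hF, smul_eq_mul,
          topeFlagVal_succ hχ hP hF' (by rwa [flagCons_one hat hF]) (e := e)
            (by rwa [flagCons_one hat hF]), flagTail_flagCons hat hF, flagCons_one hat hF]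
      · refine eq_of_flagRes_eq (res_mem_osDegree hat hω) (Submodule.zero_mem _) fun F hF => ?_
        rw [← flagRes_flagCons hat hF, h _ (flagCons_mem hat hF), map_zero, topeFlagVal_eq_zero]
        exact fun h' => hc (flagCons_one hat hF ▸ h' 1)

theorem canonicalForm_spec {𝓜 : OrientedMatroid α} [𝓜.matroid.Loopless] {k : ℕ}
    {χ : (Fin k → α) → SignType} (hχ : 𝓜.IsChirotope χ) {P : α → SignType} (hP : 𝓜.IsTope P) :
    IsCanonicalForm k 𝓜.matroid 𝓜.covectors χ P (canonicalForm 𝓜 χ P : OS 𝓜.matroid) := by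
  have := Fintype.ofFinite α
  obtain ⟨ω, hω, hres⟩ := exists_flagRes_eq (flagRel_topeFlagVal hχ P)
  have h : ∃ ω : osDegree 𝓜.matroid k, IsCanonicalForm k 𝓜.matroid 𝓜.covectors χ P ω :=
    ⟨⟨ω, hω⟩, (isCanonicalForm_iff 𝓜 rfl hχ hP ω).2 ⟨hω, hres⟩⟩
  rw [canonicalForm, dif_pos h]
  exact h.choose_spec

theorem flagRes_canonicalForm {𝓜 : OrientedMatroid α} [𝓜.matroid.Loopless] {k : ℕ}
    {χ : (Fin k → α) → SignType} (hχ : 𝓜.IsChirotope χ) {P : α → SignType} (hP : 𝓜.IsTope P)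
    {F : Fin (k + 1) → Set α} (hF : F ∈ flags 𝓜.matroid k) :
    flagRes k 𝓜.matroid F (canonicalForm 𝓜 χ P) = 𝓜.topeFlagVal χ P F :=
  ((isCanonicalForm_iff 𝓜 rfl hχ hP _).1 (canonicalForm_spec hχ hP)).2 F hF

theorem isCanonicalForm_iff_eq_canonicalForm {𝓜 : OrientedMatroid α} [𝓜.matroid.Loopless] {k : ℕ}
    {χ : (Fin k → α) → SignType} (hχ : 𝓜.IsChirotope χ) {P : α → SignType} (hP : 𝓜.IsTope P)
    (ω : osDegree 𝓜.matroid k) :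
    IsCanonicalForm k 𝓜.matroid 𝓜.covectors χ P ω ↔ ω = canonicalForm 𝓜 χ P := by
  constructor
  · intro h
    refine Subtype.ext (eq_of_flagRes_eq ω.2 (canonicalForm 𝓜 χ P).2 fun F hF => ?_)
    rw [flagRes_canonicalForm hχ hP hF, ((isCanonicalForm_iff 𝓜 rfl hχ hP _).1 h).2 F hF]
  · rintro rfl
    exact canonicalForm_spec hχ hP

end CanonicalForms

end OrientedMatroid

/-! ### Topes with prescribed signs on a basis -/

theorem flags_last_eq_ground {α : Type*} {M : Matroid α} {k : ℕ} {F : Fin (k + 1) → Set α}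
    (hF : F ∈ flags M k) (hr : M.eRank = k) : F (Fin.last k) = M.E :=
  isFlat_eq_of_subset (flags_isFlat hF _) M.ground_isFlat (flags_isFlat hF _).subset_ground
    (by simpa using flags_eRk hF (Fin.last k)) (by rw [M.eRk_ground, hr])

namespace OrientedMatroid

section PrescribedSigns

variable {α : Type*} {𝓜 : OrientedMatroid α}

theorem ne_zero_of_mem_sdiff {k : ℕ} {F : Fin (k + 1) → Set α} (hF : F ∈ flags 𝓜.matroid k)
    {X : α → SignType} {j : Fin (k + 1)} {i : Fin k} (hX : 𝓜.zeroSet X = F j) (hj : j ≤ i.castSucc)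
    {e : α} (he : e ∈ F i.succ \ F i.castSucc) : X e ≠ 0 := fun h0 =>
  he.2 (hF.1 hj (hX ▸ ⟨(flags_isFlat hF _).subset_ground he.1, h0⟩))

/-- Within a step of the flag, two topes with that flag agree up to a global sign. -/
theorem IsFaceFlag.mul_eq_mul {k : ℕ} {F : Fin (k + 1) → Set α} (hF : F ∈ flags 𝓜.matroid k)
    {P Q : α → SignType} (hP : 𝓜.IsFaceFlag P F) (hQ : 𝓜.IsFaceFlag Q F) {i : Fin k} {e f : α}
    (he : e ∈ F i.succ \ F i.castSucc) (hf : f ∈ F i.succ \ F i.castSucc) :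
    P e * Q f = P f * Q e := by
  obtain ⟨X, hX, hXP, hX0⟩ := hP i.castSucc
  obtain ⟨Y, hY, hYQ, hY0⟩ := hQ i.castSucc
  have hcl : f ∈ 𝓜.cl (insert e (F i.castSucc)) := by
    rw [← closure_eq_cl (Set.insert_subset ((flags_isFlat hF _).subset_ground he.1)
      (flags_isFlat hF _).subset_ground),
      closure_insert_eq_of_eRk (flags_isFlat hF _) (flags_isFlat hF i.succ) (flags_subset hF i)
        (flags_eRk hF _) (by simpa using flags_eRk hF i.succ) he]
    exact hf.1
  have h := mul_eq_mul_of_mem_cl hcl hX hY (fun g hg => by rw [← hX0] at hg; exact hg.2)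
    (fun g hg => by rw [← hY0] at hg; exact hg.2)
  have hXne : ∀ g ∈ F i.succ \ F i.castSucc, X g = P g := fun g hg =>
    hXP g (ne_zero_of_mem_sdiff hF hX0 le_rfl hg)
  have hYne : ∀ g ∈ F i.succ \ F i.castSucc, Y g = Q g := fun g hg =>
    hYQ g (ne_zero_of_mem_sdiff hF hY0 le_rfl hg)
  rwa [hXne e he, hXne f hf, hYne e he, hYne f hf] at h

/-- There is a tope with a given complete flag and given signs on a transversal of the flag. -/
theorem exists_tope_of_transversal [𝓜.matroid.Loopless] {k : ℕ} {F : Fin (k + 1) → Set α}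
    (hF : F ∈ flags 𝓜.matroid k) {t : Fin k → α} (ht : IsTransversal F t) {ε : Fin k → SignType}
    (hε : ∀ i, ε i ≠ 0) : ∃ P, 𝓜.IsTope P ∧ 𝓜.IsFaceFlag P F ∧ ∀ i, P (t i) = ε i := by
  have key : ∀ j : Fin (k + 1), ∃ Y ∈ 𝓜.covectors, 𝓜.zeroSet Y = F j ∧
      (∀ l, j ≤ l → IsFaceFlat 𝓜.matroid 𝓜.covectors Y (F l)) ∧
      ∀ i : Fin k, j ≤ i.castSucc → Y (t i) = ε i := by
    intro j
    induction j using Fin.reverseInduction with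
    | last =>
      obtain ⟨Y, hY, hY0⟩ := exists_zeroSet_eq (flags_isFlat hF (Fin.last k))
      refine ⟨Y, hY, hY0, fun l hl => ⟨Y, hY, fun _ _ => rfl, ?_⟩, fun i hi => ?_⟩
      · rw [Fin.last_le_iff.1 hl]; exact hY0
      · exact absurd (Fin.last_le_iff.1 hi) (Fin.castSucc_lt_last i).ne
    | cast j ih =>
      obtain ⟨Y, hY, hY0, hYF, hYt⟩ := ih
      obtain ⟨X, hX, hX0, hXt⟩ : ∃ X ∈ 𝓜.covectors, 𝓜.zeroSet X = F j.castSucc ∧ X (t j) = ε j := by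
        obtain ⟨X, hX, hX0⟩ := exists_zeroSet_eq (flags_isFlat hF j.castSucc)
        have hne := ne_zero_of_mem_sdiff hF hX0 le_rfl (ht j)
        by_cases h : X (t j) = ε j
        · exact ⟨X, hX, hX0, h⟩
        · refine ⟨-X, 𝓜.neg_mem X hX, ?_, ?_⟩
          · rw [← hX0]; ext e; simp [zeroSet]
          · rw [Pi.neg_apply, sign_eq_neg_of_ne hne (hε j) h, neg_neg]
      have hface : IsSignFace Y (signComp Y X) := fun e he => (signComp_of_ne he).symm
      have h0 : 𝓜.zeroSet (signComp Y X) = F j.castSucc := by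
        ext e
        have h1 := Set.ext_iff.1 hX0 e
        have h2 := Set.ext_iff.1 hY0 e
        have h3 : e ∈ F j.castSucc → e ∈ F j.succ := fun h => flags_subset hF j h
        rw [← h1] at h3 ⊢
        rw [← h2] at h3
        constructor
        · rintro ⟨he, hz⟩
          by_cases hYe : Y e = 0
          · rw [signComp_of_eq hYe] at hz; exact ⟨he, hz⟩
          · rw [signComp_of_ne hYe] at hz; exact absurd hz hYe
        · intro he
          exact ⟨he.1, by rw [signComp_of_eq (h3 he).2, he.2]⟩
      refine ⟨signComp Y X, 𝓜.comp_mem Y hY X hX, h0, fun l hl => ?_, fun i hi => ?_⟩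
      · rcases eq_or_lt_of_le hl with rfl | hl
        · exact ⟨_, 𝓜.comp_mem Y hY X hX, fun _ _ => rfl, h0⟩
        · obtain ⟨Z, hZ, hZY, hZ0⟩ := hYF l (Fin.castSucc_lt_iff_succ_le.1 hl)
          exact ⟨Z, hZ, hZY.trans hface, hZ0⟩
      · rcases eq_or_lt_of_le hi with hi | hi
        · rw [← Fin.castSucc_injective _ hi, signComp_of_eq, hXt]
          exact ((Set.ext_iff.1 hY0 _).2 (ht j).1).2
        · have hle := Fin.castSucc_lt_iff_succ_le.1 hi
          rw [signComp_of_ne (ne_zero_of_mem_sdiff hF hY0 hle (ht i)), hYt i hle]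
  obtain ⟨P, hP, hP0, hPF, hPt⟩ := key 0
  refine ⟨P, isTope_of_forall_ne hP fun e he h0 => ?_, fun l => hPF l (Fin.zero_le _),
    fun i => hPt i (Fin.zero_le _)⟩
  have h1 : e ∈ 𝓜.zeroSet P := ⟨he, h0⟩
  rw [hP0, flags_zero_eq_empty hF] at h1
  exact h1

/-- Two topes with the same complete flag that agree on a transversal are equal. -/
theorem eq_of_eq_on_transversal [𝓜.matroid.Loopless] {k : ℕ} {F : Fin (k + 1) → Set α}
    (hF : F ∈ flags 𝓜.matroid k) (hr : 𝓜.matroid.eRank = k) {t : Fin k → α}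
    (ht : IsTransversal F t) {P Q : α → SignType} (hP : 𝓜.IsTope P) (hQ : 𝓜.IsTope Q)
    (hPF : 𝓜.IsFaceFlag P F) (hQF : 𝓜.IsFaceFlag Q F) (h : ∀ i, P (t i) = Q (t i)) : P = Q := by
  ext e
  by_cases he : e ∈ 𝓜.E
  · obtain ⟨i, -, hi⟩ := flags_exists_step hF (Fin.last k) (e := e) (by
      rwa [flags_last_eq_ground hF hr])
    have h1 := hPF.mul_eq_mul hF hQF hi (ht i)
    have h2 := hP.ne_zero inferInstance ((flags_isFlat hF _).subset_ground (ht i).1)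
    rw [← h i] at h1
    generalize P e = a, P (t i) = b, Q e = c at *
    clear h
    revert a b c
    decide
  · rw [eq_zero_of_notMem hP.1 he, eq_zero_of_notMem hQ.1 he]

/-- Reversing the signs of a tope on one step of a flag of the tope. -/
theorem exists_flip [𝓜.matroid.Loopless] {k : ℕ} {F : Fin (k + 1) → Set α}
    (hF : F ∈ flags 𝓜.matroid k) {P : α → SignType} (hP : 𝓜.IsTope P) (hPF : 𝓜.IsFaceFlag P F)
    (i : Fin k) : ∃ Q, 𝓜.IsTope Q ∧ 𝓜.IsFaceFlag Q F ∧
      (∀ e ∈ F i.succ \ F i.castSucc, Q e = -P e) ∧ ∀ e ∉ F i.succ \ F i.castSucc, Q e = P e := by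
  obtain ⟨X, hX, hXP, hX0⟩ := hPF i.castSucc
  obtain ⟨Y, hY, hYP, hY0⟩ := hPF i.succ
  have hX1 : ∀ e ∈ 𝓜.E, X e = 0 ↔ e ∈ F i.castSucc := fun e he =>
    ⟨fun h => hX0 ▸ ⟨he, h⟩, fun h => by rw [← hX0] at h; exact h.2⟩
  have hY1 : ∀ e ∈ 𝓜.E, Y e = 0 ↔ e ∈ F i.succ := fun e he =>
    ⟨fun h => hY0 ▸ ⟨he, h⟩, fun h => by rw [← hY0] at h; exact h.2⟩
  -- flipping the step in a face of `P` that does not vanish outside the bottom of the step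
  let flip : (α → SignType) → α → SignType := fun Z => signComp Y (signComp (-X) Z)
  have hflip : ∀ Z ∈ 𝓜.covectors, flip Z ∈ 𝓜.covectors := fun Z hZ =>
    𝓜.comp_mem _ hY _ (𝓜.comp_mem _ (𝓜.neg_mem X hX) _ hZ)
  have h1 : ∀ Z, ∀ e ∈ 𝓜.E, e ∉ F i.succ → flip Z e = P e := fun Z e he h => by
    have hne := fun h0 => h ((hY1 e he).1 h0)
    rw [← hYP e hne]; exact signComp_of_ne hne
  have h2 : ∀ Z, ∀ e ∈ F i.succ \ F i.castSucc, flip Z e = -P e := fun Z e he => by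
    have heE := (flags_isFlat hF _).subset_ground he.1
    have hne : X e ≠ 0 := fun h0 => he.2 ((hX1 e heE).1 h0)
    have hne' : (-X) e ≠ 0 := by simpa using hne
    change signComp Y (signComp (-X) Z) e = _
    rw [signComp_of_eq ((hY1 e heE).2 he.1), signComp_of_ne hne', Pi.neg_apply, hXP e hne]
  have h3 : ∀ Z, ∀ e ∈ F i.castSucc, flip Z e = Z e := fun Z e he => by
    have heE := (flags_isFlat hF _).subset_ground he
    change signComp Y (signComp (-X) Z) e = _
    rw [signComp_of_eq ((hY1 e heE).2 (flags_subset hF i he)), signComp_of_eq]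
    simpa using (hX1 e heE).2 he
  have hPne := fun e he => hP.ne_zero inferInstance (e := e) he
  have hnz : ∀ Z, ∀ e ∈ 𝓜.E, e ∉ F i.castSucc → flip Z e ≠ 0 := fun Z e he h => by
    by_cases hs : e ∈ F i.succ
    · rw [h2 Z e ⟨hs, h⟩]; simpa using hPne e he
    · rw [h1 Z e he hs]; exact hPne e he
  refine ⟨flip P, isTope_of_forall_ne (hflip P hP.1) fun e he => ?_, fun j => ?_, h2 P,
    fun e he => ?_⟩
  · by_cases h : e ∈ F i.castSucc
    · rw [h3 P e h]; exact hPne e he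
    · exact hnz P e he h
  · obtain ⟨Z, hZ, hZP, hZ0⟩ := hPF j
    have hZ1 : ∀ e ∈ 𝓜.E, Z e = 0 ↔ e ∈ F j := fun e he =>
      ⟨fun h => hZ0 ▸ ⟨he, h⟩, fun h => by rw [← hZ0] at h; exact h.2⟩
    rcases le_or_gt j i.castSucc with hj | hj
    · refine ⟨flip Z, hflip Z hZ, fun e he => ?_, ?_⟩
      · have heE := 𝓜.mem_E _ (hflip Z hZ) e he
        by_cases h : e ∈ F i.castSucc
        · rw [h3 Z e h, h3 P e h]
          rw [h3 Z e h] at he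
          exact hZP e he
        · by_cases hs : e ∈ F i.succ
          · rw [h2 Z e ⟨hs, h⟩, h2 P e ⟨hs, h⟩]
          · rw [h1 Z e heE hs, h1 P e heE hs]
      · ext e
        constructor
        · rintro ⟨he, h0⟩
          by_cases h : e ∈ F i.castSucc
          · exact (hZ1 e he).1 (h3 Z e h ▸ h0)
          · exact absurd h0 (hnz Z e he h)
        · intro h
          have he := (flags_isFlat hF _).subset_ground h
          exact ⟨he, by rw [h3 Z e (hF.1 hj h)]; exact (hZ1 e he).2 h⟩
    · refine ⟨Z, hZ, fun e he => ?_, hZ0⟩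
      have heE := 𝓜.mem_E _ hZ e he
      rw [h1 P e heE fun h => he ((hZ1 e heE).2 (hF.1 (Fin.castSucc_lt_iff_succ_le.1 hj) h))]
      exact hZP e he
  · by_cases heE : e ∈ 𝓜.E
    · by_cases hs : e ∈ F i.succ
      · exact h3 P e (by by_contra h; exact he ⟨hs, h⟩)
      · exact h1 P e heE hs
    · rw [eq_zero_of_notMem (hflip P hP.1) heE, eq_zero_of_notMem hP.1 heE]

theorem isFaceFlag_of_topeFlagVal_ne_zero {k : ℕ} {χ : (Fin k → α) → SignType}
    {P : α → SignType} {F : Fin (k + 1) → Set α} (h : 𝓜.topeFlagVal χ P F ≠ 0) :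
    𝓜.IsFaceFlag P F := by
  by_contra h'
  exact h (topeFlagVal_eq_zero h')

theorem coe_sign_permSign {k : ℕ} (σ : Equiv.Perm (Fin k)) :
    ((SignType.sign (Equiv.Perm.sign σ : ℤ) : SignType) : ℤ) = (Equiv.Perm.sign σ : ℤ) := by
  rcases Int.units_eq_one_or (Equiv.Perm.sign σ) with h | h <;> simp [h]

/-- The signs along a flag of all topes with given signs on a basis sum to the residue of the
monomial of the basis: either the basis is a transversal of the flag, and exactly one of these topes
has the flag, or it misses a step of the flag, and the topes cancel in pairs. -/
theorem sum_topeFlagVal_eq [𝓜.matroid.Loopless] {k : ℕ} {χ : (Fin k → α) → SignType}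
    (hχ : 𝓜.IsChirotope χ) {F : Fin (k + 1) → Set α} (hF : F ∈ flags 𝓜.matroid k)
    {b : Fin k → α} (hr : 𝓜.matroid.eRank = k) {C : α → SignType} (hC : ∀ i, C (b i) ≠ 0)
    {s : Finset (α → SignType)} (hs : ∀ P, P ∈ s ↔ 𝓜.IsTope P ∧ ∀ i, P (b i) = C (b i)) :
    ∑ P ∈ s, 𝓜.topeFlagVal χ P F = (topeSign χ C b : ℤ) * (flagMatrix F b).det := by
  classical
  by_cases hσ : ∃ σ : Equiv.Perm (Fin k), IsTransversal F (b ∘ σ)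
  · obtain ⟨σ, hσ⟩ := hσ
    obtain ⟨P, hP, hPF, hPt⟩ := exists_tope_of_transversal hF hσ fun i => hC (σ i)
    have hPb : ∀ i, P (b i) = C (b i) := fun i => by simpa using hPt (σ.symm i)
    rw [Finset.sum_eq_single P]
    rotate_left
    · intro Q hQ hne
      by_contra h0
      refine hne (eq_of_eq_on_transversal hF hr hσ ((hs Q).1 hQ).1 hP
        (isFaceFlag_of_topeFlagVal_ne_zero h0) hPF fun i => ?_)
      rw [hPt, Function.comp_apply, ((hs Q).1 hQ).2]
    · exact fun h => absurd ((hs P).2 ⟨hP, hPb⟩) h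
    have h1 : topeSign χ P b = topeSign χ C b := by simp only [topeSign, hPb]
    have h2 := det_flagMatrix_comp_perm F b σ
    rw [flagMatrix_transversal hF hσ, Matrix.det_one] at h2
    have h3 : (flagMatrix F b).det = (Equiv.Perm.sign σ : ℤ) := by
      rcases Int.units_eq_one_or (Equiv.Perm.sign σ) with h | h <;> simp [h] at h2 ⊢ <;> omega
    rw [topeFlagVal_eq hχ hF hPF hσ, topeSign_comp_perm hχ, SignType.coe_mul, coe_sign_permSign, h1,
      h3, mul_comm]
  · have hdet : (flagMatrix F b).det = 0 := by
      by_contra h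
      exact hσ (exists_perm_isTransversal hF h)
    obtain ⟨i, hi⟩ : ∃ i : Fin k, ∀ j, b j ∉ F i.succ \ F i.castSucc := by
      by_contra hcon
      push Not at hcon
      choose τ hτ using hcon
      have ht : IsTransversal F (b ∘ τ) := hτ
      have hinj : Function.Injective τ := Function.Injective.of_comp (ht.injective hF)
      exact hσ ⟨Equiv.ofBijective τ (Finite.injective_iff_bijective.1 hinj), hτ⟩
    rw [hdet, mul_zero]
    let g : (α → SignType) → (α → SignType) := fun P e =>
      if e ∈ F i.succ \ F i.castSucc then -P e else P e
    have hg : ∀ P, 𝓜.IsTope P → 𝓜.IsFaceFlag P F → 𝓜.IsTope (g P) ∧ 𝓜.IsFaceFlag (g P) F := by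
      intro P hP hPF
      obtain ⟨Q, hQ, hQF, h1, h2⟩ := exists_flip hF hP hPF i
      have : g P = Q := by
        ext e
        by_cases he : e ∈ F i.succ \ F i.castSucc
        · rw [h1 e he]; exact if_pos he
        · rw [h2 e he]; exact if_neg he
      rw [this]; exact ⟨hQ, hQF⟩
    have hgg : ∀ P, g (g P) = P := by
      intro P
      ext e
      by_cases he : e ∈ F i.succ \ F i.castSucc
      · simp only [g, if_pos he, neg_neg]
      · simp only [g, if_neg he]
    obtain ⟨t, ht⟩ := exists_isTransversal hF
    have hval : ∀ P, 𝓜.IsTope P → 𝓜.IsFaceFlag P F →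
        𝓜.topeFlagVal χ P F + 𝓜.topeFlagVal χ (g P) F = 0 := by
      intro P hP hPF
      rw [topeFlagVal_eq hχ hF hPF ht, topeFlagVal_eq hχ hF (hg P hP hPF).2 ht]
      have h1 : (fun j => g P (t j)) = Function.update (fun j => P (t j)) i (-P (t i)) := by
        ext j
        by_cases hj : j = i
        · subst hj
          rw [Function.update_self]
          exact if_pos (ht j)
        · rw [Function.update_of_ne hj]
          exact if_neg fun h => hj (flags_step_unique hF (ht j) h)
      have h2 : topeSign χ (g P) t = -topeSign χ P t := by
        rw [topeSign, topeSign, h1, Finset.prod_update_of_mem (Finset.mem_univ i),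
          Finset.prod_eq_mul_prod_sdiff_singleton_of_mem (Finset.mem_univ i) (fun j => P (t j)),
          neg_mul, neg_mul]
      rw [h2, SignType.coe_neg, add_neg_cancel]
    rw [← Finset.sum_filter_of_ne (p := fun P => 𝓜.IsFaceFlag P F)
      fun P _ h => isFaceFlag_of_topeFlagVal_ne_zero h]
    refine Finset.sum_involution (fun P _ => g P) (fun P hP => ?_) (fun P hP hne heq => ?_)
      (fun P hP => ?_) (fun P _ => hgg P)
    · have hP' := Finset.mem_filter.1 hP
      exact hval P ((hs P).1 hP'.1).1 hP'.2
    · have hP' := Finset.mem_filter.1 hP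
      have h := hval P ((hs P).1 hP'.1).1 hP'.2
      rw [heq] at h
      exact hne (by omega)
    · have hP' := Finset.mem_filter.1 hP
      have hP'' := (hs P).1 hP'.1
      obtain ⟨h1, h2⟩ := hg P hP''.1 hP'.2
      refine Finset.mem_filter.2 ⟨(hs _).2 ⟨h1, fun j => ?_⟩, h2⟩
      rw [← hP''.2 j]
      exact if_neg (hi j)

end PrescribedSigns

end OrientedMatroid

/-! ### Covectors of a general extension -/

theorem SignOrthogonal.exists_of_ne {α : Type*} {X Y : α → SignType} (h : SignOrthogonal X Y) {e : α}
    (he : X e * Y e ≠ 0) : (∃ f, X f * Y f = 1) ∧ ∃ f, X f * Y f = -1 :=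
  h.resolve_left fun h0 => he (h0 e)

namespace OrientedMatroid

section GeneralExtension

variable {α : Type*} [DecidableEq α] {𝓜 𝓝 : OrientedMatroid α} {star : α}

theorem IsGeneralExtension.subset_ground (h : 𝓝.IsGeneralExtension star 𝓜) : 𝓜.E ⊆ 𝓝.E := by
  rw [h.ground_eq]; exact Set.subset_insert _ _

theorem IsGeneralExtension.ne_star (h : 𝓝.IsGeneralExtension star 𝓜) {e : α} (he : e ∈ 𝓜.E) :
    e ≠ star := fun h' => h.star_notMem (h' ▸ he)

theorem IsGeneralExtension.update_mem (h : 𝓝.IsGeneralExtension star 𝓜) {X : α → SignType}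
    (hX : X ∈ 𝓝.covectors) : Function.update X star 0 ∈ 𝓜.covectors := by
  rw [h.covectors_eq]; exact ⟨X, hX, rfl⟩

theorem IsGeneralExtension.exists_lift (h : 𝓝.IsGeneralExtension star 𝓜) {X : α → SignType}
    (hX : X ∈ 𝓜.covectors) : ∃ Z ∈ 𝓝.covectors, ∀ e, e ≠ star → Z e = X e := by
  rw [h.covectors_eq] at hX
  obtain ⟨Z, hZ, rfl⟩ := hX
  exact ⟨Z, hZ, fun e he => by simp [he]⟩

theorem IsGeneralExtension.eq_of_eq (h : 𝓝.IsGeneralExtension star 𝓜) {X Y : α → SignType}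
    (hX : X ∈ 𝓝.covectors) (hY : ∀ e, e ∉ 𝓝.E → Y e = 0) (hs : X star = Y star)
    (hE : ∀ e ∈ 𝓜.E, X e = Y e) : X = Y := by
  ext e
  by_cases he : e ∈ 𝓝.E
  · rw [h.ground_eq] at he
    rcases he with rfl | he
    exacts [hs, hE e he]
  · rw [eq_zero_of_notMem hX he, hY e he]

theorem IsGeneralExtension.cl_eq (h : 𝓝.IsGeneralExtension star 𝓜) {S : Set α} (hS : S ⊆ 𝓜.E) :
    𝓜.cl S = 𝓝.cl S ∩ 𝓜.E := by
  ext e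
  constructor
  · intro he
    refine ⟨⟨h.subset_ground he.1, fun X hX h0 => ?_⟩, he.1⟩
    have := he.2 _ (h.update_mem hX) fun f hf => by simp [h.ne_star (hS hf), h0 f hf]
    simpa [h.ne_star he.1] using this
  · rintro ⟨he, heE⟩
    refine ⟨heE, fun X hX h0 => ?_⟩
    obtain ⟨Z, hZ, hZX⟩ := h.exists_lift hX
    rw [← hZX e (h.ne_star heE)]
    exact he.2 Z hZ fun f hf => by rw [hZX f (h.ne_star (hS hf)), h0 f hf]

theorem IsGeneralExtension.restrict_eq (h : 𝓝.IsGeneralExtension star 𝓜) :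
    𝓝.matroid.restrict 𝓜.E = 𝓜.matroid := by
  refine Matroid.ext_indep rfl fun I hI => ?_
  have hI' : I ⊆ 𝓜.E := hI
  rw [Matroid.restrict_indep_iff, matroid_indep_iff, matroid_indep_iff]
  constructor
  · rintro ⟨h1, h2⟩
    exact ⟨hI', fun e he hcl => h1.2 e he (by
      rw [h.cl_eq (Set.sdiff_subset.trans hI')] at hcl; exact hcl.1)⟩
  · rintro h1
    exact ⟨⟨hI'.trans h.subset_ground, fun e he hcl => h1.2 e he (by
      rw [h.cl_eq (Set.sdiff_subset.trans hI')]; exact ⟨hcl, hI' he⟩)⟩, hI'⟩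

theorem IsGeneralExtension.eRk_eq (h : 𝓝.IsGeneralExtension star 𝓜) {S : Set α} (hS : S ⊆ 𝓜.E) :
    𝓝.matroid.eRk S = 𝓜.matroid.eRk S := by
  rw [← h.restrict_eq, Matroid.restrict_eRk_eq _ hS]

theorem IsGeneralExtension.star_mem (h : 𝓝.IsGeneralExtension star 𝓜) : star ∈ 𝓝.E := by
  rw [h.ground_eq]; exact Set.mem_insert _ _

/-- A covector of a general extension that vanishes on a basis of the original matroid is zero. -/
theorem IsGeneralExtension.eq_zero_of_isBase (h : 𝓝.IsGeneralExtension star 𝓜) {B : Set α}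
    (hB : 𝓜.matroid.IsBase B) {X : α → SignType} (hX : X ∈ 𝓝.covectors) (h0 : ∀ b ∈ B, X b = 0) :
    X = 0 := by
  have hBE : B ⊆ 𝓜.E := hB.subset_ground
  have hcl : 𝓜.E ⊆ 𝓜.cl B := by
    rw [← closure_eq_cl hBE, hB.closure_eq]; exact subset_rfl
  refine h.eq_of_eq hX (Y := 0) (fun _ _ => rfl) ?_ fun e he => ?_
  · have hle : 𝓝.matroid.eRk (insert star B) ≤ 𝓝.matroid.eRk B := by
      rw [h.general B hBE, h.eRk_eq hBE, ← hB.eRk_eq_eRank]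
      exact min_le_right _ _
    have hs : star ∈ 𝓝.matroid.closure B := by
      by_contra hs
      rw [Matroid.eRk_insert_eq_add_one ⟨h.star_mem, hs⟩] at hle
      have hfin : 𝓝.matroid.eRk B ≠ ⊤ := by
        rw [Matroid.eRk_ne_top_iff]
        exact Matroid.isRkFinite_of_finite _ (𝓜.finite_E.subset hBE)
      exact absurd hle (not_le.2 ((ENat.lt_add_one_iff hfin).2 le_rfl))
    rw [closure_eq_cl (hBE.trans h.subset_ground)] at hs
    exact hs.2 X hX h0
  · have := (h.cl_eq hBE ▸ hcl he).1
    exact this.2 X hX h0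

/-- On a set of smaller rank, a covector of a general extension can vanish without vanishing at
`star`. -/
theorem IsGeneralExtension.exists_star_eq_one (h : 𝓝.IsGeneralExtension star 𝓜) {S : Set α}
    (hS : S ⊆ 𝓜.E) (hr : 𝓜.matroid.eRk S < 𝓜.matroid.eRank) :
    ∃ X ∈ 𝓝.covectors, (∀ e ∈ S, X e = 0) ∧ X star = 1 := by
  have hs : star ∉ 𝓝.cl S := by
    rw [← closure_eq_cl (hS.trans h.subset_ground)]
    intro hs
    have h1 := h.general S hS
    rw [← Matroid.eRk_closure_eq, Matroid.closure_insert_eq_of_mem_closure hs,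
      Matroid.eRk_closure_eq, h.eRk_eq hS] at h1
    have hfin : 𝓜.matroid.eRk S ≠ ⊤ := hr.ne_top
    rcases min_choice (𝓜.matroid.eRk S + 1) 𝓜.matroid.eRank with h2 | h2
    · rw [h2] at h1
      exact ((ENat.lt_add_one_iff hfin).2 le_rfl).ne h1
    · rw [h2] at h1
      exact hr.ne h1
  obtain ⟨X, hX, h0, h1⟩ := (notMem_cl_iff h.star_mem).1 hs
  by_cases hx : X star = 1
  · exact ⟨X, hX, h0, hx⟩
  · refine ⟨-X, 𝓝.neg_mem X hX, fun e he => by simp [h0 e he], ?_⟩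
    rw [Pi.neg_apply, sign_eq_neg_of_ne h1 (by decide) hx, neg_neg]

theorem IsGeneralExtension.exists_covector_of_isBase (h : 𝓝.IsGeneralExtension star 𝓜) {B : Set α}
    (hB : 𝓜.matroid.IsBase B) {b : α} (hb : b ∈ B) :
    ∃ X ∈ 𝓝.covectors, (∀ e ∈ B, e ≠ b → X e = 0) ∧ X star = 1 ∧ X b ≠ 0 := by
  have hBf : B.Finite := 𝓜.finite_E.subset hB.subset_ground
  obtain ⟨X, hX, h0, h1⟩ := h.exists_star_eq_one (S := B \ {b})
    (Set.sdiff_subset.trans hB.subset_ground) (by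
      rw [← hB.eRk_eq_eRank, hB.indep.eRk_eq_encard, (hB.indep.subset Set.sdiff_subset).eRk_eq_encard]
      exact hBf.sdiff.encard_lt_encard (Set.sdiff_singleton_ssubset.2 hb))
  refine ⟨X, hX, fun e he hne => h0 e ⟨he, hne⟩, h1, fun hXb => ?_⟩
  have := h.eq_zero_of_isBase hB hX fun e he => by
    by_cases hne : e = b
    · rw [hne, hXb]
    · exact h0 e ⟨he, hne⟩
  rw [this] at h1
  exact zero_ne_one h1

/-- Every basis of `𝓜` together with `star` supports a signed circuit. The sign at `b` is that of
the covector vanishing on the rest of the basis that is positive at `star`. -/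
theorem IsGeneralExtension.exists_isSignedCircuit (h : 𝓝.IsGeneralExtension star 𝓜) {B : Set α}
    (hB : 𝓜.matroid.IsBase B) :
    ∃ C, 𝓝.IsSignedCircuit C ∧ {e | C e ≠ 0} = insert star B ∧ C star = -1 := by
  have hBE : B ⊆ 𝓜.E := hB.subset_ground
  have hBf : B.Finite := 𝓜.finite_E.subset hBE
  have hsB : ∀ b ∈ B, b ≠ star := fun b hb => h.ne_star (hBE hb)
  choose! X hX hX0 hXs hXb using fun b (hb : b ∈ B) => h.exists_covector_of_isBase hB hb
  -- eliminating the covectors `X b` one at a time leaves a covector vanishing on the basis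
  have key : ∀ (n : ℕ) (Z : α → SignType), Z ∈ 𝓝.covectors → Z star = 1 →
      {b ∈ B | Z b ≠ 0}.ncard = n → ∃ b ∈ B, X b b * Z b = 1 := by
    intro n
    induction n with
    | zero =>
      intro Z hZ hZs hn
      rw [Set.ncard_eq_zero (hBf.subset (Set.sep_subset _ _))] at hn
      have hZ0 := h.eq_zero_of_isBase hB hZ fun b hb => by
        by_contra h0
        exact (Set.eq_empty_iff_forall_notMem.1 hn) b ⟨hb, h0⟩
      rw [hZ0] at hZs
      exact absurd hZs zero_ne_one
    | succ n ih =>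
      intro Z hZ hZs hn
      obtain ⟨b, hb, hZb⟩ : {b ∈ B | Z b ≠ 0}.Nonempty := by
        rw [Set.nonempty_iff_ne_empty]; intro h0; simp [h0] at hn
      by_cases hs : X b b * Z b = 1
      · exact ⟨b, hb, hs⟩
      have hs' : Z b = -X b b := by
        have := hXb b hb
        revert hs hZb this
        generalize X b b = x, Z b = z
        revert x z; decide
      obtain ⟨W, hW, hWb, hWo⟩ := 𝓝.elim (X b) (hX b hb) Z hZ b (hXb b hb) hs'
      have hWB : ∀ b' ∈ B, b' ≠ b → W b' = Z b' := fun b' hb' hne => by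
        have h0 := hX0 b hb b' hb' hne
        rw [hWo b' fun h' => h'.1 h0, signComp_of_eq h0]
      have hWs : W star = 1 := by
        rw [hWo star fun h' => ?_, signComp_of_ne (by rw [hXs b hb]; exact one_ne_zero), hXs b hb]
        have := h'.2
        rw [hZs, hXs b hb] at this
        exact absurd this (by decide)
      have hset : {b' ∈ B | W b' ≠ 0} = {b' ∈ B | Z b' ≠ 0} \ {b} := by
        ext b'
        by_cases hne : b' = b
        · subst hne; simp [hWb]
        · simp only [Set.mem_sep_iff, Set.mem_sdiff, Set.mem_singleton_iff, hne, not_false_eq_true,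
            and_true]
          exact and_congr_right fun hb' => by rw [hWB b' hb' hne]
      obtain ⟨b', hb', hX'⟩ := ih W hW hWs (by
        have := Set.ncard_sdiff_singleton_add_one (s := {b ∈ B | Z b ≠ 0}) ⟨hb, hZb⟩
          (hBf.subset (Set.sep_subset _ _))
        rw [hset]; omega)
      refine ⟨b', hb', ?_⟩
      rwa [← hWB b' hb' fun hne => by rw [hne, hWb, mul_zero] at hX'; exact zero_ne_one hX']
  have key' : ∀ Z ∈ 𝓝.covectors, Z star = 1 → ∃ b ∈ B, X b b * Z b = 1 := fun Z hZ hZs =>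
    key _ Z hZ hZs rfl
  -- a nonzero covector vanishing at `star` has a positive product at some basis element
  have key0 : ∀ Z ∈ 𝓝.covectors, Z star = 0 → ∀ b₀ ∈ B, Z b₀ ≠ 0 → ∃ b ∈ B, X b b * Z b = 1 := by
    intro Z hZ hZs b₀ hb₀ hZb
    by_cases hs : X b₀ b₀ * Z b₀ = 1
    · exact ⟨b₀, hb₀, hs⟩
    have hs' : Z b₀ = -X b₀ b₀ := by
      have := hXb b₀ hb₀
      revert hs hZb this
      generalize X b₀ b₀ = x, Z b₀ = z
      revert x z; decide
    obtain ⟨W, hW, hWb, hWo⟩ := 𝓝.elim (X b₀) (hX b₀ hb₀) Z hZ b₀ (hXb b₀ hb₀) hs'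
    have hWs : W star = 1 := by
      rw [hWo star fun h' => ?_, signComp_of_ne (by rw [hXs b₀ hb₀]; exact one_ne_zero), hXs b₀ hb₀]
      have := h'.2
      rw [hZs, hXs b₀ hb₀] at this
      exact absurd this (by decide)
    obtain ⟨b', hb', hX'⟩ := key' W hW hWs
    refine ⟨b', hb', ?_⟩
    have hne : b' ≠ b₀ := fun hne => by rw [hne, hWb, mul_zero] at hX'; exact zero_ne_one hX'
    have h0 := hX0 b₀ hb₀ b' hb' hne
    rwa [hWo b' fun h' => h'.1 h0, signComp_of_eq h0] at hX'
  classical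
  let C : α → SignType := fun e => if e = star then -1 else if e ∈ B then X e e else 0
  have hCs : C star = -1 := if_pos rfl
  have hCb : ∀ b ∈ B, C b = X b b := fun b hb => by
    change ite _ _ _ = _
    rw [if_neg (hsB b hb), if_pos hb]
  have hsupp : {e | C e ≠ 0} = insert star B := by
    ext e
    rw [Set.mem_ofPred_eq, Set.mem_insert_iff]
    by_cases hes : e = star
    · subst hes; simp [hCs]
    · by_cases heB : e ∈ B
      · simp [heB, hCb e heB, hXb e heB]
      · simp [hes, heB, C]
  have horth : ∀ Z ∈ 𝓝.covectors, SignOrthogonal C Z := by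
    have hpos : ∀ Z ∈ 𝓝.covectors, Z star = 1 → SignOrthogonal C Z := fun Z hZ hZs => by
      obtain ⟨b, hb, hb1⟩ := key' Z hZ hZs
      exact Or.inr ⟨⟨b, by rw [hCb b hb, hb1]⟩, star, by rw [hCs, hZs, mul_one]⟩
    intro Z hZ
    by_cases hz : Z star = 0
    · by_cases hB0 : ∃ b ∈ B, Z b ≠ 0
      · obtain ⟨b₀, hb₀, hne⟩ := hB0
        obtain ⟨b, hb, hb1⟩ := key0 Z hZ hz b₀ hb₀ hne
        obtain ⟨b', hb', hb1'⟩ := key0 (-Z) (𝓝.neg_mem Z hZ) (by simp [hz]) b₀ hb₀ (by simpa using hne)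
        refine Or.inr ⟨⟨b, by rw [hCb b hb, hb1]⟩, b', ?_⟩
        rw [hCb b' hb']
        rw [Pi.neg_apply, mul_neg] at hb1'
        rw [← hb1', neg_neg]
      · push Not at hB0
        refine Or.inl fun e => ?_
        by_cases he : C e = 0
        · rw [he, zero_mul]
        · rcases (Set.ext_iff.1 hsupp e).1 he with rfl | heB
          · rw [hz, mul_zero]
          · rw [hB0 e heB, mul_zero]
    · by_cases hz1 : Z star = 1
      · exact hpos Z hZ hz1
      · have := hpos (-Z) (𝓝.neg_mem Z hZ) (by
          rw [Pi.neg_apply, sign_eq_neg_of_ne hz one_ne_zero hz1, neg_neg])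
        simp only [SignOrthogonal, Pi.neg_apply, mul_neg, neg_inj] at this
        rcases this with h0 | ⟨⟨e, he⟩, f, hf⟩
        · exact Or.inl fun e => by rw [← neg_neg (C e * Z e), h0 e]; rfl
        · exact Or.inr ⟨⟨f, hf⟩, e, by rw [← he, neg_neg]⟩
  have hBi : 𝓝.IsIndep B := by
    have := hB.indep
    rw [← h.restrict_eq, Matroid.restrict_indep_iff] at this
    exact this.1
  have hsN : star ∉ B := fun hs => hsB star hs rfl
  refine ⟨C, ⟨?_, horth⟩, hsupp, hCs⟩
  rw [hsupp, Matroid.isCircuit_iff_dep_forall_sdiff_singleton_indep]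
  refine ⟨⟨fun hi => ?_, Set.insert_subset h.star_mem hBi.1⟩, ?_⟩
  · refine (matroid_indep_iff.1 hi).2 star (Set.mem_insert _ _) ?_
    rw [Set.insert_sdiff_self_of_notMem hsN]
    refine ⟨h.star_mem, fun Z hZ hZ0 => ?_⟩
    rw [h.eq_zero_of_isBase hB hZ hZ0]; rfl
  · rintro b (rfl | hb)
    · rw [Set.insert_sdiff_self_of_notMem hsN]; exact hBi
    · have h1 : insert star B \ {b} = insert star (B \ {b}) :=
        Set.insert_sdiff_of_notMem _ (by simpa using (hsB b hb).symm)
      rw [h1]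
      refine isIndep_insert (hBi.subset Set.sdiff_subset) h.star_mem ?_
      exact (notMem_cl_iff h.star_mem).2 ⟨X b, hX b hb, fun e he => hX0 b hb e he.1 he.2, by
        rw [hXs b hb]; exact one_ne_zero⟩

/-- The normalised signed circuit on `B ∪ star` is determined by the covectors that vanish on all
but one element of the basis. -/
theorem IsGeneralExtension.signedCircuit_apply (h : 𝓝.IsGeneralExtension star 𝓜) {B : Set α}
    {C : α → SignType} (hC : 𝓝.IsSignedCircuit C) (hsupp : {e | C e ≠ 0} = insert star B)
    (hs : C star = -1) {b : α} {X : α → SignType} (hX : X ∈ 𝓝.covectors)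
    (hX0 : ∀ e ∈ B, e ≠ b → X e = 0) (hXs : X star = 1) : C b = X b := by
  obtain ⟨⟨f, hf⟩, -⟩ := (hC.2 X hX).exists_of_ne (e := star) (by rw [hs, hXs]; decide)
  have hCf : C f ≠ 0 := fun h0 => by rw [h0, zero_mul] at hf; exact zero_ne_one hf
  have hXf : X f ≠ 0 := fun h0 => by rw [h0, mul_zero] at hf; exact zero_ne_one hf
  rcases (Set.ext_iff.1 hsupp f).1 hCf with rfl | hfB
  · rw [hs, hXs] at hf; exact absurd hf (by decide)
  · have : f = b := by
      by_contra hne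
      exact hXf (hX0 f hfB hne)
    subst this
    revert hf
    generalize C f = x, X f = y
    revert x y; decide

theorem IsGeneralExtension.mem_topesInBasis_iff (h : 𝓝.IsGeneralExtension star 𝓜) {B : Set α}
    (hB : 𝓜.matroid.IsBase B) {C : α → SignType} (hC : 𝓝.IsSignedCircuit C)
    (hsupp : {e | C e ≠ 0} = insert star B) (hs : C star = -1) {P : α → SignType} :
    P ∈ topesInBasis 𝓝 star 𝓜 B ↔ 𝓜.IsTope P ∧ ∀ b ∈ B, P b = C b := by
  refine and_congr_right fun _ => ⟨?_, fun hb => ⟨C, hC, hsupp, hs, hb⟩⟩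
  rintro ⟨C', hC', hsupp', hs', hb⟩ b hbB
  obtain ⟨X, hX, hX0, hXs, -⟩ := h.exists_covector_of_isBase hB hbB
  rw [hb b hbB, h.signedCircuit_apply hC' hsupp' hs' hX hX0 hXs,
    h.signedCircuit_apply hC hsupp hs hX hX0 hXs]

/-- The topes that agree with the signed circuit of a basis are bounded: orthogonality to the circuit
forces a nonzero face of `(+, P)` to be positive at `star`. -/
theorem IsGeneralExtension.topesInBasis_subset (h : 𝓝.IsGeneralExtension star 𝓜)
    (hl : 𝓜.matroid.Loopless) {B : Set α} (hB : 𝓜.matroid.IsBase B) (hBne : B.Nonempty) :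
    topesInBasis 𝓝 star 𝓜 B ⊆ boundedTopes 𝓝 star 𝓜 := by
  rintro P ⟨hP, C, hC, hsupp, hs, hPC⟩
  have hBE : B ⊆ 𝓜.E := hB.subset_ground
  -- a covector with signs `0` or `C b` on the basis has sign `+` at `star`, unless it is zero
  have key : ∀ Y ∈ 𝓝.covectors, Y ≠ 0 → (∀ b ∈ B, Y b = 0 ∨ Y b = C b) → Y star = 1 := by
    intro Y hY hne hYC
    obtain ⟨b, hb, hYb⟩ : ∃ b ∈ B, Y b ≠ 0 := by
      by_contra hcon
      push Not at hcon
      exact hne (h.eq_zero_of_isBase hB hY hcon)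
    have hCb : C b ≠ 0 := (Set.ext_iff.1 hsupp b).2 (Set.mem_insert_of_mem _ hb)
    obtain ⟨-, f, hf⟩ := (hC.2 Y hY).exists_of_ne (mul_ne_zero hCb hYb)
    have hCf : C f ≠ 0 := fun h0 => by rw [h0, zero_mul] at hf; exact absurd hf (by decide)
    rcases (Set.ext_iff.1 hsupp f).1 hCf with rfl | hfB
    · rw [hs] at hf
      revert hf
      generalize Y f = y
      revert y; decide
    · rcases hYC f hfB with h0 | h0 <;> rw [h0] at hf <;> exfalso <;>
        revert hf <;> generalize C f = c <;> revert c <;> decide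
  have hPs : ∀ e ∈ 𝓜.E, Function.update P star 1 e = P e := fun e he =>
    Function.update_of_ne (h.ne_star he) _ _
  obtain ⟨X, hX, hXP⟩ := h.exists_lift hP.1
  have hXE : ∀ e ∈ 𝓜.E, X e = P e := fun e he => hXP e (h.ne_star he)
  have hX1 : X star = 1 := by
    refine key X hX ?_ fun b hb => Or.inr (by rw [hXE b (hBE hb), hPC b hb])
    rintro rfl
    obtain ⟨f, hf⟩ := hBne
    exact hP.ne_zero hl (hBE hf) (hXE f (hBE hf)).symm
  have hXu : X = Function.update P star 1 := by
    ext e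
    by_cases he : e = star
    · rw [he, Function.update_self, hX1]
    · rw [Function.update_of_ne he, hXP e he]
  refine ⟨hP, isTope_of_forall_ne (hXu ▸ hX) fun e he => ?_, fun Y hY hne hYP => ?_⟩
  · rw [h.ground_eq] at he
    rcases he with rfl | he
    · rw [Function.update_self]; exact one_ne_zero
    · rw [hPs e he]; exact hP.ne_zero hl he
  · refine key Y hY hne fun b hb => ?_
    by_cases h0 : Y b = 0
    · exact Or.inl h0
    · exact Or.inr (by rw [hYP b h0, hPs b (hBE hb), hPC b hb])

end GeneralExtension

end OrientedMatroid

/-! ### Independence of the canonical forms of the bounded topes -/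

theorem eRank_contract_add_one {α : Type*} {M : Matroid α} {c : Set α} (hc : IsAtomFlat M c) :
    (M.contract c).eRank + 1 = M.eRank := by
  have h := eRk_contract_add M c (M.E \ c)
  rwa [hc.2, Set.sdiff_union_of_subset hc.1.subset_ground, M.eRk_ground, ← Matroid.contract_ground,
    (M.contract c).eRk_ground] at h

theorem IsTransversal.isBase {α : Type*} {M : Matroid α} [M.Loopless] {k : ℕ}
    {F : Fin (k + 1) → Set α} (hF : F ∈ flags M k) {u : Fin k → α} (hu : IsTransversal F u)
    (hr : M.eRank = k) : M.IsBase (Set.range u) := by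
  refine Matroid.isBase_iff_indep_closure_eq.2 ⟨hu.indep hF, ?_⟩
  have hcl := hu.closure_eq hF (Fin.last k)
  have h1 : {j : Fin k | j.castSucc < Fin.last k} = Set.univ := by
    ext j; simp [Fin.castSucc_lt_last]
  rwa [h1, Set.image_univ, flags_last_eq_ground hF hr] at hcl

theorem pair_mem_flags {α : Type*} {M : Matroid α} [M.Loopless] (hr : M.eRank = 1) :
    (![∅, M.E] : Fin 2 → Set α) ∈ flags M 1 := by
  refine ⟨fun i j hij => ?_, fun i => ?_⟩
  · fin_cases i <;> fin_cases j <;> simp_all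
  · fin_cases i
    · refine ⟨Matroid.isFlat_iff_closure_eq.2 ?_, by simp⟩
      simp [Matroid.closure_empty]
    · exact ⟨M.ground_isFlat, by simpa using hr⟩

namespace OrientedMatroid

section Walls

variable {α : Type*} {𝓜 : OrientedMatroid α}

/-- Reversing a tope on the zero set of one of its faces gives a tope. -/
theorem exists_opposite (hl : 𝓜.matroid.Loopless) {P Y : α → SignType} (hP : 𝓜.IsTope P)
    (hY : Y ∈ 𝓜.covectors) (hYP : IsSignFace Y P) :
    ∃ Q, 𝓜.IsTope Q ∧ IsSignFace Y Q ∧ (∀ e, Y e = 0 → Q e = -P e) ∧ ∀ e, Y e ≠ 0 → Q e = P e := by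
  have h1 : ∀ e, Y e = 0 → signComp Y (-P) e = -P e := fun e he => signComp_of_eq he
  have h2 : ∀ e, Y e ≠ 0 → signComp Y (-P) e = P e := fun e he => by
    rw [signComp_of_ne he, hYP e he]
  refine ⟨signComp Y (-P), isTope_of_forall_ne (𝓜.comp_mem _ hY _ (𝓜.neg_mem P hP.1))
    fun e he => ?_, fun e he => (signComp_of_ne he).symm, h1, h2⟩
  by_cases h0 : Y e = 0
  · rw [h1 e h0]; simpa using hP.ne_zero hl he
  · rw [h2 e h0]; exact hP.ne_zero hl he

/-- Topes with a common facet `Y` that agree at one zero of `Y` are equal. -/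
theorem eq_of_facet (hl : 𝓜.matroid.Loopless) {P Q Y : α → SignType} (hP : 𝓜.IsTope P)
    (hQ : 𝓜.IsTope Q) (hYP : IsSignFace Y P) (hYQ : IsSignFace Y Q)
    (hc : IsAtomFlat 𝓜.matroid (𝓜.zeroSet Y)) {e : α} (he : e ∈ 𝓜.zeroSet Y) (h : P e = Q e) :
    P = Q := by
  ext f
  by_cases hY : Y f = 0
  · by_cases hf : f ∈ 𝓜.E
    · have hcl : f ∈ 𝓜.cl (insert e ∅) := by
        have := isBasis_singleton_of_isAtomFlat hc he
        rw [insert_empty_eq, ← closure_eq_cl (by simpa using he.1)]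
        exact this.subset_closure ⟨hf, hY⟩
      have h1 := mul_eq_mul_of_mem_cl hcl hP.1 hQ.1 (fun _ h => h.elim) fun _ h => h.elim
      have h2 := hP.ne_zero hl he.1
      rw [← h] at h1
      revert h1 h2
      generalize P e = a, P f = b, Q f = c
      revert a b c; decide
    · rw [eq_zero_of_notMem hP.1 hf, eq_zero_of_notMem hQ.1 hf]
  · rw [← hYP f hY, hYQ f hY]

end Walls

section Independence

variable {α : Type*} [DecidableEq α] {𝓜 𝓝 : OrientedMatroid α} {star : α}

theorem IsGeneralExtension.contraction (h : 𝓝.IsGeneralExtension star 𝓜) {c : Set α}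
    (hc : IsAtomFlat 𝓜.matroid c) :
    (𝓝.contraction c).IsGeneralExtension star (𝓜.contraction c) := by
  have hcE : c ⊆ 𝓜.E := hc.1.subset_ground
  have hsc : star ∉ c := fun hs => h.star_notMem (hcE hs)
  refine ⟨fun hs => h.star_notMem hs.1, ?_, ?_, fun S hS => ?_⟩
  · change 𝓝.E \ c = insert star (𝓜.E \ c)
    rw [h.ground_eq, Set.insert_sdiff_of_notMem _ hsc]
  · have hu : ∀ (X : α → SignType) (f : α), f ∈ c → Function.update X star 0 f = X f :=
      fun X f hf =>
      Function.update_of_ne (fun h' : f = star => hsc (h' ▸ hf)) _ _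
    ext X
    change (X ∈ 𝓜.covectors ∧ ∀ f ∈ c, X f = 0) ↔ _
    rw [h.covectors_eq]
    constructor
    · rintro ⟨⟨Z, hZ, rfl⟩, h0⟩
      exact ⟨Z, ⟨hZ, fun f hf => by rw [← hu Z f hf]; exact h0 f hf⟩, rfl⟩
    · rintro ⟨Z, ⟨hZ, h0⟩, rfl⟩
      exact ⟨⟨Z, hZ, rfl⟩, fun f hf => (hu Z f hf).trans (h0 f hf)⟩
  · have hSE : S ∪ c ⊆ 𝓜.E := Set.union_subset (hS.trans Set.sdiff_subset) hcE
    rw [matroid_contraction hcE, matroid_contraction (hcE.trans h.subset_ground)]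
    have h1 := eRk_contract_add 𝓝.matroid c (insert star S)
    have h2 := eRk_contract_add 𝓝.matroid c S
    rw [h.eRk_eq hcE, hc.2] at h1 h2
    rw [Set.insert_union, h.general _ hSE, ← h2, ← eRank_contract_add_one hc,
      min_add_add_right] at h1
    exact ENat.add_left_injective_of_ne_top ENat.one_ne_top h1

/-- The tope induced by a bounded tope in the contraction by an atom of its face lattice is bounded,
unless the contraction has rank zero. -/
theorem IsGeneralExtension.indicator_mem_boundedTopes (h : 𝓝.IsGeneralExtension star 𝓜)
    (hl : 𝓜.matroid.Loopless) {P : α → SignType} (hP : P ∈ boundedTopes 𝓝 star 𝓜)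
    {c : Set α} (hc : IsFaceFlat 𝓜.matroid 𝓜.covectors P c) {e : α} (he : e ∈ 𝓜.E) (hec : e ∉ c) :
    cᶜ.indicator P ∈ boundedTopes (𝓝.contraction c) star (𝓜.contraction c) := by
  obtain ⟨hPt, hPs, hPb⟩ := hP
  refine ⟨hPt.contraction hc, ?_⟩
  obtain ⟨Y, hY, hYP, rfl⟩ := hc
  change e ∉ 𝓜.zeroSet Y at hec
  change (𝓝.contraction (𝓜.zeroSet Y)).IsTope
      (Function.update ((𝓜.zeroSet Y)ᶜ.indicator P) star 1) ∧
    (𝓝.contraction (𝓜.zeroSet Y)).IsBounded star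
      (Function.update ((𝓜.zeroSet Y)ᶜ.indicator P) star 1)
  rw [hPt.indicator_eq hY hYP]
  have hYe : Y e ≠ 0 := fun h0 => hec ⟨he, h0⟩
  have hes := h.ne_star he
  obtain ⟨Z, hZ, hZY⟩ := h.exists_lift hY
  have hface : ∀ X : α → SignType, (∀ f, f ≠ star → X f ≠ 0 → X f = P f) →
      (X star ≠ 0 → X star = 1) → IsSignFace X (Function.update P star 1) := by
    intro X h1 h2 f hf
    by_cases hfs : f = star
    · subst hfs; rw [Function.update_self, h2 hf]
    · rw [Function.update_of_ne hfs, h1 f hfs hf]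
  have hZP : ∀ f, f ≠ star → Z f ≠ 0 → Z f = P f := fun f hf h0 => by
    rw [hZY f hf] at h0 ⊢; exact hYP f h0
  -- the lift of the face is positive at `star`: otherwise some nonzero face of `(+, P)` vanishes there
  have hZs : Z star = 1 := by
    by_contra hne
    by_cases h0 : Z star = 0
    · refine hne (hPb Z hZ (fun hz => hYe ?_) (hface Z hZP fun h' => absurd h0 h'))
      rw [← hZY e hes, hz]; rfl
    · have hZs : Z star = -Function.update P star 1 star := by
        rw [Function.update_self]; exact sign_eq_neg_of_ne h0 one_ne_zero hne
      obtain ⟨W, hW, hWs, hWo⟩ := 𝓝.elim _ hPs.1 Z hZ star (by simp) hZs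
      have hWP : ∀ f, f ≠ star → W f = P f := by
        intro f hf
        have hcomp : signComp (Function.update P star 1) Z f = P f := by
          by_cases hPf : P f = 0
          · rw [signComp_of_eq (by rw [Function.update_of_ne hf, hPf]), hPf]
            by_contra h'
            exact h' ((hZP f hf h').trans hPf)
          · rw [signComp_of_ne (by rwa [Function.update_of_ne hf]), Function.update_of_ne hf]
        rw [hWo f, hcomp]
        rintro ⟨h1, h2⟩
        rw [Function.update_of_ne hf] at h1 h2
        have hZf : Z f ≠ 0 := by rw [h2]; simpa using h1
        rw [hZP f hf hZf] at h2
        revert h1 h2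
        generalize P f = x
        revert x; decide
      have := hPb W hW (fun hw => ?_) (hface W (fun f hf _ => hWP f hf) fun h' => absurd hWs h')
      · rw [hWs] at this; exact zero_ne_one this
      · refine hPt.ne_zero hl he ?_
        rw [← hWP e hes, hw]; rfl
  have hZu : Z = Function.update Y star 1 := by
    ext f
    by_cases hf : f = star
    · rw [hf, Function.update_self, hZs]
    · rw [Function.update_of_ne hf, hZY f hf]
  refine ⟨isTope_of_forall_ne ⟨hZu ▸ hZ, fun f hf => ?_⟩ fun f hf => ?_, fun X hX hne hXf => ?_⟩
  · rw [Function.update_of_ne (h.ne_star hf.1), hf.2]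
  · by_cases hfs : f = star
    · rw [hfs, Function.update_self]; exact one_ne_zero
    · rw [Function.update_of_ne hfs]
      intro h0
      have hfE := hf.1
      rw [h.ground_eq] at hfE
      exact hf.2 ⟨hfE.resolve_left hfs, h0⟩
  · refine hPb X hX.1 hne (hXf.trans ?_)
    refine hface _ (fun f hf h0 => ?_) fun _ => Function.update_self _ _ _
    rw [Function.update_of_ne hf] at h0 ⊢
    exact hYP f h0

/-- In rank at least two, some tope on the positive side of `star` is unbounded. -/
theorem IsGeneralExtension.exists_unbounded (h : 𝓝.IsGeneralExtension star 𝓜)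
    (hl : 𝓜.matroid.Loopless) (hr : 1 < 𝓜.matroid.eRank) :
    ∃ U ∈ 𝓝.covectors, (∀ e ∈ 𝓝.E, U e ≠ 0) ∧ U star = 1 ∧ ¬𝓝.IsBounded star U := by
  obtain ⟨e, he, V, hV, hVs, hVe⟩ : ∃ e ∈ 𝓜.E, ∃ V ∈ 𝓝.covectors, V star = 0 ∧ V e ≠ 0 := by
    by_contra hcon
    push Not at hcon
    have hsub : 𝓜.E ⊆ 𝓝.matroid.closure {star} := by
      rw [closure_eq_cl (by simpa using h.star_mem)]
      exact fun e he => ⟨h.subset_ground he, fun X hX h0 => hcon e he X hX (h0 star rfl)⟩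
    have h1 := 𝓝.matroid.eRk_mono hsub
    rw [h.eRk_eq subset_rfl, Matroid.eRk_closure_eq] at h1
    have h2 : 𝓜.matroid.eRk 𝓜.E = 𝓜.matroid.eRank := 𝓜.matroid.eRk_ground
    have h3 : 𝓝.matroid.eRk {star} ≤ 1 := 𝓝.matroid.eRk_singleton_le star
    rw [h2] at h1
    exact absurd (h1.trans h3) (not_le.2 hr)
  obtain ⟨W, hW, -, hWs⟩ := h.exists_star_eq_one (Set.empty_subset _) (by
    rw [Matroid.eRk_empty]; exact zero_lt_one.trans hr)
  obtain ⟨T₀, hT₀, hT₀z⟩ := exists_zeroSet_eq (𝓜 := 𝓜) (F := ∅) (by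
    rw [Matroid.isFlat_iff_closure_eq, Matroid.closure_empty, 𝓜.matroid.loops_eq_empty])
  obtain ⟨T, hT, hTT⟩ := h.exists_lift hT₀
  have hTne : ∀ f ∈ 𝓜.E, T f ≠ 0 := fun f hf h0 => by
    rw [hTT f (h.ne_star hf)] at h0
    exact (Set.eq_empty_iff_forall_notMem.1 hT₀z) f ⟨hf, h0⟩
  set X := signComp V (signComp W T) with hX
  have hXm : X ∈ 𝓝.covectors := 𝓝.comp_mem _ hV _ (𝓝.comp_mem _ hW _ hT)
  have hXs : X star = 1 := by
    rw [hX, signComp_of_eq hVs, signComp_of_ne (by rw [hWs]; exact one_ne_zero), hWs]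
  have hXne : ∀ f ∈ 𝓝.E, X f ≠ 0 := by
    intro f hf
    rw [h.ground_eq] at hf
    rcases hf with rfl | hf
    · rw [hXs]; exact one_ne_zero
    · by_cases hVf : V f = 0
      · rw [hX, signComp_of_eq hVf]
        by_cases hWf : W f = 0
        · rw [signComp_of_eq hWf]; exact hTne f hf
        · rwa [signComp_of_ne hWf]
      · rwa [hX, signComp_of_ne hVf]
  refine ⟨X, hXm, hXne, hXs, fun hb => ?_⟩
  have h1 := hb V hV (fun h0 => hVe (by rw [h0]; rfl)) fun f hf => (signComp_of_ne hf).symm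
  rw [hVs] at h1
  exact zero_ne_one h1

/-- In rank one, the bounded topes agree on every basis. -/
theorem IsGeneralExtension.eq_on_basis_of_rank_one (h : 𝓝.IsGeneralExtension star 𝓜) {e : α}
    (hB : 𝓜.matroid.IsBase {e}) : ∃ s, ∀ P ∈ boundedTopes 𝓝 star 𝓜, P e = s := by
  obtain ⟨C, hC, hsupp, hs⟩ := h.exists_isSignedCircuit hB
  refine ⟨C e, fun P hP => ?_⟩
  have he : e ≠ star := h.ne_star (hB.subset_ground rfl)
  obtain ⟨⟨f, hf⟩, -⟩ := (hC.2 _ hP.2.1.1).exists_of_ne (e := star) (by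
    rw [hs, Function.update_self]; decide)
  have hCf : C f ≠ 0 := fun h0 => by rw [h0, zero_mul] at hf; exact zero_ne_one hf
  rcases (Set.ext_iff.1 hsupp f).1 hCf with rfl | hfe
  · rw [hs, Function.update_self] at hf; exact absurd hf (by decide)
  · obtain rfl : f = e := hfe
    rw [Function.update_of_ne he] at hf
    revert hf
    generalize C f = x, P f = y
    revert x y; decide

/-- The linear relations among the signs of bounded topes on flags are inherited by the contraction
by an atom `c`; when these are trivial, the coefficients of the topes on both sides of a wall with
zero set `c` agree. -/
theorem IsGeneralExtension.eq_of_wall [Fintype α] (h : 𝓝.IsGeneralExtension star 𝓜)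
    (hl : 𝓜.matroid.Loopless) {k : ℕ} {χ : (Fin (k + 1) → α) → SignType} (hχ : 𝓜.IsChirotope χ)
    {n : (α → SignType) → ℤ} (hn : ∀ P, P ∉ boundedTopes 𝓝 star 𝓜 → n P = 0)
    (hf : ∀ F ∈ flags 𝓜.matroid (k + 1), ∑ P, n P * 𝓜.topeFlagVal χ P F = 0)
    {P Q Y : α → SignType} (hP : 𝓜.IsTope P) (hQ : 𝓜.IsTope Q) (hY : Y ∈ 𝓜.covectors)
    (hYP : IsSignFace Y P) (hYQ : IsSignFace Y Q) (hc : IsAtomFlat 𝓜.matroid (𝓜.zeroSet Y))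
    {e : α} (he : e ∈ 𝓜.zeroSet Y) (hQP : Q e = -P e) {e' : α} (he' : e' ∈ 𝓜.E) (hYe' : Y e' ≠ 0)
    (ih : ∀ n' : (α → SignType) → ℤ,
      (∀ P, P ∉ boundedTopes (𝓝.contraction (𝓜.zeroSet Y)) star (𝓜.contraction (𝓜.zeroSet Y)) →
        n' P = 0) →
      (∀ F ∈ flags (𝓜.contraction (𝓜.zeroSet Y)).matroid k,
        ∑ P, n' P * (𝓜.contraction (𝓜.zeroSet Y)).topeFlagVal (fun x => χ (Fin.snoc x e)) P F = 0) →
      n' Y = 0) : n P = n Q := by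
  classical
  set c := 𝓜.zeroSet Y with hcdef
  have hPe := hP.ne_zero hl he.1
  let A : (α → SignType) → Prop := fun R => IsFaceFlat 𝓜.matroid 𝓜.covectors R c
  let n' : (α → SignType) → ℤ := fun R => ∑ P, if A P ∧ cᶜ.indicator P = R then n P * (P e : ℤ) else 0
  have hn' : n' Y = 0 := by
    refine ih n' (fun R hR => Finset.sum_eq_zero fun P _ => ?_) fun F hF => ?_
    · by_cases hAP : A P ∧ cᶜ.indicator P = R
      · rw [if_pos hAP, hn P fun hb => hR ?_, zero_mul]
        rw [← hAP.2]
        exact h.indicator_mem_boundedTopes hl hb hAP.1 he' fun h0 => hYe' h0.2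
      · exact if_neg hAP
    · rw [matroid_contraction hc.1.subset_ground] at hF
      rw [← hf _ (flagCons_mem hc hF)]
      simp only [n', Finset.sum_mul]
      rw [Finset.sum_comm]
      refine Finset.sum_congr rfl fun P _ => ?_
      by_cases hAP : A P
      · simp only [hAP, true_and, ite_mul, zero_mul, Finset.sum_ite_eq, Finset.mem_univ, if_true]
        by_cases hb : P ∈ boundedTopes 𝓝 star 𝓜
        · have h1 := flagCons_one hc hF
          rw [topeFlagVal_succ hχ hb.1 (flagCons_mem hc hF) (by rwa [h1]) (e := e) (by rwa [h1]),
            flagTail_flagCons hc hF, h1, mul_assoc]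
        · rw [hn P hb, zero_mul, zero_mul, zero_mul]
      · simp only [hAP, false_and, if_false, zero_mul, Finset.sum_const_zero]
        rw [topeFlagVal_eq_zero, mul_zero]
        intro h'
        have h1 := h' 1
        rw [flagCons_one hc hF] at h1
        exact hAP h1
  have hne : P ≠ Q := fun h' => by
    rw [← h'] at hQP
    revert hQP hPe
    generalize P e = x
    revert x; decide
  have hind : ∀ R, 𝓜.IsTope R → IsSignFace Y R → A R ∧ cᶜ.indicator R = Y := fun R hR hYR =>
    ⟨⟨Y, hY, hYR, rfl⟩, hR.indicator_eq hY hYR⟩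
  change ∑ R, _ = (0 : ℤ) at hn'
  rw [Finset.sum_eq_add P Q hne, if_pos (hind P hP hYP), if_pos (hind Q hQ hYQ), hQP,
    SignType.coe_neg] at hn'
  · have : (n P - n Q) * (P e : ℤ) = 0 := by linear_combination hn'
    rcases mul_eq_zero.1 this with h0 | h0
    · exact sub_eq_zero.1 h0
    · exfalso
      revert h0 hPe
      generalize P e = x
      revert x; decide
  · rintro R - ⟨hRP, hRQ⟩
    by_cases hR : A R ∧ cᶜ.indicator R = Y
    · rw [if_pos hR, hn R, zero_mul]
      intro hb
      have hYR : IsSignFace Y R := fun f hf => by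
        have := congrFun hR.2 f
        rw [Set.indicator_of_mem (Set.mem_compl fun h0 : f ∈ c => hf h0.2)] at this
        exact this.symm
      by_cases hs : R e = P e
      · exact hRP (eq_of_facet hl hb.1 hP hYR hYP hc he hs)
      · refine hRQ (eq_of_facet hl hb.1 hQ hYR hYQ hc he ?_)
        rw [hQP]
        exact sign_eq_neg_of_ne (hb.1.ne_zero hl he.1) hPe hs
    · exact if_neg hR
  · exact fun h' => absurd (Finset.mem_univ _) h'
  · exact fun h' => absurd (Finset.mem_univ _) h'

/-- The signs of the bounded topes on flags are linearly independent. By induction on the rank, the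
coefficients of a relation agree on both sides of every wall; following walls from a bounded tope
towards an unbounded one, they all vanish. -/
theorem IsGeneralExtension.eq_zero_of_sum_eq_zero [Fintype α] (k : ℕ) {𝓜 𝓝 : OrientedMatroid α}
    (h : 𝓝.IsGeneralExtension star 𝓜) (hl : 𝓜.matroid.Loopless)
    (hr : 𝓜.matroid.eRank = (k + 1 : ℕ)) {χ : (Fin (k + 1) → α) → SignType} (hχ : 𝓜.IsChirotope χ)
    {n : (α → SignType) → ℤ} (hn : ∀ P, P ∉ boundedTopes 𝓝 star 𝓜 → n P = 0)
    (hf : ∀ F ∈ flags 𝓜.matroid (k + 1), ∑ P, n P * 𝓜.topeFlagVal χ P F = 0)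
    (P : α → SignType) : n P = 0 := by
  induction k generalizing 𝓜 𝓝 n P with
  | zero =>
    by_contra hne
    have hb : P ∈ boundedTopes 𝓝 star 𝓜 := by
      by_contra hb
      exact hne (hn P hb)
    have hF := pair_mem_flags (M := 𝓜.matroid) (by simpa using hr)
    obtain ⟨t, ht⟩ := exists_isTransversal hF
    have hB := ht.isBase hF hr
    have hface : ∀ R, 𝓜.IsTope R → 𝓜.IsFaceFlag R (![∅, 𝓜.matroid.E] : Fin 2 → Set α) := by
      intro R hR i
      fin_cases i
      · exact hR.isFaceFlat_empty hl
      · exact ⟨0, 𝓜.zero_mem, fun e he => absurd rfl he, by ext e; simp⟩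
    have hrange : Set.range t = {t 0} := by
      ext e
      simp only [Set.mem_range, Fin.exists_fin_one, Set.mem_singleton_iff, eq_comm, Fin.isValue]
    obtain ⟨s, hs⟩ := h.eq_on_basis_of_rank_one (hrange ▸ hB)
    have huniq : ∀ R ∈ boundedTopes 𝓝 star 𝓜, R = P := fun R hR =>
      eq_of_eq_on_transversal hF hr ht hR.1 hb.1 (hface R hR.1) (hface P hb.1) fun i => by
        rw [Fin.fin_one_eq_zero i, hs R hR, hs P hb]
    have hsum := hf _ hF
    rw [Finset.sum_eq_single P (fun R _ hRP => by
        rw [hn R fun hR => hRP (huniq R hR), zero_mul]) fun h' => absurd (Finset.mem_univ _) h',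
      topeFlagVal_eq hχ hF (hface P hb.1) ht] at hsum
    have hs0 := topeSign_ne_zero hχ (P := P) (ht.injective hF) hB fun i =>
      hb.1.ne_zero hl (hB.subset_ground (Set.mem_range_self i))
    refine (mul_ne_zero hne ?_) hsum
    revert hs0
    generalize topeSign χ P t = x
    revert x; decide
  | succ k ih =>
    obtain ⟨U, hU, hU0, hUs, hUb⟩ := h.exists_unbounded hl (by
      rw [hr]; exact_mod_cast Nat.succ_lt_succ (Nat.succ_pos k))
    by_cases hPt : 𝓜.IsTope P
    swap
    · exact hn P fun hb => hPt hb.1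
    induction hm : {e ∈ 𝓜.E | P e ≠ U e}.ncard using Nat.strong_induction_on generalizing P with
    | _ m ihm =>
      by_contra hne
      have hb : P ∈ boundedTopes 𝓝 star 𝓜 := by
        by_contra hb
        exact hne (hn P hb)
      set R := Function.update P star 1 with hR
      have hRm : R ∈ 𝓝.covectors := hb.2.1.1
      have hRs : R star = 1 := Function.update_self _ _ _
      have hRE : ∀ e ∈ 𝓜.E, R e = P e := fun e he => Function.update_of_ne (h.ne_star he) _ _
      have hPne : ∀ e ∈ 𝓜.E, P e ≠ 0 := fun e he => hPt.ne_zero hl he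
      have hUR : ∀ e, e ∉ {e ∈ 𝓜.E | P e ≠ U e} → U e = R e := by
        intro e he
        by_cases heE : e ∈ 𝓜.E
        · rw [hRE e heE]
          by_contra h0
          exact he ⟨heE, fun h1 => h0 h1.symm⟩
        · by_cases hes : e = star
          · rw [hes, hUs, hRs]
          · have heN : e ∉ 𝓝.E := by rw [h.ground_eq]; exact fun h' => h'.elim hes heE
            rw [eq_zero_of_notMem hU heN, eq_zero_of_notMem hRm heN]
      -- a facet of `(+, P)` inside the set of elements separating `P` from the unbounded tope
      obtain ⟨Y, hY, hYP, hYS, ⟨e, heS, hYe⟩, hYcl⟩ := exists_facet hRm hU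
        (fun hUP => hUb (hUP ▸ hb.2.2)) (fun e he => by rw [hRE e he.1]; exact hPne e he.1) hUR
      have hYs : Y star = 1 := (hYS star fun hs => h.star_notMem hs.1).trans hRs
      set Y₀ := Function.update Y star 0 with hY₀def
      have hY₀ : Y₀ ∈ 𝓜.covectors := h.update_mem hY
      have hY₀E : ∀ f ∈ 𝓜.E, Y₀ f = Y f := fun f hf => Function.update_of_ne (h.ne_star hf) _ _
      have hY₀P : IsSignFace Y₀ P := fun f hf => by
        have hfE := 𝓜.mem_E _ hY₀ f hf
        rw [hY₀E f hfE] at hf ⊢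
        rw [hYP f hf, hRE f hfE]
      have hzero : 𝓝.zeroSet Y = 𝓜.zeroSet Y₀ := by
        ext f
        constructor
        · rintro ⟨hfN, hf⟩
          rw [h.ground_eq] at hfN
          rcases hfN with rfl | hfE
          · rw [hYs] at hf; exact absurd hf one_ne_zero
          · exact ⟨hfE, by rw [hY₀E f hfE, hf]⟩
        · rintro ⟨hfE, hf⟩
          exact ⟨h.subset_ground hfE, by rw [← hY₀E f hfE, hf]⟩
      have hRz : 𝓝.zeroSet R = ∅ := by
        refine Set.eq_empty_of_forall_notMem ?_
        rintro f ⟨hfN, hf⟩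
        rw [h.ground_eq] at hfN
        rcases hfN with rfl | hfE
        · rw [hRs] at hf; exact one_ne_zero hf
        · rw [hRE f hfE] at hf; exact hPne f hfE hf
      have hc : IsAtomFlat 𝓜.matroid (𝓜.zeroSet Y₀) := by
        refine ⟨isFlat_zeroSet hY₀, ?_⟩
        rw [← h.eRk_eq fun f hf => hf.1, ← hzero, eRk_zeroSet_facet hRm hY hYP
          (by rw [hRE e heS.1]; exact hPne e heS.1) hYe (hYcl e heS hYe), hRz,
          Matroid.eRk_empty, zero_add]
      have hrc : (𝓜.contraction (𝓜.zeroSet Y₀)).matroid.eRank = (k + 1 : ℕ) := by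
        rw [matroid_contraction hc.1.subset_ground]
        have := eRank_contract_add_one hc
        rw [hr, Nat.cast_add _ 1, Nat.cast_one] at this
        exact ENat.add_left_injective_of_ne_top ENat.one_ne_top this
      obtain ⟨e', he', hYe'⟩ : ∃ e' ∈ 𝓜.E, Y₀ e' ≠ 0 := by
        by_contra hcon
        push Not at hcon
        have h1 := 𝓜.matroid.eRk_mono (show 𝓜.E ⊆ 𝓜.zeroSet Y₀ from fun f hf => ⟨hf, hcon f hf⟩)
        have h2 : 𝓜.matroid.eRk 𝓜.E = 𝓜.matroid.eRank := 𝓜.matroid.eRk_ground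
        rw [hc.2, h2, hr] at h1
        have h3 : k + 1 + 1 ≤ 1 := by exact_mod_cast h1
        omega
      obtain ⟨Q, hQ, hQY, hQ0, hQ1⟩ := exists_opposite hl hPt hY₀ hY₀P
      have he0 : e ∈ 𝓜.zeroSet Y₀ := ⟨heS.1, by rw [hY₀E e heS.1, hYe]⟩
      have hwall := h.eq_of_wall hl hχ hn hf hPt hQ hY₀ hY₀P hQY hc he0 (hQ0 e he0.2) he' hYe'
        fun n' hn' hf' => ih (h.contraction hc) (loopless_contraction hc.1) hrc
          (hχ.contraction hc he0) hn' hf' Y₀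
      refine hne (hwall.trans (ihm _ ?_ Q hQ rfl))
      rw [← hm]
      refine Set.ncard_lt_ncard ?_ (Set.toFinite _)
      refine Set.ssubset_iff_exists.2 ⟨fun f hf => ?_, e, heS, fun he => he.2 ?_⟩
      · by_cases h0 : Y₀ f = 0
        · by_contra hfS
          refine hPne f hf.1 ?_
          rw [← hRE f hf.1]
          exact (hYS f hfS).symm.trans ((hY₀E f hf.1).symm.trans h0)
        · exact ⟨hf.1, by rw [← hQ1 f h0]; exact hf.2⟩
      · rw [hQ0 e he0.2, sign_eq_neg_of_ne (hPne e heS.1) ?_ heS.2, neg_neg]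
        exact hU0 e (h.subset_ground heS.1)

end Independence

end OrientedMatroid

/-! ### The basis of canonical forms -/

theorem exists_perm_of_range_eq {α : Type*} {k : ℕ} {t u : Fin k → α} (hu : Function.Injective u)
    (h : Set.range u = Set.range t) : ∃ σ : Equiv.Perm (Fin k), u = t ∘ σ := by
  have h1 : ∀ i, ∃ j, t j = u i := fun i => by
    have : u i ∈ Set.range t := h ▸ Set.mem_range_self i
    exact this
  choose s hs using h1
  have hinj : Function.Injective s := fun i j hij => hu (by rw [← hs i, ← hs j, hij])
  exact ⟨Equiv.ofBijective s (Finite.injective_iff_bijective.1 hinj), funext fun i => (hs i).symm⟩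

theorem exists_enum_of_isBase {α : Type*} [Finite α] {M : Matroid α} {k : ℕ} (hr : M.eRank = k)
    {B : Set α} (hB : M.IsBase B) : ∃ b : Fin k → α, Function.Injective b ∧ Set.range b = B := by
  have h1 : B.ncard = k := by
    have h2 := hB.encard_eq_eRank
    rw [hr, ← (Set.toFinite B).cast_ncard_eq] at h2
    exact_mod_cast h2
  have := (Set.toFinite B).to_subtype
  let e := Finite.equivFinOfCardEq (α := B) (n := k) (by rw [← h1]; rfl)
  refine ⟨fun i => e.symm i, Subtype.val_injective.comp e.symm.injective, ?_⟩
  ext x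
  exact ⟨by rintro ⟨i, rfl⟩; exact (e.symm i).2, fun hx => ⟨e ⟨x, hx⟩, by simp⟩⟩

theorem osMk_wedge_eq_zero_of_not_isBase {α : Type*} {M : Matroid α} {k : ℕ}
    (hr : M.eRank = k) {u : Fin k → α}
    (h : ¬(Function.Injective u ∧ M.IsBase (Set.range u))) : osMk M (wedge u) = 0 := by
  by_cases hu : Function.Injective u
  · refine osMk_eq_zero (wedge_mem_osIdeal fun hi => h ⟨hu, ?_⟩)
    replace hi : M.Indep (Set.range u) := hi
    refine hi.isBase_of_eRk_ge (Set.finite_range u) ?_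
    rw [hr, hi.eRk_eq_encard, ← Set.image_univ, hu.encard_image, Set.encard_univ]
    simp
  · rw [wedge_eq_zero_of_not_injective hu, map_zero]

theorem sum_subtype_ite_eq {ι N : Type*} [AddCommMonoid N] [Fintype ι] {S T : Set ι}
    [Fintype T] [DecidablePred (· ∈ S)] (hST : S ⊆ T) (f : ι → N) :
    ∑ x : T, (if (x : ι) ∈ S then f x else 0) = ∑ x with x ∈ S, f x := by
  classical
  rw [← Finset.sum_subtype (Finset.univ.filter (· ∈ T)) (by simp)
    fun x => if x ∈ S then f x else 0, ← Finset.sum_filter, Finset.filter_filter]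
  refine Finset.sum_congr (Finset.ext fun x => ?_) fun _ _ => rfl
  simp only [Finset.mem_filter, Finset.mem_univ, true_and]
  exact ⟨fun h => h.2, fun h => ⟨hST h, h⟩⟩

namespace OrientedMatroid

section CanonicalBasis

theorem topeSign_mul_self {α : Type*} {k : ℕ} {χ : (Fin k → α) → SignType} {P : α → SignType}
    {u : Fin k → α} (h : topeSign χ P u ≠ 0) : (topeSign χ P u : ℤ) * (topeSign χ P u : ℤ) = 1 := by
  revert h
  generalize topeSign χ P u = x
  revert x; decide

variable {α : Type*} [DecidableEq α] [Finite α] {𝓜 𝓝 : OrientedMatroid α} {star : α}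

open Classical in
/-- The canonical forms of the topes that agree with the signed circuit of a basis sum to the monomial
of the basis, up to a sign. -/
theorem IsGeneralExtension.sum_canonicalForm_eq (h : 𝓝.IsGeneralExtension star 𝓜)
    (hl : 𝓜.matroid.Loopless) {k : ℕ} (hk : 1 ≤ k) (hr : 𝓜.matroid.eRank = k)
    {χ : (Fin k → α) → SignType}
    (hχ : 𝓜.IsChirotope χ) {b : Fin k → α} (hb : Function.Injective b)
    (hB : 𝓜.matroid.IsBase (Set.range b)) :
    ∃ s : ℤ, s * s = 1 ∧
      (∀ F ∈ flags 𝓜.matroid k, ∑ Q : boundedTopes 𝓝 star 𝓜,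
        (if (Q : α → SignType) ∈ topesInBasis 𝓝 star 𝓜 (Set.range b) then
          𝓜.topeFlagVal χ Q F else 0) = s * (flagMatrix F b).det) ∧
      ∑ Q : boundedTopes 𝓝 star 𝓜,
        (if (Q : α → SignType) ∈ topesInBasis 𝓝 star 𝓜 (Set.range b) then
          canonicalForm 𝓜 χ Q else 0) = s • ⟨osMk 𝓜.matroid (wedge b), osMk_wedge_mem b⟩ := by
  have := Fintype.ofFinite α
  obtain ⟨C, hC, hsupp, hs⟩ := h.exists_isSignedCircuit hB
  have hCb : ∀ i, C (b i) ≠ 0 := fun i =>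
    (Set.ext_iff.1 hsupp (b i)).2 (Set.mem_insert_of_mem _ (Set.mem_range_self i))
  have hsub := h.topesInBasis_subset hl hB ⟨b ⟨0, hk⟩, Set.mem_range_self _⟩
  have hval : ∀ F ∈ flags 𝓜.matroid k, ∑ Q : boundedTopes 𝓝 star 𝓜,
        (if (Q : α → SignType) ∈ topesInBasis 𝓝 star 𝓜 (Set.range b) then
          𝓜.topeFlagVal χ Q F else 0) = (topeSign χ C b : ℤ) * (flagMatrix F b).det := by
    intro F hF
    rw [sum_subtype_ite_eq hsub fun Q => 𝓜.topeFlagVal χ Q F]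
    refine sum_topeFlagVal_eq hχ hF hr hCb fun P => ?_
    rw [Finset.mem_filter, h.mem_topesInBasis_iff hB hC hsupp hs]
    simp
  refine ⟨topeSign χ C b, topeSign_mul_self (topeSign_ne_zero hχ hb hB hCb), hval, ?_⟩
  refine Subtype.ext (eq_of_flagRes_eq (Subtype.property _) (Subtype.property _) fun F hF => ?_)
  rw [Submodule.coe_smul, map_smul, flagRes_wedge hF, smul_eq_mul, ← hval F hF,
    AddSubmonoidClass.coe_finsetSum, map_sum]
  refine Finset.sum_congr rfl fun Q _ => ?_
  split_ifs
  · exact flagRes_canonicalForm hχ Q.2.1 hF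
  · exact map_zero _

theorem IsGeneralExtension.linearIndependent_canonicalForm (h : 𝓝.IsGeneralExtension star 𝓜)
    (hl : 𝓜.matroid.Loopless) {k : ℕ} (hk : 1 ≤ k) (hr : 𝓜.matroid.eRank = k)
    {χ : (Fin k → α) → SignType} (hχ : 𝓜.IsChirotope χ) :
    LinearIndependent ℤ fun P : boundedTopes 𝓝 star 𝓜 => canonicalForm 𝓜 χ P := by
  classical
  have := Fintype.ofFinite α
  obtain ⟨k, rfl⟩ := Nat.exists_eq_add_of_le' hk
  rw [Fintype.linearIndependent_iff]
  intro g hg P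
  let n : (α → SignType) → ℤ := fun Q => if hQ : Q ∈ boundedTopes 𝓝 star 𝓜 then g ⟨Q, hQ⟩ else 0
  have hnP : n P = g P := dif_pos P.2
  rw [← hnP]
  have hn : ∀ Q, Q ∉ boundedTopes 𝓝 star 𝓜 → n Q = 0 := fun Q hQ => dif_neg hQ
  refine h.eq_zero_of_sum_eq_zero k hl hr hχ hn (fun F hF => ?_) P
  have h1 := congrArg (flagRes _ 𝓜.matroid F ∘ₗ (osDegree 𝓜.matroid (k + 1)).subtype) hg
  rw [map_sum, map_zero] at h1
  rw [← h1]
  have h2 := sum_subtype_ite_eq (S := boundedTopes 𝓝 star 𝓜) subset_rfl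
    fun Q => n Q * 𝓜.topeFlagVal χ Q F
  rw [Finset.sum_filter_of_ne] at h2
  · rw [← h2]
    refine Finset.sum_congr rfl fun Q _ => ?_
    rw [if_pos Q.2, map_smul, smul_eq_mul, LinearMap.comp_apply, Submodule.subtype_apply,
      flagRes_canonicalForm hχ Q.2.1 hF]
    exact congrArg (· * _) (dif_pos Q.2)
  · intro Q _ hQ
    by_contra hQb
    refine hQ ?_
    rw [hn Q hQb, zero_mul]

theorem IsGeneralExtension.span_canonicalForm (h : 𝓝.IsGeneralExtension star 𝓜)
    (hl : 𝓜.matroid.Loopless) {k : ℕ} (hk : 1 ≤ k) (hr : 𝓜.matroid.eRank = k)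
    {χ : (Fin k → α) → SignType} (hχ : 𝓜.IsChirotope χ) :
    ⊤ ≤ Submodule.span ℤ (Set.range fun P : boundedTopes 𝓝 star 𝓜 => canonicalForm 𝓜 χ P) := by
  classical
  set S := Submodule.span ℤ (Set.range fun P : boundedTopes 𝓝 star 𝓜 => canonicalForm 𝓜 χ P)
  have hw : ∀ u : Fin k → α, (⟨osMk 𝓜.matroid (wedge u), osMk_wedge_mem u⟩ :
      osDegree 𝓜.matroid k) ∈ S := by
    intro u
    by_cases hu : Function.Injective u ∧ 𝓜.matroid.IsBase (Set.range u)
    · obtain ⟨s, hs, -, hsum⟩ := h.sum_canonicalForm_eq hl hk hr hχ hu.1 hu.2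
      have h1 := congrArg (s • ·) hsum
      simp only [smul_smul, hs, one_smul] at h1
      rw [← h1]
      refine S.smul_mem _ (S.sum_mem fun Q _ => ?_)
      split_ifs
      · exact Submodule.subset_span ⟨Q, rfl⟩
      · exact S.zero_mem
    · have : (⟨osMk 𝓜.matroid (wedge u), osMk_wedge_mem u⟩ : osDegree 𝓜.matroid k) = 0 :=
        Subtype.ext (osMk_wedge_eq_zero_of_not_isBase hr hu)
      rw [this]; exact S.zero_mem
  rintro ⟨x, hx⟩ -
  have key : x ∈ S.map (osDegree 𝓜.matroid k).subtype := by
    refine osDegree_induction (p := fun x => x ∈ S.map (osDegree 𝓜.matroid k).subtype)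
      (Submodule.zero_mem _) (fun x y => Submodule.add_mem _) (fun n x => Submodule.smul_mem _ n)
      (fun u => ⟨_, hw u, rfl⟩) hx
  obtain ⟨y, hy, rfl⟩ := key
  exact hy

/-- The basis of `A(M)` that consists of the canonical forms of the bounded topes. -/
def canonicalBasis (h : 𝓝.IsGeneralExtension star 𝓜)
    (hl : 𝓜.matroid.Loopless) {k : ℕ} (hk : 1 ≤ k) (hr : 𝓜.matroid.eRank = k)
    {χ : (Fin k → α) → SignType} (hχ : 𝓜.IsChirotope χ) :
    Module.Basis (boundedTopes 𝓝 star 𝓜) ℤ (osDegree 𝓜.matroid k) :=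
  Module.Basis.mk (h.linearIndependent_canonicalForm hl hk hr hχ)
    (h.span_canonicalForm hl hk hr hχ)

theorem canonicalBasis_apply (h : 𝓝.IsGeneralExtension star 𝓜)
    (hl : 𝓜.matroid.Loopless) {k : ℕ} (hk : 1 ≤ k) (hr : 𝓜.matroid.eRank = k)
    {χ : (Fin k → α) → SignType} (hχ : 𝓜.IsChirotope χ) (P : boundedTopes 𝓝 star 𝓜) :
    canonicalBasis h hl hk hr hχ P = canonicalForm 𝓜 χ P :=
  Module.Basis.mk_apply _ _ P

end CanonicalBasis

end OrientedMatroid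

/-! ### The intersection forms -/

section Weights

variable {α : Type*} {M : Matroid α}

open Classical in
/-- The indeterminate `a_e` for `e` in the ground set, and `0` otherwise. -/
def paramVar (M : Matroid α) (e : α) : ParamField M :=
  if h : e ∈ M.E then algebraMap (MvPolynomial M.E ℤ) _ (MvPolynomial.X ⟨e, h⟩) else 0

theorem paramVar_coe (e : M.E) :
    paramVar M e = algebraMap (MvPolynomial M.E ℤ) _ (MvPolynomial.X e) := dif_pos e.2

/-- A functional on `A^k(M)` with values in a field of characteristic zero, a divisible abelian group,
extends to the Orlik–Solomon algebra. -/
theorem exists_extension {k : ℕ} (ψ : osDegree M k →ₗ[ℤ] ParamField M) :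
    ∃ φ : OS M →ₗ[ℤ] ParamField M, ∀ x : osDegree M k, φ x = ψ x := by
  obtain ⟨φ, hφ⟩ := (Module.Baer.of_divisible (ParamField M)).extension_property
    (osDegree M k).subtype Subtype.val_injective ψ
  exact ⟨φ, fun x => LinearMap.congr_fun hφ x⟩

variable [Finite α]

open Classical in
theorem aSum_eq_sum [Fintype α] {S : Set α} (hS : S ⊆ M.E) :
    aSum M S = ∑ e, if e ∈ S then paramVar M e else 0 := by
  rw [aSum, map_sum, ← Finset.sum_filter]
  refine Finset.sum_bij (fun e _ => (e : α)) (fun e he => ?_) (fun e _ f _ h => Subtype.ext h)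
    (fun e he => ?_) fun e _ => (paramVar_coe e).symm
  · simpa [elemsIn] using he
  · rw [Finset.mem_filter] at he
    exact ⟨⟨e, hS he.2⟩, by simpa [elemsIn] using he.2, rfl⟩

theorem aProd_range {k : ℕ} {t : Fin k → α} (ht : Function.Injective t) (hE : Set.range t ⊆ M.E) :
    aProd M (Set.range t) = ∏ i, paramVar M (t i) := by
  rw [aProd, map_prod]
  symm
  refine Finset.prod_bij (fun i _ => ⟨t i, hE (Set.mem_range_self i)⟩) (fun i _ => ?_)
    (fun i _ j _ h => ht (congrArg Subtype.val h)) (fun e he => ?_)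
    fun i _ => paramVar_coe ⟨t i, hE (Set.mem_range_self i)⟩
  · simp [elemsIn]
  · obtain ⟨i, hi⟩ : (e : α) ∈ Set.range t := by simpa [elemsIn] using he
    exact ⟨i, Finset.mem_univ i, Subtype.ext hi⟩

theorem aSum_ne_zero {S : Set α} (hS : S ⊆ M.E) (hne : S.Nonempty) : aSum M S ≠ 0 := by
  obtain ⟨e, he⟩ := hne
  rw [aSum, Ne, FaithfulSMul.algebraMap_eq_zero_iff]
  intro h
  have h1 := congrArg (MvPolynomial.eval fun _ => (1 : ℤ)) h
  simp only [map_sum, MvPolynomial.eval_X, map_zero, Finset.sum_const, nsmul_eq_mul, mul_one,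
    Nat.cast_eq_zero, Finset.card_eq_zero] at h1
  have h2 : (⟨e, hS he⟩ : M.E) ∈ elemsIn M S := by simpa [elemsIn] using he
  rw [h1] at h2
  exact absurd h2 (Finset.notMem_empty _)

theorem flagWeight'_eq {k : ℕ} (F : Fin (k + 1) → Set α) :
    flagWeight' M F = ∏ i : Fin k, 1 / aSum M (F i.succ) := by
  rw [flagWeight', Finset.prod_filter, Fin.prod_univ_succ]
  simp [Fin.succ_ne_zero]

theorem flagWeight_eq {k : ℕ} (hk : 1 ≤ k) (hr : M.eRank = k) {F : Fin (k + 1) → Set α}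
    (hF : F ∈ flags M k) (hE : aSum M M.E ≠ 0) : flagWeight M F = aSum M M.E * flagWeight' M F := by
  have h0 : Fin.last k ≠ 0 := by
    rw [Ne, Fin.ext_iff, Fin.val_last, Fin.val_zero]; omega
  have h1 : (Finset.univ.filter fun i : Fin (k + 1) => i ≠ 0) =
      insert (Fin.last k) (Finset.univ.filter fun i => i ≠ 0 ∧ i ≠ Fin.last k) := by
    ext i
    simp only [Finset.mem_filter, Finset.mem_univ, true_and, Finset.mem_insert]
    by_cases hi : i = Fin.last k
    · subst hi; simpa using h0
    · simp [hi]
  rw [flagWeight', h1, Finset.prod_insert (by simp), flagWeight, flags_last_eq_ground hF hr,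
    ← mul_assoc, mul_one_div_cancel hE, one_mul]

theorem dRForm_eq {k : ℕ} (hk : 1 ≤ k) (hr : M.eRank = k) (hE : aSum M M.E ≠ 0)
    (x y : osDegree M k) : dRForm M k x y = aSum M M.E * dRForm' M k x y := by
  rw [dRForm, dRForm', Finset.mul_sum]
  refine Finset.sum_congr rfl fun F hF => ?_
  rw [flagWeight_eq hk hr ((Set.Finite.mem_toFinset _).1 hF) hE]
  ring

/-- The weights with which the generators in a flat `G` are averaged: `a_b / a_G`. -/
def averageWeight (M : Matroid α) (G : Set α) (b : α) : ParamField M :=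
  paramVar M b * (1 / aSum M G)

open Classical in
theorem sum_averageWeight [Fintype α] {G : Set α} (hG : M.IsFlat G) (hne : G.Nonempty) :
    (∑ b : α, if b ∈ G then averageWeight M G b else 0) = 1 := by
  simp only [averageWeight, ← ite_zero_mul]
  rw [← Finset.sum_mul, ← aSum_eq_sum hG.subset_ground,
    mul_one_div_cancel (aSum_ne_zero hG.subset_ground hne)]

open Classical in
/-- Only bases that are transversals of the flag have a nonzero residue along it, so that the sum over
the bases is a sum over the transversals. The order in which a basis is enumerated does not matter,
since it changes the signs of both the monomial and its residue. -/
theorem sum_isBase_eq_flagEval [Fintype α] [M.Loopless] {k : ℕ} (hr : M.eRank = k)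
    {F : Fin (k + 1) → Set α} (hF : F ∈ flags M k) (φ : ExtAlg α →ₗ[ℤ] ParamField M)
    {b : Set α → Fin k → α}
    (hb : ∀ B, M.IsBase B → Function.Injective (b B) ∧ Set.range (b B) = B) :
    (∑ B with M.IsBase B, aProd M B * φ (wedge (b B)) * ((flagMatrix F (b B)).det : ParamField M)) *
      flagWeight' M F = flagEval (averageWeight M) F φ := by
  rw [flagEval, ← Finset.sum_filter, ← Finset.sum_filter_of_ne
    (p := fun B => (flagMatrix F (b B)).det ≠ 0) fun B _ h h0 => h (by rw [h0]; simp),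
    Finset.sum_mul]
  symm
  have hperm : ∀ t : Fin k → α, IsTransversal F t → ∃ σ : Equiv.Perm (Fin k),
      b (Set.range t) = t ∘ σ := fun t ht =>
    exists_perm_of_range_eq (hb _ (ht.isBase hF hr)).1 (hb _ (ht.isBase hF hr)).2
  have hdet : ∀ t : Fin k → α, IsTransversal F t → ∀ σ : Equiv.Perm (Fin k),
      (flagMatrix F (t ∘ σ)).det = (Equiv.Perm.sign σ : ℤ) := fun t ht σ => by
    rw [det_flagMatrix_comp_perm, flagMatrix_transversal hF ht, Matrix.det_one, mul_one]
  refine Finset.sum_bij (fun t _ => Set.range t) (fun t ht => ?_) (fun t ht u hu htu => ?_)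
    (fun B hB => ?_) fun t ht => ?_
  · have ht' := (Finset.mem_filter.1 ht).2
    obtain ⟨σ, hσ⟩ := hperm t ht'
    simp only [Finset.mem_filter, Finset.mem_univ, true_and]
    refine ⟨ht'.isBase hF hr, ?_⟩
    rw [hσ, hdet t ht']
    exact Units.ne_zero _
  · have ht' := (Finset.mem_filter.1 ht).2
    have hu' := (Finset.mem_filter.1 hu).2
    funext i
    obtain ⟨j, hj⟩ : t i ∈ Set.range u := htu ▸ Set.mem_range_self i
    have hij : i = j := flags_step_unique hF (ht' i) (hj ▸ hu' j)
    rw [← hj, hij]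
  · simp only [Finset.mem_filter, Finset.mem_univ, true_and] at hB
    obtain ⟨σ, hσ⟩ := exists_perm_isTransversal hF hB.2
    refine ⟨b B ∘ σ, Finset.mem_filter.2 ⟨Finset.mem_univ _, hσ⟩, ?_⟩
    rw [σ.surjective.range_comp, (hb B hB.1).2]
  · have ht' := (Finset.mem_filter.1 ht).2
    obtain ⟨σ, hσ⟩ := hperm t ht'
    have hs : ((Equiv.Perm.sign σ : ℤ) : ParamField M) *
        ((Equiv.Perm.sign σ : ℤ) : ParamField M) = 1 := by
      rcases Int.units_eq_one_or (Equiv.Perm.sign σ) with h | h <;> simp [h]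
    rw [hσ, hdet t ht', wedge_comp_perm, map_smul, zsmul_eq_mul, flagWeight'_eq,
      aProd_range (ht'.injective hF) (ht'.isBase hF hr).subset_ground, smul_eq_mul]
    simp only [averageWeight, Finset.prod_mul_distrib]
    linear_combination (-(∏ i, paramVar M (t i)) * (∏ i, 1 / aSum M (F (Fin.succ i))) *
      φ (wedge t)) * hs

open Classical in
/-- The flag expansion of a functional on the Orlik–Solomon algebra with the weights `a_b / a_G`. -/
theorem sum_flagRes_mul_flagEval [Fintype α] [M.Loopless] {k : ℕ} (φ : OS M →ₗ[ℤ] ParamField M)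
    (x : osDegree M k) :
    ∑ F ∈ (Set.toFinite (flags M k)).toFinset,
      (flagRes k M F x : ParamField M) * flagEval (averageWeight M) F (φ ∘ₗ osMk M) = φ x := by
  obtain ⟨x, hx⟩ := x
  refine osDegree_induction (p := fun x => ∑ F ∈ (Set.toFinite (flags M k)).toFinset,
      (flagRes k M F x : ParamField M) * flagEval (averageWeight M) F (φ ∘ₗ osMk M) = φ x)
    (by simp) (fun x y hx hy => ?_) (fun n x hx => ?_) (fun u => ?_) hx
  · simp only [map_add, Int.cast_add, add_mul, Finset.sum_add_distrib, hx, hy]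
  · rw [map_smul φ n x, zsmul_eq_mul (φ x), ← hx, Finset.mul_sum]
    refine Finset.sum_congr rfl fun F _ => ?_
    rw [map_smul, smul_eq_mul, Int.cast_mul, mul_assoc]
  · have h := flag_expansion (fun G hG hne => sum_averageWeight hG hne) k (φ ∘ₗ osMk M)
      (fun x hx => by rw [LinearMap.comp_apply, osMk_eq_zero hx, map_zero]) u
    rw [LinearMap.comp_apply] at h
    rw [← h]
    refine Finset.sum_congr rfl fun F hF => ?_
    rw [flagRes_wedge ((Set.Finite.mem_toFinset _).1 hF), zsmul_eq_mul]

end Weights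

namespace OrientedMatroid

section Matrices

variable {α : Type*} [Finite α] {𝓜 𝓝 : OrientedMatroid α} {star : α}

open Classical in
/-- The homology form as a sum over all bases. -/
theorem dRHomForm_eq (P Q : α → SignType) [Fintype (Set α)] :
    dRHomForm 𝓝 star 𝓜 P Q = ∑ B with 𝓜.matroid.IsBase B,
      if P ∈ topesInBasis 𝓝 star 𝓜 B then
        if Q ∈ topesInBasis 𝓝 star 𝓜 B then aProd 𝓜.matroid B else 0
      else 0 := by
  simp only [← ite_and]
  rw [← Finset.sum_filter, Finset.filter_filter, dRHomForm]
  refine Finset.sum_congr (Finset.ext fun B => ?_) fun _ _ => rfl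
  rw [Set.Finite.mem_toFinset, Finset.mem_filter]
  simp

theorem aSum_ground_ne_zero {k : ℕ} (hk : 1 ≤ k) (hr : 𝓜.matroid.eRank = k) :
    aSum 𝓜.matroid 𝓜.E ≠ 0 := by
  obtain ⟨B, hB⟩ := 𝓜.matroid.exists_isBase
  obtain ⟨b, -, hb⟩ := exists_enum_of_isBase hr hB
  exact aSum_ne_zero subset_rfl
    ⟨b ⟨0, hk⟩, hB.subset_ground (hb ▸ Set.mem_range_self _)⟩

variable [DecidableEq α]

/-- The homology form is the inverse of the primed cohomology form. Let `φ` be the coordinate of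
`Ω_P` in the basis of canonical forms. As the monomial of a basis `B` is, up to a sign, the sum of
the `Ω_Q` over the topes `Q` in `topesInBasis`, the entry at `P, R` of the product is the sum of
`a^B φ(e_B) ⟨e_B, Ω_R⟩'` over the bases `B`, which is `φ(Ω_R)` by the flag expansion. -/
theorem IsGeneralExtension.dRHomMatrix_mul_dRMatrix' (h : 𝓝.IsGeneralExtension star 𝓜)
    (hl : 𝓜.matroid.Loopless) {k : ℕ} (hk : 1 ≤ k) (hr : 𝓜.matroid.eRank = k)
    {χ : (Fin k → α) → SignType} (hχ : 𝓜.IsChirotope χ) :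
    dRHomMatrix 𝓝 star 𝓜 * dRMatrix' 𝓝 star 𝓜 χ = 1 := by
  classical
  have := Fintype.ofFinite α
  set M := 𝓜.matroid with hM
  ext P R
  let β := canonicalBasis h hl hk hr hχ
  obtain ⟨φ, hφ⟩ := exists_extension
    ((Int.castAddHom (ParamField M)).toIntLinearMap ∘ₗ β.coord P)
  have hcoordΩ : ∀ Q : boundedTopes 𝓝 star 𝓜,
      β.coord P (canonicalForm 𝓜 χ Q) = if Q = P then 1 else 0 := by
    intro Q
    rw [← canonicalBasis_apply h hl hk hr hχ Q, Module.Basis.coord_apply, Module.Basis.repr_self,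
      Finsupp.single_apply]
  have hex : ∀ B : Set α, ∃ b : Fin k → α, M.IsBase B → Function.Injective b ∧ Set.range b = B := by
    obtain ⟨B₀, hB₀⟩ := M.exists_isBase
    obtain ⟨b₀, -⟩ := exists_enum_of_isBase hr hB₀
    intro B
    by_cases hB : M.IsBase B
    · obtain ⟨b, hb⟩ := exists_enum_of_isBase hr hB
      exact ⟨b, fun _ => hb⟩
    · exact ⟨b₀, fun h => absurd h hB⟩
  choose b hb using hex
  -- the value of `φ` on the monomial of a basis, and the sum of residues over its bounded part
  have hbasis : ∀ B, M.IsBase B → ∀ F ∈ flags M k,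
      (if (P : α → SignType) ∈ topesInBasis 𝓝 star 𝓜 B then
        ∑ Q : boundedTopes 𝓝 star 𝓜, (if (Q : α → SignType) ∈ topesInBasis 𝓝 star 𝓜 B then
          ((𝓜.topeFlagVal χ Q F : ℤ) : ParamField M) else 0) else 0) =
      φ (osMk M (wedge (b B))) * ((flagMatrix F (b B)).det : ParamField M) := by
    intro B hB F hF
    obtain ⟨hinj, hran⟩ := hb B hB
    obtain ⟨s, hs, hval, hsum⟩ := h.sum_canonicalForm_eq hl hk hr hχ hinj (by rw [hran]; exact hB)
    rw [hran] at hval hsum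
    have hcoord : φ (osMk M (wedge (b B))) =
        if (P : α → SignType) ∈ topesInBasis 𝓝 star 𝓜 B then (s : ParamField M) else 0 := by
      have h1 := congrArg (s • ·) hsum
      simp only [smul_smul, hs, one_smul] at h1
      have h2 : β.coord P (⟨osMk M (wedge (b B)), osMk_wedge_mem _⟩ : osDegree M k) =
          if (P : α → SignType) ∈ topesInBasis 𝓝 star 𝓜 B then s else 0 := by
        rw [← h1, map_smul, map_sum, Finset.sum_eq_single P]
        · split_ifs
          · rw [hcoordΩ, if_pos rfl, smul_eq_mul, mul_one]
          · rw [map_zero, smul_zero]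
        · intro Q _ hQ
          split_ifs
          · rw [hcoordΩ, if_neg hQ]
          · exact map_zero _
        · exact fun h' => absurd (Finset.mem_univ _) h'
      rw [hφ ⟨osMk M (wedge (b B)), osMk_wedge_mem _⟩, LinearMap.comp_apply, h2]
      split_ifs <;> simp
    have hval' := congrArg (Int.cast (R := ParamField M)) (hval F hF)
    rw [Int.cast_sum, Int.cast_mul] at hval'
    rw [hcoord]
    split_ifs with hP
    · rw [← hval']
      refine Finset.sum_congr rfl fun Q _ => ?_
      rw [Int.cast_ite, Int.cast_zero]
    · rw [zero_mul]
  have hres : ∀ Q : boundedTopes 𝓝 star 𝓜, ∀ F ∈ flags M k,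
      flagRes k M F (canonicalForm 𝓜 χ Q) = 𝓜.topeFlagVal χ Q F := fun Q F hF =>
    flagRes_canonicalForm hχ Q.2.1 hF
  have hentry : ∀ Q : boundedTopes 𝓝 star 𝓜, dRHomForm 𝓝 star 𝓜 P Q *
      dRForm' M k (canonicalForm 𝓜 χ Q) (canonicalForm 𝓜 χ R) =
      ∑ F ∈ (Set.toFinite (flags M k)).toFinset, ∑ B with M.IsBase B, aProd M B *
        (if (P : α → SignType) ∈ topesInBasis 𝓝 star 𝓜 B then
          if (Q : α → SignType) ∈ topesInBasis 𝓝 star 𝓜 B then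
            ((𝓜.topeFlagVal χ Q F : ℤ) : ParamField M) else 0 else 0) *
        (flagWeight' M F * (flagRes k M F (canonicalForm 𝓜 χ R) : ParamField M)) := by
    intro Q
    rw [dRHomForm_eq, dRForm', Finset.sum_mul_sum, Finset.sum_comm]
    refine Finset.sum_congr rfl fun F hF => Finset.sum_congr rfl fun B _ => ?_
    rw [hres Q F ((Set.Finite.mem_toFinset _).1 hF)]
    split_ifs <;> ring
  calc ∑ Q : boundedTopes 𝓝 star 𝓜, dRHomForm 𝓝 star 𝓜 P Q *
        dRForm' M k (canonicalForm 𝓜 χ Q) (canonicalForm 𝓜 χ R)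
      = ∑ F ∈ (Set.toFinite (flags M k)).toFinset,
          (flagRes k M F (canonicalForm 𝓜 χ R) : ParamField M) *
            flagEval (averageWeight M) F (φ ∘ₗ osMk M) := by
        rw [Finset.sum_congr rfl fun Q _ => hentry Q, Finset.sum_comm]
        refine Finset.sum_congr rfl fun F hF => ?_
        have hF' := (Set.Finite.mem_toFinset _).1 hF
        rw [Finset.sum_comm, ← sum_isBase_eq_flagEval hr hF' _ hb]
        refine Eq.trans ?_ ((mul_comm _ _).trans (mul_assoc _ _ _)).symm
        rw [Finset.sum_mul]
        refine Finset.sum_congr rfl fun B hB => ?_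
        rw [← Finset.sum_mul, ← Finset.mul_sum, LinearMap.comp_apply,
          mul_assoc (aProd M B) (φ (osMk M _)), ← hbasis B (Finset.mem_filter.1 hB).2 F hF']
        congr 2
        split_ifs
        · rfl
        · exact Finset.sum_const_zero
    _ = φ (canonicalForm 𝓜 χ R) := sum_flagRes_mul_flagEval φ _
    _ = (1 : Matrix (boundedTopes 𝓝 star 𝓜) (boundedTopes 𝓝 star 𝓜) (ParamField M)) P R := by
        rw [hφ, LinearMap.comp_apply, hcoordΩ, Matrix.one_apply]
        by_cases hRP : R = P
        · rw [if_pos hRP, if_pos hRP.symm]; simp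
        · rw [if_neg hRP, if_neg fun h' => hRP h'.symm]; simp

theorem dRMatrix_eq_smul {k : ℕ} (hk : 1 ≤ k) (hr : 𝓜.matroid.eRank = k)
    (χ : (Fin k → α) → SignType) :
    dRMatrix 𝓝 star 𝓜 χ = aSum 𝓜.matroid 𝓜.E • dRMatrix' 𝓝 star 𝓜 χ :=
  Matrix.ext fun _ _ => dRForm_eq hk hr (aSum_ground_ne_zero hk hr) _ _

end Matrices

end OrientedMatroid

end OMForms

end

theorem mainTheorem3 {α : Type*} [Finite α] [DecidableEq α]
    (𝓜 𝓝 : OMForms.OrientedMatroid α) (star : α) (hext : 𝓝.IsGeneralExtension star 𝓜)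
    (r : ℕ) (hr : 1 ≤ r) (hrank : 𝓜.matroid.eRank = r) (hloopless : 𝓜.matroid.Loopless)
    (χ : (Fin r → α) → SignType) (hχ : 𝓜.IsChirotope χ) :
    -- every tope has exactly one canonical form
    (∀ P, 𝓜.IsTope P → ∀ ω : OMForms.osDegree 𝓜.matroid r,
      OMForms.IsCanonicalForm r 𝓜.matroid 𝓜.covectors χ P ω ↔ ω = OMForms.canonicalForm 𝓜 χ P) ∧
    -- the canonical forms of the bounded topes are a basis of the top degree component
    (∃ b : Module.Basis (OMForms.boundedTopes 𝓝 star 𝓜) ℤ (OMForms.osDegree 𝓜.matroid r),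
      ∀ P, b P = OMForms.canonicalForm 𝓜 χ P) ∧
    -- `(1 / a_E) ⟨·,·⟩_dR` is the inverse of `⟨·,·⟩^dR`
    (OMForms.dRMatrix 𝓝 star 𝓜 χ *
        ((1 / OMForms.aSum 𝓜.matroid 𝓜.E) • OMForms.dRHomMatrix 𝓝 star 𝓜) = 1 ∧
      ((1 / OMForms.aSum 𝓜.matroid 𝓜.E) • OMForms.dRHomMatrix 𝓝 star 𝓜) *
        OMForms.dRMatrix 𝓝 star 𝓜 χ = 1) ∧
    -- `⟨·,·⟩_dR` is the inverse of the primed form `⟨·,·⟩'^dR`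
    (OMForms.dRMatrix' 𝓝 star 𝓜 χ * OMForms.dRHomMatrix 𝓝 star 𝓜 = 1 ∧
      OMForms.dRHomMatrix 𝓝 star 𝓜 * OMForms.dRMatrix' 𝓝 star 𝓜 χ = 1) := by
  have hinv := hext.dRHomMatrix_mul_dRMatrix' hloopless hr hrank hχ
  have hdR : ((1 / OMForms.aSum 𝓜.matroid 𝓜.E) • OMForms.dRHomMatrix 𝓝 star 𝓜) *
      OMForms.dRMatrix 𝓝 star 𝓜 χ = 1 := by
    rw [OMForms.OrientedMatroid.dRMatrix_eq_smul hr hrank, Matrix.smul_mul, Matrix.mul_smul,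
      smul_smul, one_div_mul_cancel (OMForms.OrientedMatroid.aSum_ground_ne_zero hr hrank),
      one_smul, hinv]
  exact ⟨fun P hP ω => OMForms.OrientedMatroid.isCanonicalForm_iff_eq_canonicalForm hχ hP ω,
    ⟨OMForms.OrientedMatroid.canonicalBasis hext hloopless hr hrank hχ,
      OMForms.OrientedMatroid.canonicalBasis_apply hext hloopless hr hrank hχ⟩,
    ⟨mul_eq_one_comm.1 hdR, hdR⟩, ⟨mul_eq_one_comm.1 hinv, hinv⟩⟩
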